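/- Let $AP$ be a set of atomic propositions. A finite Markov decision process (MDP) $G=(S,A,\Gamma,\delta,[\cdot])$ consists of a finite nonempty set $S$ of states, a finite set $A$ of actions, a map $\Gamma$ giving each state $s$ a nonempty set $\Gamma(s)\subseteq A$ of available actions, a transition function $\delta: S\times A\to \mathrm{Distr}(S)$ into the probability distributions on $S$, and a labelling $[\cdot]:S\to 2^{AP}$. Put $\mathrm{dest}(s,a)=\{t\in S\mid \delta(s,a)(t)>0\}$ and $$|\delta|=\sum_{s\in S}\sum_{a\in\Gamma(s)}|\mathrm{dest}(s,a)|.$$ A strategy $\sigma$ assigns to every nonempty finite sequence of states, with last state $s$, a probability distribution on $A$ supported in $\Gamma(s)$. A state $s$ and a strategy $\sigma$ determine a probability measure $\Pr_s^\sigma$ on plays $\omega=(s_0,s_1,\dots)\in S^\omega$ with $s_0=s$. Let $\mathrm{Outcome}(s,\sigma)$ be the set of feasible plays, that is, those with $s_0=s$ such that for every $k$ some $a\in\Gamma(s_k)$ has $\sigma(s_0,\dots,s_k)(a)>0$ and $\delta(s_k,a)(s_{k+1})>0$. The formulas $\psi$ of QRCTL are given by $$\psi ::= \mathsf{true}\mid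 q\mid\neg\psi\mid\psi\lor\psi\mid \exists^{m}(\varphi)\mid\forall^{m}(\varphi),\qquad \varphi::=\psi\mid\bigcirc\psi\mid\psi\,\mathcal U\,\psi\mid\psi\,\mathcal W\,\psi,$$ with $q\in AP$ and $m\in\{\mathrm{sure},\mathrm{almost},\mathrm{pos},\mathrm{null}\}$. A play $\omega=(s_0,s_1,\dots)$ satisfies $\psi$ if $s_0$ does; $\bigcirc\psi$ if $s_1\models\psi$; $\psi_1\,\mathcal U\,\psi_2$ if for some $j$ we have $s_j\models\psi_2$ and $s_i\models\psi_1$ for all $i<j$; and $\psi_1\,\mathcal W\,\psi_2$ if either $s_j\models\psi_1$ for all $j$, or for some $j$ we have $s_j\models\psi_2$ and $s_i\models\psi_1$ for all $i\le j$. Boolean connectives are interpreted as usual, and $s\models q$ iff $q\in[s]$. With $[\![\varphi]\!]$ the set of plays that satisfy $\varphi$, $s\models\exists^m(\varphi)$ (respectively $\forall^m(\varphi)$) means that for some (respectively every) strategy $\sigma$ * $\mathrm{Outcome}(s,\sigma)\subseteq[\![\varphi]\!]$, if $m=\mathrm{sure}$; * $\Pr_s^\sigma([\![\varphi]\!])=1$,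 if $m=\mathrm{almost}$; * $\Pr_s^\sigma([\![\varphi]\!])>0$, if $m=\mathrm{pos}$; * $\mathrm{Outcome}(s,\sigma)\cap[\![\varphi]\!]\neq\emptyset$, if $m=\mathrm{null}$. The length $\ell$ of $\psi$ is the number of its symbols (not counting parentheses). **Theorem.** There is an algorithm that, given a finite MDP $G$ and a QRCTL formula $\psi$, computes the set $[\![\psi]\!]_G=\{s\in S\mid s\models\psi\}$ in time $O(|S|\cdot|\delta|\cdot\ell)$, with an absolute constant. Here an algorithm is a single program for a unit-cost random access machine (constants, copying, addition, truncated subtraction, indirect load and store, jumps, jumps on zero; no multiplication). The input is the list of numbers consisting of $|S|$, the number of entries of a finite list of atomic propositions containing all those of $\psi$, $\ell$, the formula $\psi$ in prefix notation (one number per symbol, each atomic proposition being given by its position in the list), for each state the list of its available actions as lists of the elements of $\mathrm{dest}(s,a)$, each preceded by its length, and the $0/1$ table recording which listed propositions hold at which states. The output is the characteristic vector of $[\![\psi]\!]_G$. Moreover, during the run all numbers stored are bounded by a fixed power of the input length, so that they fit in words of logarithmically many bits. -/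

import Mathlib

open MeasureTheory ProbabilityTheory

universe u v w

/-! ## Markov decision processes -/

/-- A Markov decision process with states `S`, actions `Act`, atomic propositions `AP`. -/
structure MDP (S : Type u) (Act : Type v) (AP : Type w) where
  /-- the nonempty set of actions that can be chosen at a state -/
  mov : S → Finset Act
  mov_nonempty : ∀ s, (mov s).Nonempty
  /-- the next-state distribution of a state and an action -/
  trans : S → Act → PMF S
  /-- the set of atomic propositions that are true at a state -/
  label : S → Set AP

/-- The last state of a nonempty history `s₀, …, s_k`. -/
def lastState {S : Type u} {k : ℕ} (h : Finset.Iic k → S) : S :=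
  h ⟨k, Finset.mem_Iic.2 le_rfl⟩

namespace MDP

variable {S : Type u} {Act : Type v} {AP : Type w}

/-- The possible destinations of action `a` at state `s`. -/
def dest (G : MDP S Act AP) (s : S) (a : Act) : Set S := (G.trans s a).support

/-- The size `|δ|`: the sum over all states `s` and all `a ∈ mov s` of `|dest s a|`. -/
noncomputable def transSize [Fintype S] (G : MDP S Act AP) : ℕ :=
  ∑ s : S, ∑ a ∈ G.mov s, (G.dest s a).ncard

/-- A (randomized, history-dependent) player-1 strategy. A history `s₀, …, s_k` is a function on
`{0, …, k}`. -/
structure Strategy (G : MDP S Act AP) where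
  choice : (k : ℕ) → (Finset.Iic k → S) → PMF Act
  admissible : ∀ k h a, a ∈ (choice k h).support → a ∈ G.mov (lastState h)

/-- The feasible plays from `s` under the strategy `σ`. -/
def outcome (G : MDP S Act AP) (s : S) (σ : G.Strategy) : Set (ℕ → S) :=
  {ω | ω 0 = s ∧ ∀ k : ℕ, ∃ a ∈ G.mov (ω k),
    0 < σ.choice k (fun i : Finset.Iic k => ω i) a ∧ 0 < G.trans (ω k) a (ω (k + 1))}

section Probability

variable [Countable S] [MeasurableSpace S] [DiscreteMeasurableSpace S]

/-- The law of the next state, given the history, under the strategy `σ`. -/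
noncomputable def stepKernel (G : MDP S Act AP) (σ : G.Strategy) (k : ℕ) :
    Kernel (Finset.Iic k → S) S :=
  Kernel.ofFunOfCountable fun h =>
    ((σ.choice k h).bind fun a => G.trans (lastState h) a).toMeasure

instance (G : MDP S Act AP) (σ : G.Strategy) (k : ℕ) : IsMarkovKernel (G.stepKernel σ k) :=
  ⟨fun h => PMF.toMeasure.isProbabilityMeasure
    ((σ.choice k h).bind fun a => G.trans (lastState h) a)⟩

/-- The probability measure on plays that start from `s` and follow the strategy `σ`. -/
noncomputable def playMeasure (G : MDP S Act AP) (s : S) (σ : G.Strategy) : Measure (ℕ → S) :=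
  Kernel.traj (X := fun _ => S) (G.stepKernel σ) 0 (fun _ => s)

end Probability

end MDP

/-! ## The logic QRCTL -/

/-- The superscripts of the path quantifiers. -/
inductive QMode
  | sure
  | almost
  | pos
  | nullo

mutual

/-- State formulas of QRCTL. -/
inductive StateFormula (AP : Type w) : Type w
  | tt : StateFormula AP
  | atom : AP → StateFormula AP
  | neg : StateFormula AP → StateFormula AP
  | disj : StateFormula AP → StateFormula AP → StateFormula AP
  | ex : QMode → PathFormula AP → StateFormula AP
  | all : QMode → PathFormula AP → StateFormula AP

/-- The path formulas that a path quantifier of QRCTL may be applied to: a state formula, or one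
temporal operator applied to state formulas. -/
inductive PathFormula (AP : Type w) : Type w
  | state : StateFormula AP → PathFormula AP
  | next : StateFormula AP → PathFormula AP
  | until : StateFormula AP → StateFormula AP → PathFormula AP
  | wait : StateFormula AP → StateFormula AP → PathFormula AP

end

/-- A strategy `σ` satisfies the objective `A` from `s`, in the sense of a quantifier's
superscript. -/
def QMode.Holds {S : Type u} {Act : Type v} {AP : Type w} [Countable S] [MeasurableSpace S]
    [DiscreteMeasurableSpace S] (G : MDP S Act AP) (s : S) (σ : G.Strategy) (A : Set (ℕ → S)) :
    QMode → Prop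
  | .sure => G.outcome s σ ⊆ A
  | .almost => G.playMeasure s σ A = 1
  | .pos => 0 < G.playMeasure s σ A
  | .nullo => (G.outcome s σ ∩ A).Nonempty

section Semantics

variable {S : Type u} {Act : Type v} {AP : Type w} [Countable S] [MeasurableSpace S]
  [DiscreteMeasurableSpace S]

mutual

/-- `ψ.Sat G s`: the state formula `ψ` holds at the state `s` of `G`. -/
def StateFormula.Sat (G : MDP S Act AP) : StateFormula AP → S → Prop
  | .tt, _ => True
  | .atom q, s => q ∈ G.label s
  | .neg ψ, s => ¬ ψ.Sat G s
  | .disj ψ₁ ψ₂, s => ψ₁.Sat G s ∨ ψ₂.Sat G s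
  | .ex m φ, s => ∃ σ : G.Strategy, m.Holds G s σ {ω | φ.Sat G ω}
  | .all m φ, s => ∀ σ : G.Strategy, m.Holds G s σ {ω | φ.Sat G ω}

/-- `φ.Sat G ω`: the path formula `φ` holds on the play `ω`. -/
def PathFormula.Sat (G : MDP S Act AP) : PathFormula AP → (ℕ → S) → Prop
  | .state ψ, ω => ψ.Sat G (ω 0)
  | .next ψ, ω => ψ.Sat G (ω 1)
  | .until ψ₁ ψ₂, ω => ∃ j, ψ₂.Sat G (ω j) ∧ ∀ i < j, ψ₁.Sat G (ω i)
  | .wait ψ₁ ψ₂, ω => (∀ j, ψ₁.Sat G (ω j)) ∨ ∃ j, ψ₂.Sat G (ω j) ∧ ∀ i ≤ j, ψ₁.Sat G (ω i)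

end

end Semantics

section Length

variable {AP : Type w}

mutual

/-- The length of a state formula: the number of its symbols, without parentheses. -/
def StateFormula.length : StateFormula AP → ℕ
  | .tt => 1
  | .atom _ => 1
  | .neg ψ => ψ.length + 1
  | .disj ψ₁ ψ₂ => ψ₁.length + ψ₂.length + 1
  | .ex _ φ => φ.length + 1
  | .all _ φ => φ.length + 1

/-- The length of a path formula: the number of its symbols, without parentheses. -/
def PathFormula.length : PathFormula AP → ℕ
  | .state ψ => ψ.length
  | .next ψ => ψ.length + 1
  | .until ψ₁ ψ₂ => ψ₁.length + ψ₂.length + 1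
  | .wait ψ₁ ψ₂ => ψ₁.length + ψ₂.length + 1

end

mutual

/-- The atomic propositions that occur in a state formula. -/
def StateFormula.atoms : StateFormula AP → Set AP
  | .tt => ∅
  | .atom q => {q}
  | .neg ψ => ψ.atoms
  | .disj ψ₁ ψ₂ => ψ₁.atoms ∪ ψ₂.atoms
  | .ex _ φ => φ.atoms
  | .all _ φ => φ.atoms

/-- The atomic propositions that occur in a path formula. -/
def PathFormula.atoms : PathFormula AP → Set AP
  | .state ψ => ψ.atoms
  | .next ψ => ψ.atoms
  | .until ψ₁ ψ₂ => ψ₁.atoms ∪ ψ₂.atoms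
  | .wait ψ₁ ψ₂ => ψ₁.atoms ∪ ψ₂.atoms

end

end Length

/-! ## Random access machines -/

namespace RAM

/-- Instructions of a random access machine with registers `R₀, R₁, …` and memory cells
`M₀, M₁, …`, which hold natural numbers. There is no multiplication. -/
inductive Instr
  | const (d c : ℕ) : Instr     -- R_d := c
  | move (d a : ℕ) : Instr      -- R_d := R_a
  | add (d a b : ℕ) : Instr     -- R_d := R_a + R_b
  | sub (d a b : ℕ) : Instr     -- R_d := max (R_a - R_b) 0
  | load (d a : ℕ) : Instr      -- R_d := M_(R_a)
  | store (a b : ℕ) : Instr     -- M_(R_a) := R_b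
  | jump (l : ℕ) : Instr        -- go to instruction l
  | jumpZero (a l : ℕ) : Instr  -- if R_a = 0, go to instruction l

/-- A program is a finite list of instructions, numbered from `0`. -/
abbrev Program := List Instr

/-- A configuration: program counter, registers, memory. -/
structure Config where
  pc : ℕ
  reg : ℕ → ℕ
  mem : ℕ → ℕ

/-- The effect of one instruction; each takes one unit of time. -/
def Instr.exec (c : Config) : Instr → Config
  | .const d x => ⟨c.pc + 1, Function.update c.reg d x, c.mem⟩
  | .move d a => ⟨c.pc + 1, Function.update c.reg d (c.reg a), c.mem⟩
  | .add d a b => ⟨c.pc + 1, Function.update c.reg d (c.reg a + c.reg b), c.mem⟩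
  | .sub d a b => ⟨c.pc + 1, Function.update c.reg d (c.reg a - c.reg b), c.mem⟩
  | .load d a => ⟨c.pc + 1, Function.update c.reg d (c.mem (c.reg a)), c.mem⟩
  | .store a b => ⟨c.pc + 1, c.reg, Function.update c.mem (c.reg a) (c.reg b)⟩
  | .jump l => ⟨l, c.reg, c.mem⟩
  | .jumpZero a l => ⟨if c.reg a = 0 then l else c.pc + 1, c.reg, c.mem⟩

/-- The machine has halted if its program counter points outside the program. -/
def Halted (P : Program) (c : Config) : Prop := P.length ≤ c.pc

/-- One step of the machine; a halted configuration does not change. -/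
def step (P : Program) (c : Config) : Config :=
  match P[c.pc]? with
  | some i => i.exec c
  | none => c

/-- The initial configuration: the input stands in the memory cells from `0` on, and everything
else is `0`. -/
def init (input : List ℕ) : Config := ⟨0, fun _ => 0, fun i => input.getD i 0⟩

/-- The configuration after `t` steps on the given input. -/
def run (P : Program) (input : List ℕ) (t : ℕ) : Config := (step P)^[t] (init input)

/-- Every number in the registers and in the memory is at most `B`. -/
def Config.BoundedBy (c : Config) (B : ℕ) : Prop := ∀ i, c.reg i ≤ B ∧ c.mem i ≤ B

end RAM

/-! ## The input of a model checker -/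

/-- The code of a superscript. -/
def QMode.code : QMode → ℕ
  | .sure => 0
  | .almost => 1
  | .pos => 2
  | .nullo => 3

section Encoding

variable {S : Type u} {Act : Type v} {AP : Type w}

open Classical in
mutual

/-- A state formula as a word in prefix notation, one number for each symbol. An atomic
proposition is given by its position in the list `props`. -/
noncomputable def StateFormula.encode (props : List AP) : StateFormula AP → List ℕ
  | .tt => [0]
  | .atom q => [14 + props.idxOf q]
  | .neg ψ => 1 :: ψ.encode props
  | .disj ψ₁ ψ₂ => 2 :: (ψ₁.encode props ++ ψ₂.encode props)
  | .ex m φ => (6 + m.code) :: φ.encode props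
  | .all m φ => (10 + m.code) :: φ.encode props

/-- A path formula as a word in prefix notation. -/
noncomputable def PathFormula.encode (props : List AP) : PathFormula AP → List ℕ
  | .state ψ => ψ.encode props
  | .next ψ => 3 :: ψ.encode props
  | .until ψ₁ ψ₂ => 4 :: (ψ₁.encode props ++ ψ₂.encode props)
  | .wait ψ₁ ψ₂ => 5 :: (ψ₁.encode props ++ ψ₂.encode props)

end

open Classical in
/-- The destination set of action `a` at state `s`: its size, followed by the numbers of its
elements. -/
noncomputable def MDP.encodeDest {n : ℕ} (G : MDP S Act AP) (e : S ≃ Fin n) (s : S) (a : Act) :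
    List ℕ :=
  let l := (List.finRange n).filter fun j => e.symm j ∈ G.dest s a
  l.length :: l.map Fin.val

open Classical in
/-- The actions at state `s`: the number of available actions, followed by their destination
sets. -/
noncomputable def MDP.encodeState {n k : ℕ} (G : MDP S Act AP) (e : S ≃ Fin n) (f : Act ≃ Fin k)
    (s : S) : List ℕ :=
  let l := (List.finRange k).filter fun j => f.symm j ∈ G.mov s
  l.length :: l.flatMap fun j => G.encodeDest e s (f.symm j)

open Classical in
/-- The row of state `s` in the table of labels. -/
noncomputable def MDP.encodeLabel (G : MDP S Act AP) (props : List AP) (s : S) : List ℕ :=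
  props.map fun q => if q ∈ G.label s then 1 else 0

/-- The input: the number of states, the number of listed atomic propositions, the length of the
formula, the formula, the actions at each state, and the table of labels. States and actions are
numbered by `e` and `f`, and `props` lists atomic propositions. -/
noncomputable def encodeInput {n k : ℕ} (G : MDP S Act AP) (e : S ≃ Fin n) (f : Act ≃ Fin k)
    (props : List AP) (ψ : StateFormula AP) : List ℕ :=
  [n, props.length, ψ.length] ++ ψ.encode props
    ++ (List.finRange n).flatMap (fun i => G.encodeState e f (e.symm i))
    ++ (List.finRange n).flatMap (fun i => G.encodeLabel props (e.symm i))

end Encoding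

-- Semantics. For each superscript and temporal operator, the states that satisfy an existential
-- quantifier form a fixed point of a monotone map on sets of states (two nested ones for `pos` and
-- `W`), and |S| rounds of iteration reach it (`iterate_fixed_of_lt`). For `sure`, the objective A U
-- B gives the least fixed point of Y ↦ B ∪ (A ∩ pre Y), where pre Y asks for an action with all
-- destinations in Y; A W B gives the greatest fixed point of the same map with A ∩ B in place of B.
-- For `null`, one destination in Y suffices.
--
-- Every finite prefix of a feasible play has positive probability (`playMeasure_cyl_pos`). Hence
-- `pos` agrees with `null` for objectives that are decided in finite time (○ and U), and `almost`
-- agrees with `sure` for objectives whose complements are (○ and W). Two cases are genuinely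
-- probabilistic. For `almost` and U, the answer is the largest Y from each of whose states B can be
-- reached in A with actions that do not leave Y (`exists_almost_until`). For `pos` and W, it
-- consists of the states that can reach, inside A, the set where the objective can be ensured
-- surely (`exists_pos_wait`). Both rest on `ae_exists_notMem`: if every chosen action has a
-- destination outside a set or of smaller rank, then the set is left almost surely, because the
-- rank is bounded and the transition probabilities are bounded below.
--
-- Universal quantifiers reduce to existential ones by complement, which exchanges `sure` with
-- `null`, `almost` with `pos`, and U with W. A quantifier over a state formula has no effect, since
-- every strategy has an outcome and all its outcomes start at the given state.
--
-- Complexity. One round takes time O(|δ|): a pass over the edges finds the enabled actions, and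
-- then either a pass over the actions or a backward breadth-first search follows, which treats each
-- edge at most once (`wp_bfs`). Destination sets are nonempty, so |δ| bounds the numbers of states
-- and of actions. The formula is read from right to left with a stack of characteristic vectors,
-- and each symbol needs at most two iterations of |S| rounds.
--
-- Machine. The algorithm is written in a small structured language whose compilation is verified
-- once (`Cmd.Exec.goes`), with running times equal to numbers of machine steps. The right summand
-- of every addition and every constant is at most K, so t steps raise the largest number by at most
-- t * K. With K linear and t cubic in the input length, all numbers stay below a fixed power of
-- that length.

/-! ## Predecessor operators -/

namespace MDP

variable {S : Type u} {Act : Type v} {AP : Type w}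

/-- The states with an action all of whose destinations (or one of whose destinations) lie
in `Y`. -/
def pre (G : MDP S Act AP) (all : Bool) (Y : Set S) : Set S :=
  {s | ∃ a ∈ G.mov s, if all then G.dest s a ⊆ Y else (G.dest s a ∩ Y).Nonempty}

/-- The states in `B`, and the states in `A` that are in `G.pre all Y`. -/
def stepSet (G : MDP S Act AP) (all : Bool) (A B Y : Set S) : Set S := B ∪ A ∩ G.pre all Y

/-- The states from which `B` can be reached in `A` with actions that do not leave `Y`. -/
def reachSet (G : MDP S Act AP) (A B Y : Set S) : Set S :=
  {s | ∀ Z : Set S, B ⊆ Z → (∀ s ∈ A, (∃ a ∈ G.mov s, G.dest s a ⊆ Y ∧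
    (G.dest s a ∩ Z).Nonempty) → s ∈ Z) → s ∈ Z}

/-- One round of a fixed point computation. -/
def round (G : MDP S Act AP) (reach all : Bool) (A B Y : Set S) : Set S :=
  if reach then G.reachSet A B Y else G.stepSet all A B Y

end MDP

/-- Whether the superscript asks for probability one. -/
def QMode.strong : QMode → Bool
  | .sure => true
  | .almost => true
  | .pos => false
  | .nullo => false

/-- Whether the superscript is `almost`. -/
def QMode.isAlmost : QMode → Bool
  | .almost => true
  | _ => false

/-- Whether the superscript is not `null`. -/
def QMode.isNonnull : QMode → Bool
  | .nullo => false
  | _ => true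

/-- The dual superscript. -/
def QMode.dual : QMode → QMode
  | .sure => .nullo
  | .almost => .pos
  | .pos => .almost
  | .nullo => .sure

namespace MDP

variable {S : Type u} {Act : Type v} {AP : Type w}

/-- The computation for `∃ᵐ ○ A`. -/
def exNext (G : MDP S Act AP) (m : QMode) (A : Set S) : Set S := G.pre m.strong A

/-- The computation for `∃ᵐ (A U B)`, with `N` rounds. -/
def exUntil (G : MDP S Act AP) (N : ℕ) (m : QMode) (A B : Set S) : Set S :=
  (G.round m.isAlmost m.strong A B)^[N] (if m.isAlmost then Set.univ else ∅)

/-- The computation for `∃ᵐ (A W B)`, with `N` rounds for each fixed point. -/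
def exWait (G : MDP S Act AP) (N : ℕ) : QMode → Set S → Set S → Set S
  | .sure, A, B => (G.round false true A (A ∩ B))^[N] Set.univ
  | .almost, A, B => (G.round false true A (A ∩ B))^[N] Set.univ
  | .pos, A, B =>
    (G.round false false A ((G.round false true A (A ∩ B))^[N] Set.univ))^[N] ∅
  | .nullo, A, B => (G.round false false A (A ∩ B))^[N] Set.univ

/-- The computation for an existential quantifier and the temporal operator with number `op`. -/
def exOp (G : MDP S Act AP) (N op : ℕ) (m : QMode) (A B : Set S) : Set S :=
  if op = 0 then G.exNext m A else if op = 1 then G.exUntil N m A B else G.exWait N m A B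

/-- The computation for a universal quantifier and the temporal operator with number `op`. -/
def allOp (G : MDP S Act AP) (N op : ℕ) (m : QMode) (A B : Set S) : Set S :=
  if op = 0 then (G.exOp N 0 m.dual Aᶜ ∅)ᶜ else (G.exOp N (3 - op) m.dual Bᶜ Aᶜ)ᶜ

end MDP

/-! ## Plays and their probabilities -/

/-- The history of a play up to time `k`. -/
def hist {S : Type u} (ω : ℕ → S) (k : ℕ) : Finset.Iic k → S := fun i => ω i

/-- The plays that agree with `ω` up to time `k`. -/
def cyl {S : Type u} (ω : ℕ → S) (k : ℕ) : Set (ℕ → S) := {ω' | ∀ i ≤ k, ω' i = ω i}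

theorem hist_eq_iff {S : Type u} {ω ω' : ℕ → S} {k : ℕ} : hist ω' k = hist ω k ↔ ω' ∈ cyl ω k :=
  ⟨fun h i hi => congrFun h ⟨i, Finset.mem_Iic.2 hi⟩,
    fun h => funext fun i => h i (Finset.mem_Iic.1 i.2)⟩

theorem cyl_succ {S : Type u} (ω : ℕ → S) (k : ℕ) :
    cyl ω (k + 1) = cyl ω k ∩ {ω' | ω' (k + 1) = ω (k + 1)} := by
  ext ω'
  constructor
  · exact fun h => ⟨fun i hi => h i (by omega), h _ le_rfl⟩
  · rintro ⟨h1, h2⟩ i hi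
    rcases Nat.lt_succ_iff_lt_or_eq.1 (Nat.lt_succ_of_le hi) with h | rfl
    exacts [h1 i (by omega), h2]

theorem cyl_congr {S : Type u} {ω ω' : ℕ → S} {k : ℕ} (h : ω' ∈ cyl ω k) : cyl ω' k = cyl ω k := by
  ext ω''
  exact forall₂_congr fun i hi => by rw [h i hi]

namespace MDP

variable {S : Type u} {Act : Type v} {AP : Type w}

/-- The distribution of the next state. -/
noncomputable def stepPMF (G : MDP S Act AP) (σ : G.Strategy) (k : ℕ) (h : Finset.Iic k → S) :
    PMF S := (σ.choice k h).bind fun a => G.trans (lastState h) a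

theorem mem_support_stepPMF {G : MDP S Act AP} {σ : G.Strategy} {k : ℕ} {h : Finset.Iic k → S}
    {t : S} : t ∈ (G.stepPMF σ k h).support ↔
      ∃ a ∈ (σ.choice k h).support, t ∈ G.dest (lastState h) a := by
  simp [stepPMF, dest]

theorem mem_outcome {G : MDP S Act AP} {s : S} {σ : G.Strategy} {ω : ℕ → S} :
    ω ∈ G.outcome s σ ↔ ω 0 = s ∧ ∀ k, ω (k + 1) ∈ (G.stepPMF σ k (hist ω k)).support := by
  refine and_congr Iff.rfl (forall_congr' fun k => ?_)
  rw [mem_support_stepPMF]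
  constructor
  · rintro ⟨a, -, h1, h2⟩
    exact ⟨a, (PMF.mem_support_iff _ _).2 h1.ne', (PMF.mem_support_iff _ _).2 h2.ne'⟩
  · rintro ⟨a, h1, h2⟩
    exact ⟨a, σ.admissible _ _ a h1, pos_iff_ne_zero.2 ((PMF.mem_support_iff _ _).1 h1),
      pos_iff_ne_zero.2 ((PMF.mem_support_iff _ _).1 h2)⟩

variable [Fintype S] [MeasurableSpace S] [DiscreteMeasurableSpace S] {G : MDP S Act AP} {s : S}
  {σ : G.Strategy}

instance : IsProbabilityMeasure (G.playMeasure s σ) := by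
  unfold playMeasure; infer_instance

/-- The law of the pair of the history up to `k` and the next state is the product of the law of the
history with the step kernel. Together with `playMeasure_zero` and the total mass being one, this is
all that is used of the construction of the measure. -/
theorem lintegral_step (k : ℕ) (F : (Finset.Iic k → S) → ENNReal) (f : S → ENNReal) :
    ∫⁻ ω, F (hist ω k) * f (ω (k + 1)) ∂G.playMeasure s σ =
      ∫⁻ ω, F (hist ω k) * ∫⁻ t, f t ∂(G.stepPMF σ k (hist ω k)).toMeasure ∂G.playMeasure s σ := by
  have hF : Measurable F := measurable_of_finite _
  have hf : Measurable f := measurable_of_finite _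
  have hk : Measurable (Preorder.frestrictLe (π := fun _ : ℕ => S) k) :=
    Preorder.measurable_frestrictLe k
  have h1 := Kernel.partialTraj_compProd_eq_map_traj (X := fun _ => S) (κ := G.stepKernel σ)
    (Nat.zero_le k) (x₀ := fun _ => s)
  calc ∫⁻ ω, F (hist ω k) * f (ω (k + 1)) ∂G.playMeasure s σ
      = ∫⁻ q : (Finset.Iic k → S) × S, F q.1 * f q.2 ∂
          ((G.playMeasure s σ).map fun x => (Preorder.frestrictLe k x, x (k + 1))) := by
        rw [lintegral_map (by fun_prop) (by fun_prop)]
        rfl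
    _ = ∫⁻ h, ∫⁻ t, F h * f t ∂(G.stepPMF σ k h).toMeasure
          ∂(Kernel.partialTraj (X := fun _ => S) (G.stepKernel σ) 0 k fun _ => s) := by
        rw [playMeasure, ← h1, Measure.lintegral_compProd (by fun_prop)]
        rfl
    _ = ∫⁻ h, F h * ∫⁻ t, f t ∂(G.stepPMF σ k h).toMeasure
          ∂(Kernel.partialTraj (X := fun _ => S) (G.stepKernel σ) 0 k fun _ => s) := by
        simp only [lintegral_const_mul _ hf]
    _ = _ := by
        rw [← Kernel.traj_map_frestrictLe_apply, lintegral_map (measurable_of_finite _) hk]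
        rfl

theorem measurableSet_cyl (ω : ℕ → S) (k : ℕ) : MeasurableSet (cyl ω k) := by
  have : cyl ω k = ⋂ i ∈ Finset.Iic k, (fun ω' : ℕ → S => ω' i) ⁻¹' {ω i} := by
    ext; simp [cyl]
  rw [this]
  exact Finset.measurableSet_biInter _ fun i _ => measurable_pi_apply i (measurableSet_singleton _)

/-- This is `lintegral_step` for the indicators of one history and one state. -/
theorem playMeasure_cyl_succ (ω : ℕ → S) (k : ℕ) :
    G.playMeasure s σ (cyl ω (k + 1)) =
      G.playMeasure s σ (cyl ω k) * G.stepPMF σ k (hist ω k) (ω (k + 1)) := by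
  classical
  have h := lintegral_step (G := G) (s := s) (σ := σ) k
    (Set.indicator {hist ω k} 1) (Set.indicator {ω (k + 1)} 1)
  have e1 : ∀ ω', Set.indicator {hist ω k} (1 : (Finset.Iic k → S) → ENNReal) (hist ω' k) *
      Set.indicator {ω (k + 1)} (1 : S → ENNReal) (ω' (k + 1)) =
      (cyl ω (k + 1)).indicator 1 ω' := fun ω' => by
    rw [cyl_succ]
    simp only [Set.indicator, Set.mem_singleton_iff, hist_eq_iff, Set.mem_inter_iff,
      Set.mem_ofPred_eq]
    split_ifs <;> simp_all
  have e2 : ∀ ω', Set.indicator {hist ω k} (1 : (Finset.Iic k → S) → ENNReal) (hist ω' k) *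
      ∫⁻ t, Set.indicator {ω (k + 1)} (1 : S → ENNReal) t
        ∂(G.stepPMF σ k (hist ω' k)).toMeasure =
      (cyl ω k).indicator (fun _ => G.stepPMF σ k (hist ω k) (ω (k + 1))) ω' := fun ω' => by
    rw [lintegral_indicator_one (measurableSet_singleton _),
      PMF.toMeasure_apply_singleton _ _ (measurableSet_singleton _)]
    simp only [Set.indicator, Set.mem_singleton_iff, hist_eq_iff]
    split_ifs with h
    · rw [hist_eq_iff.2 h]; simp
    · simp
  simp only [e1, e2] at h
  rw [lintegral_indicator_one (measurableSet_cyl _ _),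
    lintegral_indicator_const (measurableSet_cyl _ _)] at h
  rw [h, mul_comm]

theorem playMeasure_zero : ∀ᵐ ω ∂G.playMeasure s σ, ω 0 = s := by
  have h := Kernel.traj_map_frestrictLe_apply (X := fun _ => S) (κ := G.stepKernel σ) 0 0
    fun _ => s
  rw [Kernel.partialTraj_self, Kernel.id_apply] at h
  have h1 : ∀ᵐ x ∂(Measure.dirac fun _ : Finset.Iic 0 => s), x ⟨0, by simp⟩ = s :=
    (ae_dirac_iff (MeasurableSet.of_discrete)).2 rfl
  rw [← h] at h1
  exact ae_of_ae_map (Preorder.measurable_frestrictLe 0).aemeasurable h1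

theorem ae_mem_outcome : ∀ᵐ ω ∂G.playMeasure s σ, ω ∈ G.outcome s σ := by
  classical
  simp only [mem_outcome, Filter.eventually_and, ae_all_iff]
  refine ⟨playMeasure_zero, fun k => ?_⟩
  -- The histories up to time `k` form a finite set, so the history can be fixed before the null set
  -- is chosen.
  have key : ∀ h : Finset.Iic k → S, ∀ᵐ ω ∂G.playMeasure s σ,
      hist ω k = h → ω (k + 1) ∈ (G.stepPMF σ k h).support := fun h => by
    have h1 := lintegral_step (G := G) (s := s) (σ := σ) k (Set.indicator {h} 1)
      (Set.indicator (G.stepPMF σ k h).supportᶜ 1)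
    have h2 : ∀ ω, Set.indicator {h} (1 : (Finset.Iic k → S) → ENNReal) (hist ω k) *
        ∫⁻ t, Set.indicator (G.stepPMF σ k h).supportᶜ (1 : S → ENNReal) t
          ∂(G.stepPMF σ k (hist ω k)).toMeasure = 0 := fun ω => by
      rw [lintegral_indicator_one MeasurableSet.of_discrete]
      by_cases hh : hist ω k = h
      · rw [hh, (PMF.toMeasure_apply_eq_zero_iff _ MeasurableSet.of_discrete).2
          disjoint_compl_right, mul_zero]
      · simp [hh]
    simp only [h2, lintegral_zero] at h1
    have hk : Measurable (Preorder.frestrictLe (π := fun _ : ℕ => S) k) :=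
      Preorder.measurable_frestrictLe k
    have hm : Measurable fun ω : ℕ → S =>
        Set.indicator {h} (1 : (Finset.Iic k → S) → ENNReal) (hist ω k) *
          Set.indicator (G.stepPMF σ k h).supportᶜ (1 : S → ENNReal) (ω (k + 1)) :=
      ((measurable_of_finite (Set.indicator {h} (1 : (Finset.Iic k → S) → ENNReal))).comp hk).mul
        ((measurable_of_finite (Set.indicator _ (1 : S → ENNReal))).comp
          (measurable_pi_apply (k + 1)))
    rw [lintegral_eq_zero_iff hm] at h1
    filter_upwards [h1] with ω h2 hh
    by_contra hc
    simp [hh, hc] at h2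
  filter_upwards [ae_all_iff.2 key] with ω hω using hω _ rfl

theorem playMeasure_cyl_zero_pos {ω : ℕ → S} (hω : ω 0 = s) : 0 < G.playMeasure s σ (cyl ω 0) := by
  have : G.playMeasure s σ (cyl ω 0) = 1 := by
    rw [← measure_univ (μ := G.playMeasure s σ)]
    refine measure_congr (Filter.eventuallyEq_univ.2 ?_)
    filter_upwards [playMeasure_zero] with ω' h i hi
    obtain rfl : i = 0 := by omega
    rw [h, hω]
  simp [this]

theorem playMeasure_cyl_succ_pos {ω : ℕ → S} {k : ℕ} (h : 0 < G.playMeasure s σ (cyl ω k))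
    (hω : ω (k + 1) ∈ (G.stepPMF σ k (hist ω k)).support) :
    0 < G.playMeasure s σ (cyl ω (k + 1)) := by
  rw [playMeasure_cyl_succ]
  exact ENNReal.mul_pos h.ne' ((PMF.mem_support_iff _ _).1 hω)

theorem playMeasure_cyl_pos {ω : ℕ → S} (hω : ω ∈ G.outcome s σ) (k : ℕ) :
    0 < G.playMeasure s σ (cyl ω k) := by
  rw [mem_outcome] at hω
  induction k with
  | zero => exact playMeasure_cyl_zero_pos hω.1
  | succ k ih => exact playMeasure_cyl_succ_pos ih (hω.2 k)

theorem playMeasure_cyl_update_pos {ω : ℕ → S} {k : ℕ} (h : 0 < G.playMeasure s σ (cyl ω k))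
    {t : S} (ht : t ∈ (G.stepPMF σ k (hist ω k)).support) :
    0 < G.playMeasure s σ (cyl (Function.update ω (k + 1) t) (k + 1)) := by
  have h1 : Function.update ω (k + 1) t ∈ cyl ω k := fun i hi =>
    Function.update_of_ne (by omega) _ _
  refine playMeasure_cyl_succ_pos (by rwa [cyl_congr h1]) ?_
  rwa [hist_eq_iff.2 h1, Function.update_self]

end MDP

-- Leaving a set of states almost surely

namespace MDP

variable {S : Type u} {Act : Type v} {AP : Type w} [Fintype S]

/-- Each `G.mov x` is a finset, so only finitely many positive transition probabilities matter, even
if `Act` is infinite. -/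
theorem exists_trans_ge (G : MDP S Act AP) :
    ∃ ε : ℝ, 0 < ε ∧ ε ≤ 1 ∧ ∀ x, ∀ a ∈ G.mov x, ∀ t ∈ G.dest x a,
      ENNReal.ofReal ε ≤ G.trans x a t := by
  classical
  let F : Finset ((_ : S) × Act × S) := Finset.univ.sigma fun x => (G.mov x) ×ˢ Finset.univ
  have h : ∃ c : ENNReal, 0 < c ∧ ∀ q ∈ F, G.trans q.1 q.2.1 q.2.2 ≠ 0 →
      c ≤ G.trans q.1 q.2.1 q.2.2 := by
    induction F using Finset.induction_on with
    | empty => exact ⟨1, by simp, by simp⟩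
    | insert q F _ ih =>
      obtain ⟨c, h0, h1⟩ := ih
      by_cases hq : G.trans q.1 q.2.1 q.2.2 = 0
      · refine ⟨c, h0, fun q' hq' hn => ?_⟩
        rcases Finset.mem_insert.1 hq' with rfl | h
        exacts [absurd hq hn, h1 q' h hn]
      · refine ⟨min c (G.trans q.1 q.2.1 q.2.2), lt_min h0 (pos_iff_ne_zero.2 hq),
          fun q' hq' hn => ?_⟩
        rcases Finset.mem_insert.1 hq' with rfl | h
        exacts [min_le_right _ _, (min_le_left _ _).trans (h1 q' h hn)]
  obtain ⟨c, h0, h1⟩ := h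
  -- The cap at 1 makes the bound finite and yields `ε ≤ 1`.
  have hc : min c 1 ≠ ⊤ := ((min_le_right _ _).trans_lt ENNReal.one_lt_top).ne
  refine ⟨(min c 1).toReal, ENNReal.toReal_pos (lt_min h0 one_pos).ne' hc,
    ENNReal.toReal_le_of_le_ofReal zero_le_one (by simp), fun x a ha t ht => ?_⟩
  rw [ENNReal.ofReal_toReal hc]
  exact (min_le_left _ _).trans
    (h1 ⟨x, a, t⟩ (by simp [F, ha]) ((PMF.mem_support_iff _ _).1 ht))

variable [MeasurableSpace S] [DiscreteMeasurableSpace S] {G : MDP S Act AP} {s : S}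
  {σ : G.Strategy}

/-- The law of the next state is an average over the chosen actions, and each of them gives `L` mass
at least `c`. -/
theorem le_stepPMF {k : ℕ} {h : Finset.Iic k → S} {c : ENNReal} {L : Set S}
    (hL : ∀ a ∈ (σ.choice k h).support, ∃ t ∈ L, c ≤ G.trans (lastState h) a t) :
    c ≤ (G.stepPMF σ k h).toMeasure L := by
  rw [stepPMF, PMF.toMeasure_bind_apply _ _ _ MeasurableSet.of_discrete]
  calc c = ∑' a, σ.choice k h a * c := by rw [ENNReal.tsum_mul_right, PMF.tsum_coe, one_mul]
    _ ≤ _ := ENNReal.tsum_le_tsum fun a => ?_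
  by_cases ha : σ.choice k h a = 0
  · simp [ha]
  · obtain ⟨t, ht, h⟩ := hL a ((PMF.mem_support_iff _ _).2 ha)
    refine mul_le_mul_right (h.trans ?_) _
    rw [← PMF.toMeasure_apply_singleton _ t (measurableSet_singleton t)]
    exact measure_mono (by simpa using ht)

open Classical in
/-- If in `T` the rank decreases with positive probability or `T` is left, then `T` is left almost
surely. -/
theorem ae_exists_notMem (T : Set S) (r : S → ℕ)
    (hr : ∀ k (h : Finset.Iic k → S), lastState h ∈ T → ∀ a ∈ (σ.choice k h).support,
      ∃ t ∈ G.dest (lastState h) a, t ∈ T → r t < r (lastState h)) :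
    ∀ᵐ ω ∂G.playMeasure s σ, ∃ k, ω k ∉ T := by
  obtain ⟨ε, hε, hε1, hG⟩ := exists_trans_ge G
  obtain ⟨R, hR⟩ : ∃ R, ∀ x, r x ≤ R :=
    ⟨Finset.univ.sup r, fun x => Finset.le_sup (Finset.mem_univ x)⟩
  set δ := ε / 2 with hδ
  have hδ0 : 0 < δ := by positivity
  have hδ1 : δ ≤ 1 / 2 := by linarith
  have hδ1' : δ ≤ 1 := by linarith
  -- The potential vanishes outside `T` and is at least 1/2 on `T`. It grows towards 1 with the rank
  -- so slowly that a decrease of the rank with probability `ε` outweighs every possible increase: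
  -- its expectation shrinks by the factor `c < 1` in each step taken from `T`.
  let g : S → ENNReal := fun x => if x ∈ T then ENNReal.ofReal (1 - δ ^ (r x + 1)) else 0
  let c : ENNReal := ENNReal.ofReal (1 - δ ^ (R + 1))
  have hstep : ∀ k (h : Finset.Iic k → S), lastState h ∈ T →
      ∫⁻ t, g t ∂(G.stepPMF σ k h).toMeasure ≤ c * g (lastState h) := by
    intro k h hx
    set x := lastState h
    set L : Set S := {t | t ∈ T → r t < r x}
    -- A state of `L` lies outside `T` or satisfies `r t + 1 ≤ r x`; either way its potential is at
    -- most `1 - δ ^ r x`.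
    have h1 : ∀ t, g t + L.indicator (fun _ => ENNReal.ofReal (δ ^ r x)) t ≤ 1 := by
      intro t
      have hp : 0 ≤ δ ^ (r t + 1) := by positivity
      have hq : δ ^ (r t + 1) ≤ 1 := pow_le_one₀ hδ0.le hδ1'
      by_cases ht : t ∈ T
      · by_cases hl : r t < r x
        · rw [Set.indicator_of_mem (show t ∈ L from fun _ => hl)]
          simp only [g, if_pos ht]
          rw [← ENNReal.ofReal_add (by linarith) (by positivity), ENNReal.ofReal_le_one]
          linarith [pow_le_pow_of_le_one hδ0.le hδ1' (show r t + 1 ≤ r x from hl)]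
        · rw [Set.indicator_of_notMem (show t ∉ L from fun h => hl (h ht)), add_zero]
          simp only [g, if_pos ht]
          rw [ENNReal.ofReal_le_one]
          linarith
      · simp only [g, if_neg ht, zero_add]
        refine (Set.indicator_le_self _ _ _).trans ?_
        rw [ENNReal.ofReal_le_one]
        exact pow_le_one₀ hδ0.le hδ1'
    have h2 : ENNReal.ofReal ε ≤ (G.stepPMF σ k h).toMeasure L := le_stepPMF fun a ha => by
      obtain ⟨t, ht, htr⟩ := hr k h hx a ha
      exact ⟨t, htr, hG _ a (σ.admissible _ _ _ ha) t ht⟩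
    have h3 : ∫⁻ t, g t ∂(G.stepPMF σ k h).toMeasure +
        ENNReal.ofReal (δ ^ r x) * ENNReal.ofReal ε ≤ 1 := by
      calc _ ≤ ∫⁻ t, g t ∂(G.stepPMF σ k h).toMeasure +
            ∫⁻ t, L.indicator (fun _ => ENNReal.ofReal (δ ^ r x)) t
              ∂(G.stepPMF σ k h).toMeasure := by
            rw [lintegral_indicator_const MeasurableSet.of_discrete]
            gcongr
        _ = ∫⁻ t, (g t + L.indicator (fun _ => ENNReal.ofReal (δ ^ r x)) t)
              ∂(G.stepPMF σ k h).toMeasure := (lintegral_add_left (measurable_of_finite _) _).symm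
        _ ≤ ∫⁻ _, 1 ∂(G.stepPMF σ k h).toMeasure := lintegral_mono h1
        _ = 1 := by simp
    -- Here `δ = ε / 2` matters. The loss is twice `δ ^ (r x + 1)`: one half is the deficit of the
    -- potential at `x`, the other pays for the factor `c`, since `δ ^ (R + 1) ≤ δ ^ (r x + 1)`.
    have hy : δ ^ r x * ε = 2 * δ ^ (r x + 1) := by rw [pow_succ, hδ]; ring
    have hy0 : δ ^ (R + 1) ≤ δ ^ (r x + 1) :=
      pow_le_pow_of_le_one hδ0.le hδ1' (by have := hR x; omega)
    have hy1 : δ ^ (r x + 1) ≤ 1 := pow_le_one₀ hδ0.le hδ1'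
    have hy2 : 0 < δ ^ (R + 1) := by positivity
    rw [← ENNReal.ofReal_mul (by positivity), hy] at h3
    simp only [g, if_pos hx, c]
    rw [← ENNReal.ofReal_mul (by linarith)]
    calc _ ≤ 1 - ENNReal.ofReal (2 * δ ^ (r x + 1)) := ENNReal.le_sub_of_add_le_right ENNReal.ofReal_ne_top h3
      _ = ENNReal.ofReal (1 - 2 * δ ^ (r x + 1)) := by
        rw [ENNReal.ofReal_sub _ (by positivity), ENNReal.ofReal_one]
      _ ≤ _ := ENNReal.ofReal_le_ofReal (by nlinarith)
  let F : ∀ k : ℕ, (Finset.Iic k → S) → ENNReal := fun k h => if ∀ i, h i ∈ T then 1 else 0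
  have hF : ∀ k ω, F k (hist ω k) = if ∀ i ≤ k, ω i ∈ T then 1 else 0 := fun k ω => by
    simp only [F]
    exact if_congr ⟨fun h i hi => h ⟨i, Finset.mem_Iic.2 hi⟩,
      fun h i => h i (Finset.mem_Iic.1 i.2)⟩ rfl rfl
  have hE : ∀ k, ∫⁻ ω, F k (hist ω k) * g (ω k) ∂G.playMeasure s σ ≤ c ^ k := by
    intro k
    induction k with
    | zero =>
      calc _ ≤ ∫⁻ _, 1 ∂G.playMeasure s σ := lintegral_mono fun ω => ?_
        _ = c ^ 0 := by simp
      have : g (ω 0) ≤ 1 := by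
        simp only [g]
        split_ifs
        · rw [ENNReal.ofReal_le_one]
          linarith [pow_pos hδ0 (r (ω 0) + 1)]
        · exact zero_le
      rw [hF]
      split_ifs <;> simp [this]
    | succ k ih =>
      calc _ = ∫⁻ ω, F k (hist ω k) * g (ω (k + 1)) ∂G.playMeasure s σ := by
            congr 1
            ext1 ω
            rw [hF, hF]
            by_cases h : ω (k + 1) ∈ T
            · congr 2
              refine propext ⟨fun h i hi => h i (by omega), fun h' i hi => ?_⟩
              rcases Nat.lt_succ_iff_lt_or_eq.1 (Nat.lt_succ_of_le hi) with h1 | rfl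
              exacts [h' i (by omega), h]
            · simp [g, h]
        _ = ∫⁻ ω, F k (hist ω k) * ∫⁻ t, g t ∂(G.stepPMF σ k (hist ω k)).toMeasure
              ∂G.playMeasure s σ := lintegral_step k _ _
        _ ≤ ∫⁻ ω, c * (F k (hist ω k) * g (ω k)) ∂G.playMeasure s σ := by
            refine lintegral_mono fun ω => ?_
            rw [hF]
            split_ifs with h
            · simp only [one_mul]
              exact hstep k (hist ω k) (h k le_rfl)
            · simp
        _ = c * ∫⁻ ω, F k (hist ω k) * g (ω k) ∂G.playMeasure s σ :=
            lintegral_const_mul' _ _ ENNReal.ofReal_ne_top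
        _ ≤ c * c ^ k := by gcongr
        _ = c ^ (k + 1) := (pow_succ' c k).symm
  have hM : MeasurableSet {ω : ℕ → S | ∀ i, ω i ∈ T} := by
    rw [Set.ofPred_forall]
    exact MeasurableSet.iInter fun i => measurable_pi_apply i MeasurableSet.of_discrete
  -- On the event of staying in `T` forever, the potential at time `k` is at least 1/2.
  have hle : ∀ k, ENNReal.ofReal (1 / 2) * G.playMeasure s σ {ω | ∀ i, ω i ∈ T} ≤ c ^ k := by
    refine fun k => le_trans ?_ (hE k)
    rw [← lintegral_indicator_const hM]
    refine lintegral_mono fun ω => ?_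
    rw [hF]
    by_cases h : ∀ i, ω i ∈ T
    · rw [Set.indicator_of_mem (show ω ∈ {ω : ℕ → S | ∀ i, ω i ∈ T} from h),
        if_pos fun i _ => h i, one_mul]
      simp only [g, if_pos (h k)]
      refine ENNReal.ofReal_le_ofReal ?_
      have : δ ^ (r (ω k) + 1) ≤ δ := pow_le_of_le_one hδ0.le hδ1' (by omega)
      linarith
    · rw [Set.indicator_of_notMem (show ω ∉ {ω : ℕ → S | ∀ i, ω i ∈ T} from h)]
      exact zero_le
  have hc : c < 1 := by
    rw [← ENNReal.ofReal_one]
    refine (ENNReal.ofReal_lt_ofReal_iff one_pos).2 ?_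
    linarith [pow_pos hδ0 (R + 1)]
  have h0 := ge_of_tendsto' (ENNReal.tendsto_pow_atTop_nhds_zero_of_lt_one hc) hle
  have h1 : G.playMeasure s σ {ω | ∀ i, ω i ∈ T} = 0 := by
    rcases mul_eq_zero.1 (le_antisymm h0 zero_le) with h | h
    · exact absurd h (by simp)
    · exact h
  rw [ae_iff]
  simpa using h1

end MDP

/-! ### Iteration of monotone maps on finite sets -/

section Iterate

variable {S : Type u} {F : Set S → Set S}

/-- An iteration that stalls once stalls forever. If it has not stalled by step `N`, then `ν` has
increased strictly `N + 1` times, which exceeds its bound. -/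
theorem iterate_fixed_of_lt {α : Type*} {F : α → α} {x : α} {N : ℕ} (ν : α → ℕ) (hν : ∀ y, ν y ≤ N)
    (h : ∀ i, F^[i + 1] x ≠ F^[i] x → ν (F^[i] x) < ν (F^[i + 1] x)) :
    F (F^[N] x) = F^[N] x := by
  by_contra hne
  rw [← Function.iterate_succ_apply' F N x] at hne
  have hne' : ∀ i ≤ N, F^[i + 1] x ≠ F^[i] x := fun i hi he => by
    obtain ⟨j, rfl⟩ := Nat.exists_eq_add_of_le hi
    rw [Function.iterate_succ_apply'] at he
    have hj : ∀ j, F^[j] (F^[i] x) = F^[i] x := fun j => Function.iterate_fixed he j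
    apply hne
    rw [show (i + j).succ = (j + 1) + i by omega, Function.iterate_add_apply, hj,
      show i + j = j + i by omega, Function.iterate_add_apply, hj]
  have key : ∀ i ≤ N + 1, i ≤ ν (F^[i] x) := fun i => by
    induction i with
    | zero => simp
    | succ i ih =>
      intro hi
      have h1 := ih (by omega)
      have h2 := h i (hne' i (by omega))
      omega
  have := key (N + 1) le_rfl
  have := hν (F^[N + 1] x)
  omega

theorem iterate_empty_mono (hF : Monotone F) : Monotone fun i => F^[i] ∅ :=
  hF.monotone_iterate_of_le_map (Set.empty_subset _)

theorem iterate_univ_anti (hF : Monotone F) : Antitone fun i => F^[i] Set.univ :=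
  hF.antitone_iterate_of_map_le (Set.subset_univ _)

theorem iterate_empty_subset (hF : Monotone F) {Y : Set S} (hY : F Y ⊆ Y) (i : ℕ) :
    F^[i] ∅ ⊆ Y := by
  induction i with
  | zero => exact Set.empty_subset _
  | succ i ih => rw [Function.iterate_succ_apply']; exact (hF ih).trans hY

variable [Fintype S] {N : ℕ}

theorem iterate_empty_fixed (hF : Monotone F) (hN : Fintype.card S = N) :
    F (F^[N] ∅) = F^[N] ∅ := by
  refine iterate_fixed_of_lt Set.ncard (fun y => ?_) fun i hi =>
    Set.ncard_lt_ncard ((iterate_empty_mono hF (Nat.le_succ i)).ssubset_of_ne hi.symm)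
      (Set.toFinite _)
  rw [← hN, ← Nat.card_eq_fintype_card, ← Set.ncard_univ]
  exact Set.ncard_le_ncard (Set.subset_univ y) (Set.toFinite _)

theorem iterate_univ_fixed (hF : Monotone F) (hN : Fintype.card S = N) :
    F (F^[N] Set.univ) = F^[N] Set.univ := by
  refine iterate_fixed_of_lt (fun Y => Yᶜ.ncard) (fun y => ?_) fun i hi =>
    Set.ncard_lt_ncard (compl_lt_compl_iff_lt.2
      ((iterate_univ_anti hF (Nat.le_succ i)).ssubset_of_ne hi)) (Set.toFinite _)
  rw [← hN, ← Nat.card_eq_fintype_card, ← Set.ncard_univ]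
  exact Set.ncard_le_ncard (Set.subset_univ _) (Set.toFinite _)

end Iterate

namespace MDP

variable {S : Type u} {Act : Type v} {AP : Type w} {G : MDP S Act AP} {s : S} {σ : G.Strategy}

/-! ### Memoryless strategies -/

/-- `y` is a possible successor of `x`. -/
def Edge (G : MDP S Act AP) (x y : S) : Prop := ∃ a ∈ G.mov x, y ∈ G.dest x a

theorem edge_of_mem_outcome {ω : ℕ → S} (h : ω ∈ G.outcome s σ) (k : ℕ) :
    G.Edge (ω k) (ω (k + 1)) := by
  obtain ⟨a, h1, h2⟩ := mem_support_stepPMF.1 ((mem_outcome.1 h).2 k)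
  exact ⟨a, σ.admissible _ _ a h1, h2⟩

/-- The strategy only looks at the present state. -/
def Strategy.Memoryless (σ : G.Strategy) : Prop :=
  ∀ k h k' h', lastState h = lastState h' → σ.choice k h = σ.choice k' h'

/-- There is a memoryless strategy that chooses an action with the given property in `Z`, and that
chooses all actions with positive probability elsewhere. -/
theorem exists_strategy (G : MDP S Act AP) (Z : Set S) (P : S → Act → Prop)
    (h : ∀ x ∈ Z, ∃ a ∈ G.mov x, P x a) :
    ∃ σ : G.Strategy, σ.Memoryless ∧
      (∀ k h, lastState h ∈ Z → ∀ a ∈ (σ.choice k h).support, P (lastState h) a) ∧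
      ∀ k h, lastState h ∉ Z → ∀ a ∈ G.mov (lastState h), a ∈ (σ.choice k h).support := by
  classical
  have h' : ∀ x, ∃ a ∈ G.mov x, x ∈ Z → P x a := fun x => by
    by_cases hx : x ∈ Z
    · obtain ⟨a, h1, h2⟩ := h x hx
      exact ⟨a, h1, fun _ => h2⟩
    · obtain ⟨a, ha⟩ := G.mov_nonempty x
      exact ⟨a, ha, fun h => absurd h hx⟩
  choose d hd hP using h'
  refine ⟨⟨fun k h => if lastState h ∈ Z then PMF.pure (d (lastState h)) else
    PMF.uniformOfFinset (G.mov (lastState h)) (G.mov_nonempty _), fun k h a ha => ?_⟩,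
    fun k h k' h' he => by simp only [he], fun k h hZ a ha => ?_, fun k h hZ a ha => ?_⟩
  · by_cases hZ : lastState h ∈ Z
    · rw [if_pos hZ, PMF.support_pure, Set.mem_singleton_iff] at ha
      exact ha ▸ hd _
    · rwa [if_neg hZ, PMF.mem_support_uniformOfFinset_iff] at ha
  · simp only [if_pos hZ, PMF.support_pure, Set.mem_singleton_iff] at ha
    exact ha ▸ hP _ hZ
  · simpa only [if_neg hZ, PMF.mem_support_uniformOfFinset_iff] using ha

/-- Putting a state in front of a play shifts all histories by one. A memoryless strategy does not
notice the shift, so each later step remains possible. -/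
theorem Strategy.Memoryless.cons (hσ : σ.Memoryless) {x : S} {ω : ℕ → S}
    (hω : ω ∈ G.outcome (ω 0) σ) {a : Act} {k : ℕ} {h : Finset.Iic k → S} (hx : lastState h = x)
    (ha : a ∈ (σ.choice k h).support) (ht : ω 0 ∈ G.dest x a) :
    (fun i => Nat.casesOn i x ω : ℕ → S) ∈ G.outcome x σ := by
  refine mem_outcome.2 ⟨rfl, fun i => mem_support_stepPMF.2 ?_⟩
  cases i with
  | zero => exact ⟨a, by rwa [hσ 0 _ k h (by rw [hx]; rfl)], ht⟩
  | succ i =>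
    obtain ⟨b, h1, h2⟩ := mem_support_stepPMF.1 ((mem_outcome.1 hω).2 i)
    exact ⟨b, by rwa [hσ (i + 1) _ i (hist ω i) rfl], h2⟩

/-! ### The superscripts -/

/-- Membership in `D` is decided in finite time. -/
def OpenPlays (D : Set (ℕ → S)) : Prop := ∀ ω ∈ D, ∃ k, cyl ω k ⊆ D

variable [Fintype S] [MeasurableSpace S] [DiscreteMeasurableSpace S] {D : Set (ℕ → S)}

theorem OpenPlays.measurableSet (hD : OpenPlays D) : MeasurableSet D := by
  have : D = ⋃ k, Preorder.frestrictLe (π := fun _ : ℕ => S) k ⁻¹'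
      {h | ∀ ω, hist ω k = h → ω ∈ D} := by
    ext ω
    simp only [Set.mem_iUnion]
    constructor
    · intro h
      obtain ⟨k, hk⟩ := hD ω h
      exact ⟨k, fun ω' h' => hk (hist_eq_iff.1 h')⟩
    · rintro ⟨k, hk⟩
      exact hk ω rfl
  rw [this]
  exact MeasurableSet.iUnion fun k => Preorder.measurable_frestrictLe k MeasurableSet.of_discrete

theorem outcome_nonempty (G : MDP S Act AP) (s : S) (σ : G.Strategy) : (G.outcome s σ).Nonempty :=
  (ae_mem_outcome (G := G) (s := s) (σ := σ)).exists

theorem almost_of_ae (h : ∀ᵐ ω ∂G.playMeasure s σ, ω ∈ D) : G.playMeasure s σ D = 1 := by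
  rw [← measure_univ (μ := G.playMeasure s σ)]
  exact measure_congr (Filter.eventuallyEq_univ.2 h)

theorem almost_of_sure (h : G.outcome s σ ⊆ D) : G.playMeasure s σ D = 1 :=
  almost_of_ae (ae_mem_outcome.mono fun _ hω => h hω)

theorem null_of_pos (h : 0 < G.playMeasure s σ D) : (G.outcome s σ ∩ D).Nonempty := by
  by_contra hn
  rw [Set.not_nonempty_iff_eq_empty] at hn
  refine h.ne' (measure_mono_null (t := (G.outcome s σ)ᶜ) (fun ω hω hω' => ?_)
    (ae_iff.1 ae_mem_outcome))
  exact (Set.ext_iff.1 hn ω).1 ⟨hω', hω⟩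

/-- The outcome has a cylinder inside `D`, and a cylinder around an outcome has positive
probability. -/
theorem pos_of_null (hD : OpenPlays D) (h : (G.outcome s σ ∩ D).Nonempty) :
    0 < G.playMeasure s σ D := by
  obtain ⟨ω, h1, h2⟩ := h
  obtain ⟨k, hk⟩ := hD ω h2
  exact (playMeasure_cyl_pos h1 k).trans_le (measure_mono hk)

theorem ae_of_almost (hD : MeasurableSet D) (h : G.playMeasure s σ D = 1) :
    ∀ᵐ ω ∂G.playMeasure s σ, ω ∈ D := by
  rw [ae_iff]
  exact (prob_compl_eq_zero_iff hD).2 h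

/-- Turns positive probability of a finite prefix into one concrete feasible continuation with an
almost sure property. This lets statements about the measure be used in arguments about single
plays. -/
theorem exists_mem_cyl {P : (ℕ → S) → Prop} {ω : ℕ → S} {k : ℕ}
    (hω : 0 < G.playMeasure s σ (cyl ω k)) (hP : ∀ᵐ ω ∂G.playMeasure s σ, P ω) :
    ∃ ω' ∈ cyl ω k, ω' ∈ G.outcome s σ ∧ P ω' := by
  by_contra! hn
  refine hω.ne' (measure_mono_null (t := {ω' | ¬ (ω' ∈ G.outcome s σ ∧ P ω')})
    (fun ω' h h' => hn ω' h h'.1 h'.2) (ae_iff.1 (ae_mem_outcome.and hP)))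

/-- A feasible play that violates the objective would do so after finitely many steps, hence with
positive probability. -/
theorem sure_of_almost (hD : OpenPlays Dᶜ) (h : G.playMeasure s σ D = 1) : G.outcome s σ ⊆ D := by
  by_contra hn
  obtain ⟨ω, h1, h2⟩ := Set.not_subset.1 hn
  have h3 := pos_of_null hD ⟨ω, h1, h2⟩
  exact h3.ne' ((prob_compl_eq_zero_iff (compl_compl D ▸ hD.measurableSet.compl)).2 h)

/-- Measurability serves the two probabilistic superscripts, where the measures of `D` and of its
complement add up to one. -/
theorem not_holds_iff (hD : MeasurableSet D) (m : QMode) :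
    ¬ m.Holds G s σ D ↔ m.dual.Holds G s σ Dᶜ := by
  cases m <;> simp only [QMode.Holds, QMode.dual]
  · rw [Set.not_subset]; rfl
  · rw [← prob_compl_eq_zero_iff hD, pos_iff_ne_zero]
  · rw [prob_compl_eq_one_iff hD, pos_iff_ne_zero, not_not]
  · rw [Set.not_nonempty_iff_eq_empty, ← Set.disjoint_iff_inter_eq_empty,
      Set.subset_compl_iff_disjoint_right]

theorem forall_holds_iff (hD : MeasurableSet D) (m : QMode) :
    (∀ σ : G.Strategy, m.Holds G s σ D) ↔ ¬ ∃ σ : G.Strategy, m.dual.Holds G s σ Dᶜ := by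
  simp only [← not_holds_iff hD, not_exists, not_not]

end MDP

/-! ### Temporal operators -/

section PathSets

variable {S : Type u}

/-- The plays with second state in `A`. -/
def nextPlays (A : Set S) : Set (ℕ → S) := {ω | ω 1 ∈ A}

/-- The plays that reach `B` through `A`. -/
def untilPlays (A B : Set S) : Set (ℕ → S) := {ω | ∃ j, ω j ∈ B ∧ ∀ i < j, ω i ∈ A}

/-- The plays that stay in `A` at least until they have reached `B`. -/
def waitPlays (A B : Set S) : Set (ℕ → S) :=
  {ω | (∀ j, ω j ∈ A) ∨ ∃ j, ω j ∈ B ∧ ∀ i ≤ j, ω i ∈ A}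

/-- The plays of the temporal operator with number `op`. -/
def opPlays (op : ℕ) (A B : Set S) : Set (ℕ → S) :=
  if op = 0 then nextPlays A else if op = 1 then untilPlays A B else waitPlays A B

variable (A B : Set S)

theorem openPlays_next : MDP.OpenPlays (nextPlays A) := fun ω (hω : ω 1 ∈ A) =>
  ⟨1, fun ω' h => show ω' 1 ∈ A from (h 1 le_rfl).symm ▸ hω⟩

theorem openPlays_until : MDP.OpenPlays (untilPlays A B) := fun _ ⟨j, h1, h2⟩ =>
  ⟨j, fun _ h => ⟨j, (h j le_rfl).symm ▸ h1, fun i hi => (h i hi.le).symm ▸ h2 i hi⟩⟩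

theorem compl_nextPlays : (nextPlays A)ᶜ = nextPlays Aᶜ := rfl

/-- The first time outside `A` is the witness: if `B` had held earlier, then `A` would have failed
by then. -/
theorem compl_waitPlays : (waitPlays A B)ᶜ = untilPlays Bᶜ Aᶜ := by
  classical
  ext ω
  simp only [waitPlays, untilPlays, Set.mem_compl_iff, Set.mem_ofPred_eq, not_or, not_forall,
    not_exists, not_and]
  constructor
  · rintro ⟨h1, h2⟩
    refine ⟨Nat.find h1, Nat.find_spec h1, fun i hi hB => ?_⟩
    obtain ⟨l, hl, hA⟩ := h2 i hB
    exact Nat.find_min h1 (hl.trans_lt hi) hA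
  · rintro ⟨j, h1, h2⟩
    refine ⟨⟨j, h1⟩, fun i hB => ⟨j, ?_, h1⟩⟩
    by_contra h
    exact h2 i (by omega) hB

theorem compl_untilPlays : (untilPlays A B)ᶜ = waitPlays Bᶜ Aᶜ := by
  rw [eq_comm, ← compl_compl (waitPlays Bᶜ Aᶜ), compl_waitPlays, compl_compl, compl_compl]

variable {A B}

/-- A local form of the objective: `A` holds as long as `A ∩ B` has not been met strictly before.
With its converse `waitPlays_mem`, it allows induction on time without a case distinction on the two
disjuncts of W. -/
theorem mem_waitPlays {ω : ℕ → S}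
    (h : ∀ k, (∀ i < k, ω i ∉ A ∩ B) → ω k ∈ A) : ω ∈ waitPlays A B := by
  classical
  by_cases hj : ∃ j, ω j ∈ A ∩ B
  · refine .inr ⟨Nat.find hj, (Nat.find_spec hj).2, fun i hi => h i fun l hl => ?_⟩
    exact Nat.find_min hj (hl.trans_le hi)
  · exact .inl fun j => h j fun i _ hi => hj ⟨i, hi⟩

theorem waitPlays_mem {ω : ℕ → S} (h : ω ∈ waitPlays A B) {k : ℕ} (hk : ∀ i < k, ω i ∉ A ∩ B) :
    ω k ∈ A := by
  rcases h with h | ⟨j, h1, h2⟩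
  · exact h k
  · by_cases hj : j < k
    · exact absurd ⟨h2 j le_rfl, h1⟩ (hk j hj)
    · exact h2 k (by omega)

end PathSets

/-- The approximation `v n` is final up to time `n`, since later updates only touch later times. The
play is the diagonal. -/
theorem exists_play {S : Type u} (f : ∀ k : ℕ, (Finset.Iic k → S) → S) (s : S) :
    ∃ ω : ℕ → S, ω 0 = s ∧ ∀ k, ω (k + 1) = f k (hist ω k) := by
  let v : ℕ → ℕ → S := fun n => Nat.rec (fun _ => s)
    (fun k v => Function.update v (k + 1) (f k (hist v k))) n
  have hv : ∀ m k, k ≤ m → v m k = v k k := fun m => by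
    induction m with
    | zero => intro k hk; rw [Nat.le_zero.1 hk]
    | succ m ih =>
      intro k hk
      rcases Nat.lt_succ_iff_lt_or_eq.1 (Nat.lt_succ_of_le hk) with h | rfl
      · rw [← ih k (by omega)]
        exact Function.update_of_ne (by omega) _ _
      · rfl
  refine ⟨fun k => v k k, rfl, fun k => ?_⟩
  have h : hist (fun k => v k k) k = hist (v k) k :=
    funext fun i => (hv k i (Finset.mem_Iic.1 i.2)).symm
  rw [h]
  exact Function.update_self _ _ _

-- Fixed points for `U` with the superscripts `sure` and `almost`

namespace MDP

variable {S : Type u} {Act : Type v} {AP : Type w} {G : MDP S Act AP} {s : S} {σ : G.Strategy}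
  {A B : Set S} {N : ℕ}

theorem pre_mono (G : MDP S Act AP) (all : Bool) : Monotone (G.pre all) := by
  rintro Y Y' h x ⟨a, ha, h1⟩
  refine ⟨a, ha, ?_⟩
  cases all
  · exact h1.mono (Set.inter_subset_inter_right _ h)
  · exact Set.Subset.trans h1 h

theorem stepSet_mono (G : MDP S Act AP) (all : Bool) (A B : Set S) :
    Monotone (G.stepSet all A B) := fun _ _ h =>
  Set.union_subset_union_right _ (Set.inter_subset_inter_right _ (G.pre_mono all h))

theorem reachSet_mono (G : MDP S Act AP) (A B : Set S) : Monotone (G.reachSet A B) :=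
  fun _ _ h _ hx Z hB hZ => hx Z hB fun y hy ⟨a, ha, h1, h2⟩ => hZ y hy ⟨a, ha, h1.trans h, h2⟩

theorem exists_step {ω : ℕ → S} (h : ω ∈ G.outcome s σ) (k : ℕ) :
    ∃ a ∈ (σ.choice k (hist ω k)).support, ω (k + 1) ∈ G.dest (ω k) a :=
  mem_support_stepPMF.1 ((mem_outcome.1 h).2 k)

/-- One plus the number of iterations from `∅` after which `x` appears. -/
noncomputable def rank (F : Set S → Set S) (x : S) : ℕ := sInf {i | x ∈ F^[i] ∅}

theorem rank_le {F : Set S → Set S} {x : S} {i : ℕ} (h : x ∈ F^[i] ∅) : rank F x ≤ i :=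
  Nat.sInf_le h

theorem exists_rank {F : Set S → Set S} {x : S} {i : ℕ} (h : x ∈ F^[i] ∅) :
    ∃ j, rank F x = j + 1 ∧ x ∈ F (F^[j] ∅) := by
  have h1 : x ∈ F^[rank F x] ∅ := Nat.sInf_mem (s := {i | x ∈ F^[i] ∅}) ⟨i, h⟩
  cases hr : rank F x with
  | zero => rw [hr] at h1; exact absurd h1 (Set.notMem_empty x)
  | succ j => exact ⟨j, rfl, by rwa [hr, Function.iterate_succ_apply'] at h1⟩

variable [Fintype S]

/-- In `A \ X` every available action has a destination outside `X`. So against any strategy some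
play avoids `X`, and with it `B`, for as long as it stays in `A`. Conversely, on `X \ B` there is an
action all of whose destinations appear in an earlier iterate. -/
theorem exists_sure_until (hN : Fintype.card S = N) :
    (∃ σ : G.Strategy, G.outcome s σ ⊆ untilPlays A B) ↔ s ∈ (G.stepSet true A B)^[N] ∅ := by
  classical
  have hF := G.stepSet_mono true A B
  set F := G.stepSet true A B with hFdef
  have hX := iterate_empty_fixed hF hN
  set X := F^[N] ∅ with hXdef
  constructor
  · rintro ⟨σ, hσ⟩
    by_contra hs
    -- The spoiling successor is chosen from the whole history, since `σ` may depend on it.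
    have hf : ∀ k h, ∃ t, t ∈ (G.stepPMF σ k h).support ∧
        (lastState h ∈ A \ X → t ∉ X) := by
      intro k h
      by_cases hx : lastState h ∈ A \ X
      · obtain ⟨a, ha⟩ := (σ.choice k h).support_nonempty
        have : ¬ G.dest (lastState h) a ⊆ X := fun hd => hx.2 (hX ▸ .inr ⟨hx.1, a,
          σ.admissible _ _ a ha, hd⟩)
        obtain ⟨t, h1, h2⟩ := Set.not_subset.1 this
        exact ⟨t, mem_support_stepPMF.2 ⟨a, ha, h1⟩, fun _ => h2⟩
      · obtain ⟨t, ht⟩ := (G.stepPMF σ k h).support_nonempty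
        exact ⟨t, ht, fun h => absurd h hx⟩
    choose f hf1 hf2 using hf
    obtain ⟨ω, h0, hω⟩ := exists_play f s
    obtain ⟨j, h1, h2⟩ := hσ (mem_outcome.2 ⟨h0, fun k => hω k ▸ hf1 _ _⟩)
    have key : ∀ i ≤ j, ω i ∉ X := fun i => by
      induction i with
      | zero => exact fun _ => h0 ▸ hs
      | succ i ih =>
        intro hi
        rw [hω]
        exact hf2 _ _ ⟨h2 i (by omega), ih (by omega)⟩
    exact key j le_rfl (hX ▸ .inl h1)
  · intro hs
    -- With `rank F x = j + 1`, the prescribed destinations lie in the `j`th iterate, so the rank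
    -- drops along every play.
    obtain ⟨σ, -, hσ, -⟩ := G.exists_strategy (X \ B)
      (fun x a => G.dest x a ⊆ F^[rank F x - 1] ∅) fun x hx => by
        obtain ⟨j, h1, h2⟩ := exists_rank hx.1
        rcases h2 with h | ⟨-, a, ha, h⟩
        · exact absurd h hx.2
        · exact ⟨a, ha, by simpa [h1] using h⟩
    refine ⟨σ, fun ω hω => ?_⟩
    have key : ∀ i k, ω k ∈ F^[i] ∅ → ∃ j ≥ k, ω j ∈ B ∧ ∀ l, k ≤ l → l < j → ω l ∈ A := by
      intro i
      induction i with
      | zero => exact fun k h => absurd h (Set.notMem_empty _)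
      | succ i ih =>
        intro k hk
        by_cases hB : ω k ∈ B
        · exact ⟨k, le_rfl, hB, fun l h1 h2 => by omega⟩
        have hkX : ω k ∈ X := iterate_empty_subset hF hX.le _ hk
        have hA : ω k ∈ A := (hX.symm ▸ hkX : ω k ∈ F X).elim (fun h => absurd h hB) (·.1)
        obtain ⟨a, ha, hd⟩ := exists_step hω k
        have h1 := hσ k (hist ω k) ⟨hkX, hB⟩ a ha hd
        have h2 : rank F (ω k) - 1 ≤ i := by have := rank_le hk; omega
        obtain ⟨j, hj, h3, h4⟩ := ih (k + 1) (iterate_empty_mono hF h2 h1)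
        refine ⟨j, by omega, h3, fun l hl hl' => ?_⟩
        rcases eq_or_lt_of_le hl with rfl | hl
        exacts [hA, h4 l hl hl']
    obtain ⟨j, -, h1, h2⟩ := key N 0 ((mem_outcome.1 hω).1 ▸ hs)
    exact ⟨j, h1, fun i hi => h2 i (by omega) hi⟩

variable [MeasurableSpace S] [DiscreteMeasurableSpace S]

/-- Necessity: all states that occur with positive probability before `B` must still reach `B`
almost surely, so the actions used on the way never leave the set of such states; by induction this
set lies in every iterate. Sufficiency: actions that stay in `Y` and have a destination nearer to
`B` leave `Y \ B` almost surely, and the only exit is into `B`. -/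
theorem exists_almost_until (hN : Fintype.card S = N) :
    (∃ σ : G.Strategy, G.playMeasure s σ (untilPlays A B) = 1) ↔
      s ∈ (G.reachSet A B)^[N] Set.univ := by
  classical
  have hY := iterate_univ_fixed (G.reachSet_mono A B) hN
  constructor
  · rintro ⟨σ, hσ⟩
    have hU := ae_of_almost (openPlays_until A B).measurableSet hσ
    -- Stated for all positive prefixes at once, because the induction on `i` must also apply to
    -- prefixes that deviate from the play under consideration.
    have key : ∀ i (ω : ℕ → S) k, 0 < G.playMeasure s σ (cyl ω k) → (∀ j < k, ω j ∉ B) →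
        ω k ∈ (G.reachSet A B)^[i] Set.univ := by
      intro i
      induction i with
      | zero => exact fun _ _ _ _ => trivial
      | succ i ih =>
        intro ω k hk hB
        rw [Function.iterate_succ_apply']
        intro Z hZ1 hZ2
        obtain ⟨ω', h1, h2, h3⟩ := exists_mem_cyl hk hU
        have h3' : ∃ j, ω' j ∈ B := h3.imp fun _ h => h.1
        have hmin := fun {m} => Nat.find_min h3' (m := m)
        have hspec := Nat.find_spec h3'
        set j := Nat.find h3' with hj
        have hA : ∀ l < j, ω' l ∈ A := by
          obtain ⟨j', h4, h5⟩ := h3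
          exact fun l hl => h5 l (hl.trans_le (Nat.find_min' h3' h4))
        have hkj : k ≤ j := by
          by_contra h
          exact hB j (by omega) (h1 j (by omega) ▸ hspec)
        -- Walks back from the first visit to `B` at time `j`, collecting the states of the play in
        -- the closed set `Z`.
        have hdown : ∀ d, d ≤ j - k → ω' (j - d) ∈ Z := fun d => by
          induction d with
          | zero => exact fun _ => hZ1 hspec
          | succ d ihd =>
            intro hd
            obtain ⟨a, ha, hda⟩ := exists_step h2 (j - (d + 1))
            refine hZ2 _ (hA _ (by omega)) ⟨a, σ.admissible _ _ _ ha, fun t ht => ?_, _, hda, ?_⟩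
            -- Any destination `t` of the action used gives another prefix of positive probability
            -- with no earlier visit to `B`, so the induction hypothesis puts `t` in the `i`th
            -- iterate.
            · have hp := playMeasure_cyl_update_pos (playMeasure_cyl_pos h2 (j - (d + 1)))
                (mem_support_stepPMF.2 ⟨a, ha, ht⟩)
              have := ih _ _ hp fun l hl => by
                rw [Function.update_of_ne (by omega)]
                exact hmin (by omega)
              rwa [Function.update_self] at this
            · rw [show j - (d + 1) + 1 = j - d by omega]
              exact ihd (by omega)
        have := hdown (j - k) le_rfl
        rw [show j - (j - k) = k by omega] at this
        exact h1 k le_rfl ▸ this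
    exact key N (fun _ => s) 0 (playMeasure_cyl_zero_pos rfl) fun j hj => by omega
  · intro hs
    set Y := (G.reachSet A B)^[N] Set.univ with hYdef
    -- `reachSet` is defined as an intersection of closed sets. The iterates of `H` rebuild it from
    -- below and supply the rank, a distance to `B`.
    let H : Set S → Set S := fun Z => B ∪ A ∩ {x | ∃ a ∈ G.mov x, G.dest x a ⊆ Y ∧
      (G.dest x a ∩ Z).Nonempty}
    have hH : Monotone H := fun Z Z' h => Set.union_subset_union_right _
      (Set.inter_subset_inter_right _ fun x ⟨a, ha, h1, h2⟩ =>
        ⟨a, ha, h1, h2.mono (Set.inter_subset_inter_right _ h)⟩)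
    have hHf := iterate_empty_fixed hH hN
    have hYH : ∀ x ∈ Y, x ∈ H^[N] ∅ := fun x hx => by
      rw [← hY] at hx
      exact hx _ (fun y hy => hHf ▸ .inl hy) fun y hy h => hHf ▸ .inr ⟨hy, h⟩
    obtain ⟨σ, -, hσ, -⟩ := G.exists_strategy (Y \ B)
      (fun x a => G.dest x a ⊆ Y ∧ (G.dest x a ∩ H^[rank H x - 1] ∅).Nonempty) fun x hx => by
        obtain ⟨j, h1, h2⟩ := exists_rank (hYH x hx.1)
        rcases h2 with h | ⟨-, a, ha, h⟩
        · exact absurd h hx.2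
        · exact ⟨a, ha, by simpa [h1] using h⟩
    refine ⟨σ, almost_of_ae ?_⟩
    -- The chosen action has a destination in an earlier iterate of `H`, which is exactly the
    -- decrease of the rank that is required.
    have hT := ae_exists_notMem (s := s) (σ := σ) (Y \ B) (rank H) fun k h hx a ha => by
      obtain ⟨j, h1, -⟩ := exists_rank (hYH _ hx.1)
      obtain ⟨-, t, h2, h3⟩ := hσ k h hx a ha
      exact ⟨t, h2, fun _ => by have := rank_le h3; omega⟩
    filter_upwards [hT, ae_mem_outcome] with ω h1 hω
    have hmin := fun {m} => Nat.find_min h1 (m := m)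
    have hspec := Nat.find_spec h1
    set j := Nat.find h1
    have hjY : ω j ∈ Y := by
      rcases hj : j with _ | i
      · exact (mem_outcome.1 hω).1 ▸ hs
      · obtain ⟨a, ha, hd⟩ := exists_step hω i
        exact (hσ i (hist ω i) (not_not.1 (hmin (m := i) (by omega))) a ha).1 hd
    refine ⟨j, by_contra fun h => hspec ⟨hjY, h⟩, fun i hi => ?_⟩
    obtain ⟨h2, h3⟩ := not_not.1 (hmin hi)
    exact (hHf.symm ▸ hYH _ h2 : ω i ∈ H (H^[N] ∅)).elim (fun h => absurd h h3) (·.1)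

end MDP

-- Fixed points for `W`, for `○`, and for `U` with the superscript `null`

namespace MDP

variable {S : Type u} {Act : Type v} {AP : Type w} {G : MDP S Act AP} {s : S} {σ : G.Strategy}
  {A B : Set S} {N : ℕ}

theorem exists_uniform_strategy (G : MDP S Act AP) : ∃ σ : G.Strategy, σ.Memoryless ∧
    ∀ k h, ∀ a ∈ G.mov (lastState h), a ∈ (σ.choice k h).support := by
  obtain ⟨σ, h1, -, h2⟩ := G.exists_strategy ∅ (fun _ _ => True) fun x hx => hx.elim
  exact ⟨σ, h1, fun k h => h2 k h (Set.notMem_empty _)⟩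

/-- A play that stays in `A` until it reaches a set `Z` that it can only leave at states of
`A ∩ B` satisfies the objective `A W B`. -/
theorem mem_waitPlays_of_trap {Z : Set S} (hZ : Z ⊆ A)
    (hσ : ∀ k h, lastState h ∈ Z → ∀ a ∈ (σ.choice k h).support,
      lastState h ∉ A ∩ B → G.dest (lastState h) a ⊆ Z)
    {ω : ℕ → S} (hω : ω ∈ G.outcome s σ) {k : ℕ} (hk : ω k ∈ Z) (hA : ∀ i < k, ω i ∈ A) :
    ω ∈ waitPlays A B := by
  refine mem_waitPlays fun n hn => ?_
  rcases lt_or_ge n k with h | h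
  · exact hA n h
  · suffices ∀ m, k ≤ m → m ≤ n → ω m ∈ Z from hZ (this n h le_rfl)
    intro m hm
    induction m, hm using Nat.le_induction with
    | base => exact fun _ => hk
    | succ m hm ih =>
      intro hmn
      obtain ⟨a, ha, hd⟩ := exists_step hω m
      exact hσ m (hist ω m) (ih (by omega)) a ha (hn m (by omega)) hd

theorem mem_iterate_of_mem_waitPlays {ω : ℕ → S} (hω : ω ∈ G.outcome s σ) (h : ω ∈ waitPlays A B)
    (i : ℕ) : s ∈ (G.stepSet false A (A ∩ B))^[i] Set.univ := by
  have key : ∀ i k, (∀ j < k, ω j ∉ A ∩ B) →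
      ω k ∈ (G.stepSet false A (A ∩ B))^[i] Set.univ := fun i => by
    induction i with
    | zero => exact fun _ _ => trivial
    | succ i ih =>
      intro k hk
      have hA := waitPlays_mem h hk
      rw [Function.iterate_succ_apply']
      by_cases hB : ω k ∈ B
      · exact .inl ⟨hA, hB⟩
      · obtain ⟨a, h1, h2⟩ := edge_of_mem_outcome hω k
        refine .inr ⟨hA, a, h1, _, h2, ih (k + 1) fun j hj => ?_⟩
        rcases Nat.lt_succ_iff_lt_or_eq.1 hj with h | rfl
        exacts [hk j h, fun h => hB h.2]
  exact (mem_outcome.1 hω).1 ▸ key i 0 fun j hj => by omega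

variable [Fintype S]

/-- Under a strategy that gives every available action positive probability, all infinite paths of
the graph are feasible, so only a path is needed. It can be kept in the greatest fixed point until
`A ∩ B` is met. -/
theorem exists_null_wait (hN : Fintype.card S = N) :
    (∃ σ : G.Strategy, (G.outcome s σ ∩ waitPlays A B).Nonempty) ↔
      s ∈ (G.stepSet false A (A ∩ B))^[N] Set.univ := by
  classical
  have hZ := iterate_univ_fixed (G.stepSet_mono false A (A ∩ B)) hN
  constructor
  · rintro ⟨σ, ω, hω, h⟩
    exact mem_iterate_of_mem_waitPlays hω h N
  · intro hs
    set Z := (G.stepSet false A (A ∩ B))^[N] Set.univ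
    obtain ⟨σ, -, hσ⟩ := G.exists_uniform_strategy
    have hf : ∀ x, ∃ t, G.Edge x t ∧ (x ∈ Z → x ∉ A ∩ B → t ∈ Z) := fun x => by
      by_cases hx : x ∈ Z ∧ x ∉ A ∩ B
      · obtain ⟨-, a, ha, t, h1, h2⟩ := (hZ.symm ▸ hx.1 : x ∈ G.stepSet _ _ _ Z).resolve_left hx.2
        exact ⟨t, ⟨a, ha, h1⟩, fun _ _ => h2⟩
      · obtain ⟨a, ha⟩ := G.mov_nonempty x
        obtain ⟨t, ht⟩ := (G.trans x a).support_nonempty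
        exact ⟨t, ⟨a, ha, ht⟩, fun h1 h2 => absurd ⟨h1, h2⟩ hx⟩
    choose f hf1 hf2 using hf
    obtain ⟨ω, h0, hω⟩ := exists_play (fun _ h => f (lastState h)) s
    refine ⟨σ, ω, mem_outcome.2 ⟨h0, fun k => ?_⟩, mem_waitPlays fun n hn => ?_⟩
    · obtain ⟨a, h1, h2⟩ := hf1 (ω k)
      rw [hω]
      exact mem_support_stepPMF.2 ⟨a, hσ k (hist ω k) a h1, h2⟩
    · have key : ∀ m ≤ n, ω m ∈ Z := fun m => by
        induction m with
        | zero => exact fun _ => h0 ▸ hs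
        | succ m ih =>
          intro hm
          rw [hω]
          exact hf2 _ (ih (by omega)) (hn m (by omega))
      exact (hZ.symm ▸ key n le_rfl : ω n ∈ G.stepSet _ _ _ Z).elim (·.1) (·.1)

variable [MeasurableSpace S] [DiscreteMeasurableSpace S]

/-- All actions need to be possible outside `B` only. This lets the strategy of `exists_pos_wait`,
which fixes one action on its target set, be used here. The states with the desired outcome form a
pre-fixed point, because a memoryless strategy allows a step in front. -/
theorem outcome_until_nonempty (hm : σ.Memoryless)
    (hσ : ∀ k h, lastState h ∉ B → ∀ a ∈ G.mov (lastState h), a ∈ (σ.choice k h).support)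
    (hs : s ∈ (G.stepSet false A B)^[N] ∅) : (G.outcome s σ ∩ untilPlays A B).Nonempty := by
  refine iterate_empty_subset (G.stepSet_mono false A B)
    (Y := {x | (G.outcome x σ ∩ untilPlays A B).Nonempty}) (fun x hx => ?_) N hs
  by_cases hB : x ∈ B
  · obtain ⟨ω, hω⟩ := G.outcome_nonempty x σ
    exact ⟨ω, hω, 0, (mem_outcome.1 hω).1.symm ▸ hB, fun i hi => absurd hi (by omega)⟩
  · obtain ⟨hA, a, ha, t, ht, ω, hω, j, h1, h2⟩ := hx.resolve_left hB
    obtain rfl := (mem_outcome.1 hω).1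
    refine ⟨_, hm.cons hω (k := 0) (h := fun _ => x) rfl (hσ 0 (fun _ => x) hB a ha) ht, j + 1, h1,
      fun i hi => ?_⟩
    cases i with
    | zero => exact hA
    | succ i => exact h2 i (by omega)

theorem exists_null_until (hN : Fintype.card S = N) :
    (∃ σ : G.Strategy, (G.outcome s σ ∩ untilPlays A B).Nonempty) ↔
      s ∈ (G.stepSet false A B)^[N] ∅ := by
  constructor
  · rintro ⟨σ, ω, hω, j, hj, hA⟩
    have hX := iterate_empty_fixed (G.stepSet_mono false A B) hN
    have key : ∀ d ≤ j, ω (j - d) ∈ (G.stepSet false A B)^[N] ∅ := fun d => by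
      induction d with
      | zero => exact fun _ => hX ▸ .inl hj
      | succ d ih =>
        intro hd
        obtain ⟨a, h1, h2⟩ := edge_of_mem_outcome hω (j - (d + 1))
        rw [show j - (d + 1) + 1 = j - d by omega] at h2
        rw [← hX]
        exact .inr ⟨hA _ (by omega), a, h1, _, h2, ih (by omega)⟩
    have := key j le_rfl
    rwa [Nat.sub_self, (mem_outcome.1 hω).1] at this
  · intro hs
    obtain ⟨σ, hm, hσ⟩ := G.exists_uniform_strategy
    exact ⟨σ, outcome_until_nonempty hm (fun k h _ => hσ k h) hs⟩

/-- The prefix rerouted to `t` has positive probability, hence it contains a feasible play. -/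
theorem exists_outcome_step {ω : ℕ → S} {k : ℕ} {a : Act} {t : S} (hω : ω ∈ G.outcome s σ)
    (ha : a ∈ (σ.choice k (hist ω k)).support) (ht : t ∈ G.dest (ω k) a) :
    ∃ ω' ∈ G.outcome s σ, ω' ∈ cyl ω k ∧ ω' (k + 1) = t := by
  classical
  obtain ⟨ω', h1, h2, -⟩ := exists_mem_cyl (playMeasure_cyl_update_pos (playMeasure_cyl_pos hω k)
    (mem_support_stepPMF.2 ⟨a, ha, ht⟩)) (Filter.Eventually.of_forall fun _ => trivial)
  refine ⟨ω', h2, fun i hi => ?_, ?_⟩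
  · rw [h1 i (by omega), Function.update_of_ne (by omega)]
  · rw [h1 (k + 1) le_rfl, Function.update_self]

/-- Under a sure strategy, every destination of an action it uses before `A ∩ B` lies on another
outcome, to which the induction applies. Conversely, the greatest fixed point is a trap that can be
left only at states of `A ∩ B`. -/
theorem exists_sure_wait (hN : Fintype.card S = N) :
    (∃ σ : G.Strategy, G.outcome s σ ⊆ waitPlays A B) ↔
      s ∈ (G.stepSet true A (A ∩ B))^[N] Set.univ := by
  constructor
  · rintro ⟨σ, hσ⟩
    have key : ∀ i, ∀ ω ∈ G.outcome s σ, ∀ k, (∀ j < k, ω j ∉ A ∩ B) →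
        ω k ∈ (G.stepSet true A (A ∩ B))^[i] Set.univ := fun i => by
      induction i with
      | zero => exact fun _ _ _ _ => trivial
      | succ i ih =>
        intro ω hω k hk
        have hA := waitPlays_mem (hσ hω) hk
        rw [Function.iterate_succ_apply']
        by_cases hB : ω k ∈ B
        · exact .inl ⟨hA, hB⟩
        · obtain ⟨a, ha, -⟩ := exists_step hω k
          refine .inr ⟨hA, a, σ.admissible _ _ a ha, fun t ht => ?_⟩
          obtain ⟨ω', h1, h2, rfl⟩ := exists_outcome_step hω ha ht
          refine ih ω' h1 (k + 1) fun j hj => ?_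
          rw [h2 j (by omega)]
          rcases Nat.lt_succ_iff_lt_or_eq.1 hj with h | rfl
          exacts [hk j h, fun h => hB h.2]
    obtain ⟨ω, hω⟩ := G.outcome_nonempty s σ
    exact (mem_outcome.1 hω).1 ▸ key N ω hω 0 fun j hj => by omega
  · intro hs
    have hZ := iterate_univ_fixed (G.stepSet_mono true A (A ∩ B)) hN
    set Z := (G.stepSet true A (A ∩ B))^[N] Set.univ
    obtain ⟨σ, -, hσ, -⟩ := G.exists_strategy Z (fun x a => x ∉ A ∩ B → G.dest x a ⊆ Z)
      fun x hx => by
        rcases (hZ.symm ▸ hx : x ∈ G.stepSet _ _ _ Z) with h | ⟨-, a, ha, h⟩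
        · obtain ⟨a, ha⟩ := G.mov_nonempty x
          exact ⟨a, ha, fun h' => absurd h h'⟩
        · exact ⟨a, ha, fun _ => h⟩
    exact ⟨σ, fun ω hω => mem_waitPlays_of_trap (k := 0)
      (fun x hx => (hZ.symm ▸ hx : x ∈ G.stepSet _ _ _ Z).elim (·.1) (·.1)) hσ hω
      ((mem_outcome.1 hω).1 ▸ hs) fun i hi => by omega⟩

/-- Reaching `Z`, where the objective can be ensured surely, along a finite path in `A` suffices,
for such a path has positive probability. If `Z` is out of reach, then a play inside `A` remains in
`A \ R`. Every action there has a destination that is discarded earlier in the computation of `Z`,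
so almost surely the play leaves `A` without having met `A ∩ B`. -/
theorem exists_pos_wait (hN : Fintype.card S = N) :
    (∃ σ : G.Strategy, 0 < G.playMeasure s σ (waitPlays A B)) ↔
      s ∈ (G.stepSet false A ((G.stepSet true A (A ∩ B))^[N] Set.univ))^[N] ∅ := by
  have hF := G.stepSet_mono true A (A ∩ B)
  have hZ := iterate_univ_fixed hF hN
  set F := G.stepSet true A (A ∩ B)
  set Z := F^[N] Set.univ
  have hR := iterate_empty_fixed (G.stepSet_mono false A Z) hN
  set R := (G.stepSet false A Z)^[N] ∅
  constructor
  · rintro ⟨σ, hσ⟩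
    by_contra hs
    have hex : ∀ x ∉ R, ∃ i, x ∉ F^[i] Set.univ := fun x hx => ⟨N, fun h => hx (hR ▸ .inl h)⟩
    -- The rank is the number of rounds after which a state is discarded. It is positive since the
    -- iteration starts with all states.
    have hT := ae_exists_notMem (s := s) (σ := σ) (A \ R) (fun x => sInf {i | x ∉ F^[i] Set.univ})
      fun k h hx a ha => by
        have h1 := Nat.sInf_mem (s := {i | lastState h ∉ F^[i] Set.univ}) (hex _ hx.2)
        cases hr : sInf {i | lastState h ∉ F^[i] Set.univ} with
        | zero => rw [hr] at h1; exact absurd trivial h1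
        | succ j =>
          rw [hr, Set.mem_ofPred_eq, Function.iterate_succ_apply'] at h1
          have h2 : ¬ G.dest (lastState h) a ⊆ F^[j] Set.univ := fun hd =>
            h1 (.inr ⟨hx.1, a, σ.admissible _ _ a ha, hd⟩)
          obtain ⟨t, h3, h4⟩ := Set.not_subset.1 h2
          exact ⟨t, h3, fun _ => Nat.lt_succ_of_le (Nat.sInf_le h4)⟩
    refine hσ.ne' (measure_eq_zero_iff_ae_notMem.2 ?_)
    filter_upwards [hT, ae_mem_outcome] with ω ⟨k, hk⟩ hω hW
    have hAB : A ∩ B ⊆ R := fun x hx => hR ▸ .inl (hZ ▸ .inl hx)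
    -- A state of `A` with a successor in `R` lies in `R` itself, and `A` holds along the play
    -- because `A ∩ B ⊆ R` has not been met. So `R` is never entered.
    have key : ∀ k, ∀ i ≤ k, ω i ∉ R := fun k => by
      induction k with
      | zero =>
        intro i hi
        rw [Nat.le_zero.1 hi, (mem_outcome.1 hω).1]
        exact hs
      | succ k ih =>
        intro i hi hiR
        rcases Nat.lt_succ_iff_lt_or_eq.1 (Nat.lt_succ_of_le hi) with h | rfl
        · exact ih i (by omega) hiR
        · obtain ⟨a, h1, h2⟩ := edge_of_mem_outcome hω k
          refine ih k le_rfl (hR ▸ .inr ⟨waitPlays_mem hW fun j hj h => ?_, a, h1, _, h2, hiR⟩)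
          exact ih j hj.le (hAB h)
    exact hk ⟨waitPlays_mem hW fun j hj h => key j j le_rfl (hAB h), key k k le_rfl⟩
  · intro hs
    obtain ⟨σ, hm, h1, h2⟩ := G.exists_strategy Z (fun x a => x ∉ A ∩ B → G.dest x a ⊆ Z)
      fun x hx => by
        rcases (hZ.symm ▸ hx : x ∈ F Z) with h | ⟨-, a, ha, h⟩
        · obtain ⟨a, ha⟩ := G.mov_nonempty x
          exact ⟨a, ha, fun h' => absurd h h'⟩
        · exact ⟨a, ha, fun _ => h⟩
    obtain ⟨ω, hω, j, hj, hA⟩ := outcome_until_nonempty hm h2 hs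
    -- Almost every play with this prefix is feasible and therefore trapped in `Z` until `A ∩ B`
    -- occurs.
    refine ⟨σ, (playMeasure_cyl_pos hω j).trans_le (measure_mono_ae ?_)⟩
    filter_upwards [ae_mem_outcome] with ω' h3 h4
    refine mem_waitPlays_of_trap (k := j)
      (fun x hx => (hZ.symm ▸ hx : x ∈ F Z).elim (·.1) (·.1)) h1 h3 ?_ fun i hi => ?_
    · rw [h4 j le_rfl]; exact hj
    · rw [h4 i hi.le]; exact hA i hi

theorem exists_sure_next :
    (∃ σ : G.Strategy, G.outcome s σ ⊆ nextPlays A) ↔ s ∈ G.pre true A := by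
  constructor
  · rintro ⟨σ, hσ⟩
    obtain ⟨ω, hω⟩ := G.outcome_nonempty s σ
    obtain ⟨a, ha, -⟩ := exists_step hω 0
    refine ⟨a, (mem_outcome.1 hω).1 ▸ σ.admissible _ _ a ha, fun t ht => ?_⟩
    obtain ⟨ω', h1, -, rfl⟩ := exists_outcome_step hω ha ((mem_outcome.1 hω).1.symm ▸ ht)
    exact hσ h1
  · rintro ⟨a, ha, hd⟩
    obtain ⟨σ, -, hσ, -⟩ := G.exists_strategy {s} (fun x a => G.dest x a ⊆ A) fun x hx =>
      ⟨a, hx ▸ ha, hx ▸ hd⟩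
    refine ⟨σ, fun ω hω => ?_⟩
    obtain ⟨b, h1, h2⟩ := exists_step hω 0
    exact hσ 0 (hist ω 0) (mem_outcome.1 hω).1 b h1 h2

theorem exists_null_next :
    (∃ σ : G.Strategy, (G.outcome s σ ∩ nextPlays A).Nonempty) ↔ s ∈ G.pre false A := by
  constructor
  · rintro ⟨σ, ω, hω, hA⟩
    obtain ⟨a, h1, h2⟩ := edge_of_mem_outcome hω 0
    rw [(mem_outcome.1 hω).1] at h1 h2
    exact ⟨a, h1, _, h2, hA⟩
  · rintro ⟨a, ha, t, ht, hA⟩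
    obtain ⟨σ, hm, hσ⟩ := G.exists_uniform_strategy
    obtain ⟨ω, hω⟩ := G.outcome_nonempty t σ
    obtain rfl := (mem_outcome.1 hω).1
    exact ⟨σ, _, hm.cons hω (k := 0) (h := fun _ => s) rfl (hσ _ _ a ha) ht, hA⟩

end MDP

-- All superscripts together, and duality

namespace MDP

variable {S : Type u} {Act : Type v} {AP : Type w} [Fintype S] [MeasurableSpace S]
  [DiscreteMeasurableSpace S] {G : MDP S Act AP} {s : S} {σ : G.Strategy} {D : Set (ℕ → S)}

theorem holds_of_sure (h : G.outcome s σ ⊆ D) (m : QMode) : m.Holds G s σ D := by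
  cases m with
  | sure => exact h
  | almost => exact almost_of_sure h
  | pos => exact zero_lt_one.trans_eq (almost_of_sure h).symm
  | nullo =>
    obtain ⟨ω, hω⟩ := G.outcome_nonempty s σ
    exact ⟨ω, hω, h hω⟩

theorem null_of_holds {m : QMode} (h : m.Holds G s σ D) : (G.outcome s σ ∩ D).Nonempty := by
  cases m with
  | sure =>
    obtain ⟨ω, hω⟩ := G.outcome_nonempty s σ
    exact ⟨ω, hω, h hω⟩
  | almost => exact null_of_pos (h.symm ▸ zero_lt_one)
  | pos => exact null_of_pos h
  | nullo => exact h

theorem almost_iff_sure (hD : OpenPlays Dᶜ) :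
    G.playMeasure s σ D = 1 ↔ G.outcome s σ ⊆ D := ⟨sure_of_almost hD, almost_of_sure⟩

theorem pos_iff_null (hD : OpenPlays D) :
    0 < G.playMeasure s σ D ↔ (G.outcome s σ ∩ D).Nonempty := ⟨null_of_pos, pos_of_null hD⟩

/-- `sure` implies each superscript and each superscript implies `null`. For a condition on the
initial state, these two extremes coincide. -/
theorem holds_state_iff (m : QMode) (A : Set S) : m.Holds G s σ {ω | ω 0 ∈ A} ↔ s ∈ A := by
  constructor
  · intro h
    obtain ⟨ω, h1, h2⟩ := null_of_holds h
    exact (mem_outcome.1 h1).1 ▸ h2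
  · exact fun h => holds_of_sure (fun ω hω => show ω 0 ∈ A from (mem_outcome.1 hω).1.symm ▸ h) m

theorem exists_holds_state (G : MDP S Act AP) (m : QMode) (A : Set S) (s : S) :
    (∃ σ : G.Strategy, m.Holds G s σ {ω | ω 0 ∈ A}) ↔ s ∈ A := by
  obtain ⟨σ, -⟩ := G.exists_uniform_strategy
  have : Nonempty G.Strategy := ⟨σ⟩
  simp only [holds_state_iff, exists_const]

theorem forall_holds_state (G : MDP S Act AP) (m : QMode) (A : Set S) (s : S) :
    (∀ σ : G.Strategy, m.Holds G s σ {ω | ω 0 ∈ A}) ↔ s ∈ A := by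
  obtain ⟨σ, -⟩ := G.exists_uniform_strategy
  have : Nonempty G.Strategy := ⟨σ⟩
  simp only [holds_state_iff, forall_const]

theorem exists_holds_next (m : QMode) (A : Set S) :
    (∃ σ : G.Strategy, m.Holds G s σ (nextPlays A)) ↔ s ∈ G.exNext m A := by
  cases m with
  | sure => exact exists_sure_next
  | almost =>
    simp only [QMode.Holds, almost_iff_sure (compl_nextPlays A ▸ openPlays_next Aᶜ)]
    exact exists_sure_next
  | pos =>
    simp only [QMode.Holds, pos_iff_null (openPlays_next A)]
    exact exists_null_next
  | nullo => exact exists_null_next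

theorem exists_holds_until {N : ℕ} (hN : Fintype.card S = N) (m : QMode) (A B : Set S) :
    (∃ σ : G.Strategy, m.Holds G s σ (untilPlays A B)) ↔ s ∈ G.exUntil N m A B := by
  cases m with
  | sure => exact exists_sure_until hN
  | almost => exact exists_almost_until hN
  | pos =>
    simp only [QMode.Holds, pos_iff_null (openPlays_until A B)]
    exact exists_null_until hN
  | nullo => exact exists_null_until hN

/-- The complement of W is decided in finite time, so `almost` collapses to `sure`. W itself is not,
so `pos` and `null` need different computations. -/
theorem exists_holds_wait {N : ℕ} (hN : Fintype.card S = N) (m : QMode) (A B : Set S) :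
    (∃ σ : G.Strategy, m.Holds G s σ (waitPlays A B)) ↔ s ∈ G.exWait N m A B := by
  cases m with
  | sure => exact exists_sure_wait hN
  | almost =>
    simp only [QMode.Holds, almost_iff_sure (compl_waitPlays A B ▸ openPlays_until Bᶜ Aᶜ)]
    exact exists_sure_wait hN
  | pos => exact exists_pos_wait hN
  | nullo => exact exists_null_wait hN

theorem exists_holds_op (G : MDP S Act AP) {N : ℕ} (hN : Fintype.card S = N) {op : ℕ} (hop : op ≤ 2)
    (m : QMode) (A B : Set S) (s : S) :
    (∃ σ : G.Strategy, m.Holds G s σ (opPlays op A B)) ↔ s ∈ G.exOp N op m A B := by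
  interval_cases op
  exacts [exists_holds_next m A, exists_holds_until hN m A B, exists_holds_wait hN m A B]

/-- Complementation exchanges U (number 1) with W (number 2) and swaps the complemented operands;
this is the `3 - op` in `allOp`. -/
theorem forall_holds_op (G : MDP S Act AP) {N : ℕ} (hN : Fintype.card S = N) {op : ℕ} (hop : op ≤ 2)
    (m : QMode) (A B : Set S) (s : S) :
    (∀ σ : G.Strategy, m.Holds G s σ (opPlays op A B)) ↔ s ∈ G.allOp N op m A B := by
  interval_cases op
  · refine (forall_holds_iff (openPlays_next A).measurableSet m).trans (not_congr ?_)
    exact exists_holds_op G hN (op := 0) (by omega) m.dual Aᶜ ∅ s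
  · refine (forall_holds_iff (openPlays_until A B).measurableSet m).trans (not_congr ?_)
    rw [compl_untilPlays]
    exact exists_holds_op G hN (op := 2) le_rfl m.dual Bᶜ Aᶜ s
  · have hD : MeasurableSet (waitPlays A B) := by
      rw [← compl_compl A, ← compl_compl B, ← compl_untilPlays]
      exact (openPlays_until _ _).measurableSet.compl
    refine (forall_holds_iff hD m).trans (not_congr ?_)
    rw [compl_waitPlays]
    exact exists_holds_op G hN (op := 1) (by omega) m.dual Bᶜ Aᶜ s

end MDP

/-! ## A structured language and its compilation to the random access machine -/

namespace RAM

/-- The code stands in the program from position `p` on. -/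
def At (P : Program) (p : ℕ) (l : List Instr) : Prop := ∀ i (h : i < l.length), P[p + i]? = some l[i]

theorem at_append {P : Program} {p : ℕ} {l l' : List Instr} :
    At P p (l ++ l') ↔ At P p l ∧ At P (p + l.length) l' := by
  constructor
  · intro h
    refine ⟨fun i hi => ?_, fun i hi => ?_⟩
    · have := h i (by simp; omega)
      rwa [List.getElem_append_left hi] at this
    · have := h (l.length + i) (by simp; omega)
      rw [List.getElem_append_right (by omega)] at this
      simpa [add_assoc] using this
  · rintro ⟨h, h'⟩ i hi
    by_cases hl : i < l.length
    · rw [List.getElem_append_left hl]; exact h i hl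
    · rw [List.getElem_append_right (by omega)]
      have := h' (i - l.length) (by simp at hi; omega)
      rw [← this]; congr 1; omega

theorem at_cons {P : Program} {p : ℕ} {a : Instr} {l : List Instr} :
    At P p (a :: l) ↔ P[p]? = some a ∧ At P (p + 1) l := by
  rw [show a :: l = [a] ++ l from rfl, at_append]
  refine and_congr ⟨fun h => by simpa using h 0 (by simp), fun h i hi => ?_⟩ Iff.rfl
  obtain rfl : i = 0 := by simpa using hi
  simpa using h

/-- The machine gets from `c` to `c'` in `t` steps, with all numbers bounded by `B`. -/
def Goes (P : Program) (B : ℕ) (c : Config) (t : ℕ) (c' : Config) : Prop :=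
  (step P)^[t] c = c' ∧ ∀ u ≤ t, ((step P)^[u] c).BoundedBy B

theorem Goes.refl {P : Program} {B : ℕ} {c : Config} (h : c.BoundedBy B) : Goes P B c 0 c :=
  ⟨rfl, fun u hu => by obtain rfl : u = 0 := by omega
                       exact h⟩

theorem Goes.trans {P : Program} {B : ℕ} {c c' c'' : Config} {t t' : ℕ} (h : Goes P B c t c')
    (h' : Goes P B c' t' c'') : Goes P B c (t + t') c'' := by
  refine ⟨by rw [add_comm, Function.iterate_add_apply, h.1, h'.1], fun u hu => ?_⟩
  by_cases hut : u ≤ t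
  · exact h.2 u hut
  · obtain ⟨v, rfl⟩ : ∃ v, u = v + t := ⟨u - t, by omega⟩
    rw [Function.iterate_add_apply, h.1]
    exact h'.2 v (by omega)

theorem Goes.bounded {P : Program} {B : ℕ} {c c' : Config} {t : ℕ} (h : Goes P B c t c') :
    c'.BoundedBy B := h.1 ▸ h.2 t le_rfl

theorem Goes.one {P : Program} {B : ℕ} {c : Config} {i : Instr} (hi : P[c.pc]? = some i)
    (h : c.BoundedBy B) (h' : (i.exec c).BoundedBy B) : Goes P B c 1 (i.exec c) := by
  have hs : step P c = i.exec c := by simp [step, hi]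
  refine ⟨by simpa using hs, fun u hu => ?_⟩
  interval_cases u
  · exact h
  · simpa [hs] using h'

theorem bounded_update_reg {c : Config} {B d x p : ℕ} (h : c.BoundedBy B) (hx : x ≤ B) :
    Config.BoundedBy ⟨p, Function.update c.reg d x, c.mem⟩ B := fun i => by
  refine ⟨?_, (h i).2⟩
  by_cases hi : i = d
  · subst hi; simpa using hx
  · simpa [hi] using (h i).1

theorem bounded_update_mem {c : Config} {B d x p : ℕ} (h : c.BoundedBy B) (hx : x ≤ B) :
    Config.BoundedBy ⟨p, c.reg, Function.update c.mem d x⟩ B := fun i => by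
  refine ⟨(h i).1, ?_⟩
  by_cases hi : i = d
  · subst hi; simpa using hx
  · simpa [hi] using (h i).2

/-- Arithmetic expressions. Array `0` is the initial part of the memory. -/
inductive Exp
  | lit (c : ℕ)
  | var (r : ℕ)
  | add (a b : Exp)
  | addl (a : Exp) (c : ℕ)
  | sub (a b : Exp)
  | arr (k : Fin 16) (i : Exp)

/-- Variables and arrays. -/
@[ext]
structure Store where
  reg : ℕ → ℕ
  arr : Fin 16 → ℕ → ℕ

/-- All numbers in the store are at most `M`. -/
def Store.Below (s : Store) (M : ℕ) : Prop := (∀ r, s.reg r ≤ M) ∧ ∀ k i, s.arr k i ≤ M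

namespace Exp

/-- The value of an expression. -/
def eval (s : Store) : Exp → ℕ
  | lit c => c
  | var r => s.reg r
  | add a b => a.eval s + b.eval s
  | addl a c => a.eval s + c
  | sub a b => a.eval s - b.eval s
  | arr k i => s.arr k (i.eval s)

/-- Array `0` is used below `W` only, and the right summands are at most `K`. -/
def Ok (W K : ℕ) (s : Store) : Exp → Prop
  | lit _ => True
  | var _ => True
  | add a b => a.Ok W K s ∧ b.Ok W K s ∧ b.eval s ≤ K
  | addl a _ => a.Ok W K s
  | sub a b => a.Ok W K s ∧ b.Ok W K s
  | arr k i => i.Ok W K s ∧ (k = 0 → i.eval s < W)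

/-- The number of instructions that compute the address of an array cell. -/
def addrCost (k : Fin 16) : ℕ := if k = 0 then 0 else 7

/-- The number of steps of the evaluation. -/
def cost : Exp → ℕ
  | lit _ => 1
  | var _ => 1
  | add a b => a.cost + b.cost + 1
  | addl a _ => a.cost + 2
  | sub a b => a.cost + b.cost + 1
  | arr k i => i.cost + addrCost k + 1

/-- The largest constant. -/
def maxLit : Exp → ℕ
  | lit c => c
  | var _ => 0
  | add a b => max a.maxLit b.maxLit
  | addl a c => max a.maxLit c
  | sub a b => max a.maxLit b.maxLit
  | arr _ i => i.maxLit

/-- Only array `0` is used. -/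
def raw : Exp → Bool
  | lit _ => true
  | var _ => true
  | add a b => a.raw && b.raw
  | addl a _ => a.raw
  | sub a b => a.raw && b.raw
  | arr k i => k == 0 && i.raw

end Exp

/-- The register of a temporary value. -/
abbrev tmp (r : ℕ) : ℕ := 2 * r + 2

/-- The register of a variable. -/
abbrev vreg (r : ℕ) : ℕ := 2 * r + 1

/-- Code that turns an index into the address of a cell of array `k`. -/
def addrCode (k : Fin 16) (r : ℕ) : List Instr :=
  if k = 0 then [] else
    [.add (tmp r) (tmp r) (tmp r), .add (tmp r) (tmp r) (tmp r), .add (tmp r) (tmp r) (tmp r),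
      .add (tmp r) (tmp r) (tmp r), .const (tmp (r + 1)) k, .add (tmp r) (tmp r) (tmp (r + 1)),
      .add (tmp r) (tmp r) 0]

/-- The address of a cell of array `k`. -/
def addr (W : ℕ) (k : Fin 16) (i : ℕ) : ℕ := if k = 0 then i else W + (16 * i + k)

/-- Code that evaluates an expression. -/
def Exp.compile : Exp → ℕ → List Instr
  | lit c, r => [.const (tmp r) c]
  | var v, r => [.move (tmp r) (vreg v)]
  | add a b, r => a.compile r ++ b.compile (r + 1) ++ [.add (tmp r) (tmp r) (tmp (r + 1))]
  | addl a c, r => a.compile r ++ [.const (tmp (r + 1)) c, .add (tmp r) (tmp r) (tmp (r + 1))]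
  | sub a b, r => a.compile r ++ b.compile (r + 1) ++ [.sub (tmp r) (tmp r) (tmp (r + 1))]
  | arr k i, r => i.compile r ++ addrCode k r ++ [.load (tmp r) (tmp r)]

theorem addrCode_length (k : Fin 16) (r : ℕ) : (addrCode k r).length = Exp.addrCost k := by
  unfold addrCode Exp.addrCost; split <;> rfl

theorem Exp.compile_length (e : Exp) (r : ℕ) : (e.compile r).length = e.cost := by
  induction e generalizing r <;> simp_all [compile, cost, addrCode_length] <;> omega

/-- The configuration represents the store. -/
def Rep (W : ℕ) (s : Store) (c : Config) : Prop :=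
  (∀ v, c.reg (vreg v) = s.reg v) ∧ (∀ i < W, c.mem i = s.arr 0 i) ∧
    ∀ k : Fin 16, k ≠ 0 → ∀ i, c.mem (addr W k i) = s.arr k i

/-- Values can grow only by additions, whose right summands `Ok` bounds by `K`. Thus the growth is
linear in the cost, where unrestricted additions could double a value at each step. -/
theorem Exp.eval_le {K M : ℕ} {W : ℕ} {s : Store} (hs : s.Below M) :
    ∀ {e : Exp}, e.Ok W K s → e.maxLit ≤ K → e.eval s ≤ M + e.cost * K
  | lit c, _, h => by simp only [maxLit] at h; simp [eval, cost]; omega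
  | var v, _, _ => (hs.1 v).trans (by simp)
  | add a b, ho, h => by
    simp only [maxLit, max_le_iff] at h
    have := Exp.eval_le hs ho.1 h.1
    have := ho.2.2
    simp only [eval, cost]; nlinarith [Nat.zero_le (b.cost * K)]
  | addl a c, ho, h => by
    simp only [maxLit, max_le_iff] at h
    have := Exp.eval_le (e := a) hs ho h.1
    simp only [eval, cost]; nlinarith
  | sub a b, ho, h => by
    simp only [maxLit, max_le_iff] at h
    have := Exp.eval_le hs ho.1 h.1
    simp only [eval, cost]
    have : 0 ≤ b.cost * K := Nat.zero_le _
    nlinarith [Nat.sub_le (a.eval s) (b.eval s)]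
  | arr k i, _, _ => (hs.2 _ _).trans (by simp)

/-- A step of straight-line code that changes a register. -/
theorem goes_reg {P : Program} {B : ℕ} {c : Config} {i : Instr} (d x : ℕ)
    (hi : P[c.pc]? = some i) (h : c.BoundedBy B) (hx : x ≤ B)
    (he : i.exec c = ⟨c.pc + 1, Function.update c.reg d x, c.mem⟩) :
    ∃ c', Goes P B c 1 c' ∧ c'.pc = c.pc + 1 ∧ c'.reg = Function.update c.reg d x ∧
      c'.mem = c.mem :=
  ⟨i.exec c, Goes.one hi h (by rw [he]; exact bounded_update_reg h hx), by rw [he], by rw [he],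
    by rw [he]⟩

/-- Four doublings stand for the multiplication by 16. Array `0` needs no code, since its cells are
the first memory cells. -/
theorem addrCode_goes {P : Program} {W B x r : ℕ} {k : Fin 16} {c : Config}
    (hP : At P c.pc (addrCode k r)) (hc : c.BoundedBy B) (hx : c.reg (tmp r) = x)
    (hB : W + 16 * x + 16 ≤ B) (h0 : k = 0 ∨ c.reg 0 = W) :
    ∃ c', Goes P B c (Exp.addrCost k) c' ∧ c'.pc = c.pc + Exp.addrCost k ∧
      c'.reg (tmp r) = addr W k x ∧ (∀ y, (∀ q, r ≤ q → y ≠ tmp q) → c'.reg y = c.reg y) ∧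
      c'.mem = c.mem := by
  by_cases hk : k = 0
  · exact ⟨c, by simpa [Exp.addrCost, hk] using Goes.refl hc, by simp [Exp.addrCost, hk],
      by simp [addr, hk, hx], fun _ _ => rfl, rfl⟩
  · have h0 := h0.resolve_left hk
    have hk' := k.2
    simp only [addrCode, hk, if_false, at_cons] at hP
    obtain ⟨p1, p2, p3, p4, p5, p6, p7, -⟩ := hP
    obtain ⟨c1, g1, q1, r1, m1⟩ := goes_reg (tmp r) (2 * x) p1 hc (by omega)
      (by simp only [Instr.exec, hx]; congr 2; omega)
    obtain ⟨c2, g2, q2, r2, m2⟩ := goes_reg (tmp r) (4 * x) (q1 ▸ p2) g1.bounded (by omega)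
      (by simp only [Instr.exec, r1, Function.update_self]; congr 2; omega)
    obtain ⟨c3, g3, q3, r3, m3⟩ := goes_reg (tmp r) (8 * x) (by rw [q2, q1]; exact p3) g2.bounded
      (by omega) (by simp only [Instr.exec, r2, Function.update_self]; congr 2; omega)
    obtain ⟨c4, g4, q4, r4, m4⟩ := goes_reg (tmp r) (16 * x) (by rw [q3, q2, q1]; exact p4)
      g3.bounded (by omega) (by simp only [Instr.exec, r3, Function.update_self]; congr 2; omega)
    obtain ⟨c5, g5, q5, r5, m5⟩ := goes_reg (tmp (r + 1)) k (by rw [q4, q3, q2, q1]; exact p5)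
      g4.bounded (by omega) (by simp only [Instr.exec])
    obtain ⟨c6, g6, q6, r6, m6⟩ := goes_reg (tmp r) (16 * x + k)
      (by rw [q5, q4, q3, q2, q1]; exact p6) g5.bounded (by omega)
      (by simp [Instr.exec, r5, r4])
    have t2 : 0 ≠ tmp r := by simp [tmp]
    have t3 : 0 ≠ tmp (r + 1) := by simp [tmp]
    obtain ⟨c7, g7, q7, r7, m7⟩ := goes_reg (tmp r) (W + (16 * x + k))
      (by rw [q6, q5, q4, q3, q2, q1]; exact p7) g6.bounded (by omega)
      (by simp only [Instr.exec, r6, r5, r4, r3, r2, r1, Function.update_self,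
            Function.update_of_ne t2, Function.update_of_ne t3, h0]; congr 2; omega)
    have g := g1.trans (g2.trans (g3.trans (g4.trans (g5.trans (g6.trans g7)))))
    refine ⟨_, by simpa [Exp.addrCost, hk] using g, by simp [Exp.addrCost, hk]; omega,
      by simp [addr, hk, r7], fun y hy => ?_, by simp only [m7, m6, m5, m4, m3, m2, m1]⟩
    have h1 := hy r le_rfl
    have h2 := hy (r + 1) (by omega)
    simp only [r7, r6, r5, r4, r3, r2, r1, Function.update_of_ne h1, Function.update_of_ne h2]

/-- Only the temporaries from `r` on are overwritten, so a left operand survives the evaluation of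
the right one at `r + 1`. The alternative `e.raw = true` covers code that runs before register `0`
holds the base address `W`. -/
theorem Exp.goes {P : Program} {W K M B : ℕ} {s : Store} (hs : s.Below M) :
    ∀ (e : Exp) {r : ℕ} {c : Config}, e.Ok W K s → e.maxLit ≤ K → At P c.pc (e.compile r) →
      Rep W s c → (e.raw = true ∨ c.reg 0 = W) → c.BoundedBy B →
      W + 16 * (M + e.cost * K) + 16 ≤ B →
      ∃ c', Goes P B c e.cost c' ∧ c'.pc = c.pc + e.cost ∧ c'.reg (tmp r) = e.eval s ∧
        (∀ y, (∀ q, r ≤ q → y ≠ tmp q) → c'.reg y = c.reg y) ∧ c'.mem = c.mem := by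
  -- Variables occupy the odd registers and temporaries the positive even ones; register `0` is
  -- neither.
  have rep : ∀ {c c' : Config} {r : ℕ}, Rep W s c →
      (∀ y, (∀ q, r ≤ q → y ≠ tmp q) → c'.reg y = c.reg y) → c'.mem = c.mem → Rep W s c' := by
    intro c c' r h h1 h2
    refine ⟨fun v => ?_, by rw [h2]; exact h.2⟩
    rw [← h.1 v]; exact h1 _ fun q _ => by simp only [vreg, tmp]; omega
  have upd : ∀ {c : Config} {r y x : ℕ}, (∀ q, r ≤ q → y ≠ tmp q) →
      Function.update c.reg (tmp r) x y = c.reg y := by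
    intro c r y x h
    rw [Function.update_of_ne]; exact h r le_rfl
  intro e
  induction e with
  | lit n =>
    intro r c ho hl hP hr h0 hc hB
    simp only [compile, at_cons] at hP
    simp only [maxLit, cost] at hl hB
    obtain ⟨c1, g1, q1, r1, m1⟩ := goes_reg (tmp r) n hP.1 hc (by omega) (by simp [Instr.exec])
    exact ⟨c1, g1, q1, by simp [eval, r1], fun y hy => by rw [r1, upd hy], m1⟩
  | var v =>
    intro r c ho hl hP hr h0 hc hB
    simp only [compile, at_cons] at hP
    obtain ⟨c1, g1, q1, r1, m1⟩ := goes_reg (tmp r) (s.reg v) hP.1 hc (hr.1 v ▸ (hc _).1)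
      (by simp [Instr.exec, hr.1])
    exact ⟨c1, g1, q1, by simp [eval, r1], fun y hy => by rw [r1, upd hy], m1⟩
  | add a b iha ihb =>
    intro r c ho hl hP hr h0 hc hB
    have hv := Exp.eval_le hs ho hl
    simp only [compile, at_append, at_cons, compile_length, List.length_append] at hP
    simp only [maxLit, max_le_iff] at hl
    simp only [raw, Bool.and_eq_true] at h0
    have e1 : (a.cost + b.cost + 1) * K = a.cost * K + b.cost * K + K := by ring
    simp only [cost, e1] at hB hv
    obtain ⟨c1, g1, q1, v1, f1, m1⟩ := iha ho.1 hl.1 hP.1.1 hr (h0.imp_left (·.1)) hc (by omega)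
    have z1 : c1.reg 0 = c.reg 0 := f1 0 fun q _ => by simp [tmp]
    obtain ⟨c2, g2, q2, v2, f2, m2⟩ := ihb (r := r + 1) ho.2.1 hl.2 (q1 ▸ hP.1.2) (rep hr f1 m1)
      (by rw [z1]; exact h0.imp_left (·.2)) g1.bounded (by omega)
    have v3 : c2.reg (tmp r) = a.eval s := by
      rw [f2 _ fun q _ => by simp only [tmp]; omega, v1]
    obtain ⟨c3, g3, q3, r3, m3⟩ := goes_reg (c := c2) (tmp r) ((add a b).eval s)
      (by rw [q2, q1, ← hP.2.1, add_assoc]) g2.bounded (by omega) (by simp [Instr.exec, v2, v3, eval])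
    refine ⟨c3, (g1.trans g2).trans g3, by simp [q3, q2, q1, cost]; omega, by simp [r3],
      fun y hy => ?_, by simp [m3, m2, m1]⟩
    rw [r3, upd hy, f2 y fun q hq => hy q (by omega), f1 y hy]
  | addl a n iha =>
    intro r c ho hl hP hr h0 hc hB
    have hv := Exp.eval_le hs ho hl
    simp only [compile, at_append, at_cons, compile_length] at hP
    simp only [maxLit, max_le_iff] at hl
    have e1 : (a.cost + 2) * K = a.cost * K + K + K := by ring
    simp only [cost, e1] at hB hv
    obtain ⟨c1, g1, q1, v1, f1, m1⟩ := iha ho hl.1 hP.1 hr h0 hc (by omega)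
    obtain ⟨c2, g2, q2, r2, m2⟩ := goes_reg (c := c1) (tmp (r + 1)) n
      (by rw [q1, ← hP.2.1]) g1.bounded (by omega) (by simp [Instr.exec])
    obtain ⟨c3, g3, q3, r3, m3⟩ := goes_reg (tmp r) ((addl a n).eval s)
      (by rw [q2, q1, ← hP.2.2.1]) g2.bounded (by omega)
      (by simp [Instr.exec, r2, v1, eval])
    refine ⟨c3, (g1.trans g2).trans g3, by simp [q3, q2, q1, cost]; omega, by simp [r3],
      fun y hy => ?_, by simp [m3, m2, m1]⟩
    rw [r3, upd hy, r2, Function.update_of_ne (hy (r + 1) (by omega)), f1 y hy]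
  | sub a b iha ihb =>
    intro r c ho hl hP hr h0 hc hB
    have hv := Exp.eval_le hs ho hl
    simp only [compile, at_append, at_cons, compile_length, List.length_append] at hP
    simp only [maxLit, max_le_iff] at hl
    simp only [raw, Bool.and_eq_true] at h0
    have e1 : (a.cost + b.cost + 1) * K = a.cost * K + b.cost * K + K := by ring
    simp only [cost, e1] at hB hv
    obtain ⟨c1, g1, q1, v1, f1, m1⟩ := iha ho.1 hl.1 hP.1.1 hr (h0.imp_left (·.1)) hc (by omega)
    have z1 : c1.reg 0 = c.reg 0 := f1 0 fun q _ => by simp [tmp]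
    obtain ⟨c2, g2, q2, v2, f2, m2⟩ := ihb (r := r + 1) ho.2 hl.2 (q1 ▸ hP.1.2) (rep hr f1 m1)
      (by rw [z1]; exact h0.imp_left (·.2)) g1.bounded (by omega)
    have v3 : c2.reg (tmp r) = a.eval s := by
      rw [f2 _ fun q _ => by simp only [tmp]; omega, v1]
    obtain ⟨c3, g3, q3, r3, m3⟩ := goes_reg (c := c2) (tmp r) ((sub a b).eval s)
      (by rw [q2, q1, ← hP.2.1, add_assoc]) g2.bounded (by omega) (by simp [Instr.exec, v2, v3, eval])
    refine ⟨c3, (g1.trans g2).trans g3, by simp [q3, q2, q1, cost]; omega, by simp [r3],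
      fun y hy => ?_, by simp [m3, m2, m1]⟩
    rw [r3, upd hy, f2 y fun q hq => hy q (by omega), f1 y hy]
  | arr k i ih =>
    intro r c ho hl hP hr h0 hc hB
    have hv := Exp.eval_le hs ho.1 hl
    simp only [compile, at_append, at_cons, compile_length, List.length_append,
      addrCode_length] at hP
    simp only [raw, Bool.and_eq_true, beq_iff_eq] at h0
    have e1 : (i.cost + addrCost k + 1) * K = i.cost * K + addrCost k * K + K := by ring
    simp only [cost, e1] at hB
    obtain ⟨c1, g1, q1, v1, f1, m1⟩ := ih ho.1 hl hP.1.1 hr (h0.imp_left (·.2)) hc (by omega)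
    have z1 : c1.reg 0 = c.reg 0 := f1 0 fun q _ => by simp [tmp]
    obtain ⟨c2, g2, q2, v2, f2, m2⟩ := addrCode_goes (W := W) (q1 ▸ hP.1.2) g1.bounded v1 (by omega)
      (by rw [z1]; exact h0.imp_left (·.1))
    have hval : c2.mem (addr W k (i.eval s)) = s.arr k (i.eval s) := by
      rw [m2, m1]
      by_cases hk : k = 0
      · subst hk; simpa [addr] using hr.2.1 _ (ho.2 rfl)
      · exact hr.2.2 k hk _
    obtain ⟨c3, g3, q3, r3, m3⟩ := goes_reg (c := c2) (tmp r) ((arr k i).eval s)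
      (by rw [q2, q1, ← hP.2.1, add_assoc]) g2.bounded
      (by simp only [eval, ← hval]; exact (g2.bounded _).2)
      (by simp [Instr.exec, v2, hval, eval])
    refine ⟨c3, (g1.trans g2).trans g3, by simp [q3, q2, q1, cost]; omega, by simp [r3],
      fun y hy => ?_, by simp [m3, m2, m1]⟩
    rw [r3, upd hy, f2 y hy, f1 y hy]

/-- Structured programs. -/
inductive Cmd
  | skip
  | assign (d : ℕ) (e : Exp)
  | store (k : Fin 16) (i e : Exp)
  | seq (c d : Cmd)
  | ite (e : Exp) (c d : Cmd)
  | while (e : Exp) (c : Cmd)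

/-- Assignment to a variable. -/
def Store.set (s : Store) (d x : ℕ) : Store := ⟨Function.update s.reg d x, s.arr⟩

/-- Assignment to an array cell. -/
def Store.put (s : Store) (k : Fin 16) (i x : ℕ) : Store :=
  ⟨s.reg, Function.update s.arr k (Function.update (s.arr k) i x)⟩

namespace Cmd

/-- The command takes the store `s` to the store `s'` in `t` steps of the machine. -/
inductive Exec (W K : ℕ) : Cmd → Store → ℕ → Store → Prop
  | skip (s) : Exec W K skip s 0 s
  | assign {s d e} (h : e.Ok W K s) : Exec W K (assign d e) s (e.cost + 1) (s.set d (e.eval s))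
  | store {s k i e} (hi : i.Ok W K s) (he : e.Ok W K s) (hk : k = 0 → i.eval s < W) :
      Exec W K (store k i e) s (i.cost + Exp.addrCost k + e.cost + 1)
        (s.put k (i.eval s) (e.eval s))
  | seq {s s' s'' t t' c d} (h : Exec W K c s t s') (h' : Exec W K d s' t' s'') :
      Exec W K (seq c d) s (t + t') s''
  | iteTrue {s s' t e c d} (he : e.Ok W K s) (h0 : e.eval s ≠ 0) (h : Exec W K c s t s') :
      Exec W K (ite e c d) s (e.cost + 1 + t + 1) s'
  | iteFalse {s s' t e c d} (he : e.Ok W K s) (h0 : e.eval s = 0) (h : Exec W K d s t s') :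
      Exec W K (ite e c d) s (e.cost + 1 + t) s'
  | whileTrue {s s' s'' t t' e c} (he : e.Ok W K s) (h0 : e.eval s ≠ 0) (h : Exec W K c s t s')
      (h' : Exec W K (Cmd.while e c) s' t' s'') :
      Exec W K (Cmd.while e c) s (e.cost + 1 + t + 1 + t') s''
  | whileFalse {s e c} (he : e.Ok W K s) (h0 : e.eval s = 0) :
      Exec W K (Cmd.while e c) s (e.cost + 1) s

/-- The largest constant. -/
def maxLit : Cmd → ℕ
  | skip => 0
  | assign _ e => e.maxLit
  | store _ i e => max i.maxLit e.maxLit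
  | seq c d => max c.maxLit d.maxLit
  | ite e c d => max e.maxLit (max c.maxLit d.maxLit)
  | Cmd.while e c => max e.maxLit c.maxLit

/-- Only array `0` is used. -/
def raw : Cmd → Bool
  | skip => true
  | assign _ e => e.raw
  | store k i e => k == 0 && i.raw && e.raw
  | seq c d => c.raw && d.raw
  | ite e c d => e.raw && c.raw && d.raw
  | Cmd.while e c => e.raw && c.raw

/-- The number of instructions. -/
def size : Cmd → ℕ
  | skip => 0
  | assign _ e => e.cost + 1
  | store k i e => i.cost + Exp.addrCost k + e.cost + 1
  | seq c d => c.size + d.size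
  | ite e c d => e.cost + 1 + c.size + 1 + d.size
  | Cmd.while e c => e.cost + 1 + c.size + 1

/-- The code of a command, placed at position `p`. -/
def compile : Cmd → ℕ → List Instr
  | skip, _ => []
  | assign d e, _ => e.compile 0 ++ [.move (vreg d) (tmp 0)]
  | store k i e, _ => i.compile 0 ++ addrCode k 0 ++ e.compile 1 ++ [.store (tmp 0) (tmp 1)]
  | seq c d, p => c.compile p ++ d.compile (p + c.size)
  | ite e c d, p => e.compile 0 ++ [.jumpZero (tmp 0) (p + e.cost + 1 + c.size + 1)] ++
      c.compile (p + e.cost + 1) ++ [.jump (p + e.cost + 1 + c.size + 1 + d.size)] ++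
      d.compile (p + e.cost + 1 + c.size + 1)
  | Cmd.while e c, p => e.compile 0 ++ [.jumpZero (tmp 0) (p + e.cost + 1 + c.size + 1)] ++
      c.compile (p + e.cost + 1) ++ [.jump p]

theorem compile_length (c : Cmd) (p : ℕ) : (c.compile p).length = c.size := by
  induction c generalizing p <;>
    simp_all [compile, size, Exp.compile_length, addrCode_length] <;> omega

/-- Each step raises the largest number by at most `K`. This turns a time bound into a bound on all
numbers. -/
theorem Exec.store_below {W K : ℕ} {c : Cmd} {s s' : Store} {t : ℕ} (h : Exec W K c s t s')
    (hl : c.maxLit ≤ K) {M : ℕ} (hs : s.Below M) : s'.Below (M + t * K) := by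
  have mono : ∀ {s : Store} {a b : ℕ}, s.Below a → a ≤ b → s.Below b := fun h hab =>
    ⟨fun r => (h.1 r).trans hab, fun k i => (h.2 k i).trans hab⟩
  induction h generalizing M with
  | skip => simpa using hs
  | @assign s d e he =>
    have hv := Exp.eval_le hs he hl
    have : M + e.cost * K ≤ M + (e.cost + 1) * K := by nlinarith
    refine ⟨fun r => ?_, fun k i => (hs.2 k i).trans (Nat.le_add_right _ _)⟩
    simp only [Store.set, Function.update_apply]
    split
    · omega
    · exact (hs.1 r).trans (by simp)
  | @store s k i e hi he hk =>
    simp only [maxLit, max_le_iff] at hl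
    have hv := Exp.eval_le hs he hl.2
    have : M + e.cost * K ≤ M + (i.cost + Exp.addrCost k + e.cost + 1) * K := by
      have : e.cost ≤ i.cost + Exp.addrCost k + e.cost + 1 := by omega
      nlinarith
    refine ⟨fun r => (hs.1 r).trans (Nat.le_add_right _ _), fun k' j => ?_⟩
    have := hs.2 k' j
    simp only [Store.put, Function.update_apply]
    split
    · subst k'
      simp only [Function.update_apply]
      split <;> omega
    · omega
  | seq _ _ ih ih' =>
    simp only [maxLit, max_le_iff] at hl
    refine mono (ih' hl.2 (ih hl.1 hs)) (by nlinarith)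
  | iteTrue _ _ _ ih =>
    simp only [maxLit, max_le_iff] at hl
    refine mono (ih hl.2.1 hs) (by gcongr; omega)
  | iteFalse _ _ _ ih =>
    simp only [maxLit, max_le_iff] at hl
    refine mono (ih hl.2.2 hs) (by gcongr; omega)
  | whileTrue _ _ _ _ ih ih' =>
    have hl' := hl
    simp only [maxLit, max_le_iff] at hl
    refine mono (ih' hl' (ih hl.2 hs)) ?_
    rw [add_assoc, ← add_mul]
    gcongr; omega
  | whileFalse => exact mono hs (by simp)

theorem Rep_of_eq {W : ℕ} {s : Store} {c c' : Config} (h : Rep W s c)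
    (h1 : ∀ y, (∀ q, 0 ≤ q → y ≠ tmp q) → c'.reg y = c.reg y) (h2 : c'.mem = c.mem) :
    Rep W s c' := by
  refine ⟨fun v => ?_, by rw [h2]; exact h.2⟩
  rw [← h.1 v]; exact h1 _ fun q _ => by simp only [vreg, tmp]; omega

theorem goes_jumpZero {P : Program} {B a l : ℕ} {c : Config}
    (hi : P[c.pc]? = some (.jumpZero a l)) (h : c.BoundedBy B) :
    Goes P B c 1 ⟨if c.reg a = 0 then l else c.pc + 1, c.reg, c.mem⟩ :=
  Goes.one hi h h

theorem goes_jump {P : Program} {B l : ℕ} {c : Config}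
    (hi : P[c.pc]? = some (.jump l)) (h : c.BoundedBy B) : Goes P B c 1 ⟨l, c.reg, c.mem⟩ :=
  Goes.one hi h h

/-- Correctness of the compiler, with exact running time. The bound `B` is asked only for the final
time: the bounds for the parts of a command follow since their times add up. -/
theorem Exec.goes {P : Program} {W K B : ℕ} {c : Cmd} {s s' : Store} {t : ℕ}
    (h : Exec W K c s t s') (hl : c.maxLit ≤ K) {M : ℕ} {g : Config} (hs : s.Below M)
    (hP : At P g.pc (c.compile g.pc)) (hr : Rep W s g) (h0 : c.raw = true ∨ g.reg 0 = W)
    (hg : g.BoundedBy B) (hB : W + 16 * (M + t * K) + 16 ≤ B) :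
    ∃ g', Goes P B g t g' ∧ g'.pc = g.pc + c.size ∧ Rep W s' g' ∧ g'.reg 0 = g.reg 0 := by
  have z : ∀ q, 0 ≤ q → 0 ≠ tmp q := fun q _ => by simp [tmp]
  induction h generalizing M g with
  | skip => exact ⟨g, Goes.refl hg, rfl, hr, rfl⟩
  | @assign s d e he =>
    have hv := Exp.eval_le hs he hl
    have e1 : (e.cost + 1) * K = e.cost * K + K := by ring
    rw [e1] at hB
    simp only [compile, at_append, at_cons, Exp.compile_length] at hP
    obtain ⟨g1, h1, q1, v1, f1, m1⟩ := Exp.goes hs e he hl hP.1 hr h0 hg (by omega)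
    obtain ⟨g2, h2, q2, r2, m2⟩ := goes_reg (vreg d) (e.eval s) (by rw [q1]; exact hP.2.1)
      h1.bounded (by omega) (by simp [Instr.exec, v1])
    have R := Rep_of_eq hr f1 m1
    refine ⟨g2, h1.trans h2, by rw [q2, q1]; rfl, ⟨fun v => ?_, ?_⟩, ?_⟩
    · simp [r2, Store.set, Function.update_apply, R.1 v]
    · rw [m2]; exact R.2
    · rw [r2, Function.update_of_ne (by simp [vreg]), f1 0 z]
  | @store s k i e hi he hk =>
    simp only [maxLit, max_le_iff] at hl
    have hv := Exp.eval_le hs he hl.2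
    have hv' := Exp.eval_le hs hi hl.1
    have e1 : (i.cost + Exp.addrCost k + e.cost + 1) * K =
      i.cost * K + Exp.addrCost k * K + e.cost * K + K := by ring
    rw [e1] at hB
    simp only [raw, Bool.and_eq_true, beq_iff_eq] at h0
    simp only [compile, at_append, at_cons, Exp.compile_length, addrCode_length,
      List.length_append] at hP
    obtain ⟨g1, h1, q1, v1, f1, m1⟩ := Exp.goes hs i hi hl.1 hP.1.1.1 hr (h0.imp_left (·.1.2)) hg
      (by omega)
    obtain ⟨g2, h2, q2, v2, f2, m2⟩ := addrCode_goes (W := W) (q1 ▸ hP.1.1.2) h1.bounded v1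
      (by omega) (by rw [f1 0 z]; exact h0.imp_left (·.1.1))
    have R := Rep_of_eq (Rep_of_eq hr f1 m1) f2 m2
    obtain ⟨g3, h3, q3, v3, f3, m3⟩ := Exp.goes hs e he hl.2 (r := 1)
      (by rw [q2, q1, add_assoc]; exact hP.1.2) R
      (by rw [f2 0 z, f1 0 z]; exact h0.imp_left (·.2)) h2.bounded (by omega)
    have R := Rep_of_eq R (fun y hy => f3 y fun q _ => hy q (by omega)) m3
    have w3 : g3.reg (tmp 0) = addr W k (i.eval s) := by
      rw [f3 _ fun q hq => by simp only [tmp]; omega, v2]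
    have h4 := Goes.one (c := g3) (B := B) (by rw [q3, q2, q1, ← hP.2.1]; congr 1; omega) h3.bounded
      (by simp only [Instr.exec, w3, v3]; exact bounded_update_mem h3.bounded (by omega))
    simp only [Instr.exec, w3, v3] at h4
    refine ⟨_, ((h1.trans h2).trans h3).trans h4, ?_, ⟨R.1, fun j hj => ?_, fun k' hk' j => ?_⟩, ?_⟩
    · simp only [q3, q2, q1, size]; omega
    · have := R.2.1 j hj
      by_cases hk0 : k = 0
      · subst hk0
        simp [addr, Store.put, Function.update_apply, this]
      · have : j ≠ addr W k (i.eval s) := by simp only [addr, hk0, if_false]; omega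
        simp only [Store.put]
        rwa [Function.update_of_ne this, Function.update_of_ne (Ne.symm hk0)]
    · have := R.2.2 k' hk' j
      by_cases hkk : k' = k
      · subst hkk
        have : addr W k' j = addr W k' (i.eval s) ↔ j = i.eval s := by
          simp only [addr, hk', if_false]; omega
        simp_all [Store.put, Function.update_apply]
      -- Addresses at or above `W` determine their array by the remainder of the offset modulo 16,
      -- and array `0` is written below `W` only.
      · have hne : addr W k' j ≠ addr W k (i.eval s) := by
          have h1 := k.2
          have h2 := k'.2
          have h3 : (k : ℕ) ≠ k' := fun h => hkk (Fin.ext h.symm)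
          simp only [addr, hk', if_false]
          split
          · rename_i hk0
            have := hk hk0
            omega
          · omega
        simp only [Store.put]
        rwa [Function.update_of_ne hne, Function.update_of_ne hkk]
    · simp only
      rw [f3 0 fun q _ => z q (by omega), f2 0 z, f1 0 z]
  | @seq s s' s'' t t' c d h h' ih ih' =>
    simp only [maxLit, max_le_iff] at hl
    simp only [raw, Bool.and_eq_true] at h0
    simp only [compile, at_append, compile_length] at hP
    obtain ⟨g1, h1, q1, r1, z1⟩ := ih hl.1 hs hP.1 hr (h0.imp_left (·.1)) hg
      (hB.trans' (by gcongr; omega))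
    obtain ⟨g2, h2, q2, r2, z2⟩ := ih' hl.2 (h.store_below hl.1 hs) (q1 ▸ hP.2) r1
      (by rw [z1]; exact h0.imp_left (·.2)) h1.bounded (by linarith [add_mul t t' K])
    exact ⟨g2, h1.trans h2, by rw [q2, q1, size, add_assoc], r2, z2.trans z1⟩
  | @iteTrue s s' t e c d he hv h ih =>
    simp only [maxLit, max_le_iff] at hl
    simp only [raw, Bool.and_eq_true] at h0
    simp only [compile, at_append, at_cons, compile_length, Exp.compile_length, List.length_append,
      List.length_cons, List.length_nil, ← add_assoc, zero_add] at hP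
    obtain ⟨⟨⟨⟨p1, p2, -⟩, p3⟩, p4, -⟩, p5⟩ := hP
    obtain ⟨g1, h1, q1, v1, f1, m1⟩ := Exp.goes hs e he hl.1 p1 hr (h0.imp_left (·.1.1)) hg
      (hB.trans' (by gcongr; omega))
    have h2 := goes_jumpZero (by rw [q1]; exact p2) h1.bounded
    rw [v1, if_neg hv, q1] at h2
    obtain ⟨g3, h3, q3, r3, z3⟩ := ih (g := ⟨g.pc + e.cost + 1, g1.reg, g1.mem⟩) hl.2.1 hs p3 (Rep_of_eq hr f1 m1)
      (by simp only [f1 0 z]; exact h0.imp_left (·.1.2)) h2.bounded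
      (hB.trans' (by gcongr; omega))
    have h4 := goes_jump (c := g3) (B := B) (by rw [q3]; exact p4) h3.bounded
    exact ⟨_, ((h1.trans h2).trans h3).trans h4, by simp only [size]; omega, r3,
      by simpa [f1 0 z] using z3⟩
  | @iteFalse s s' t e c d he hv h ih =>
    simp only [maxLit, max_le_iff] at hl
    simp only [raw, Bool.and_eq_true] at h0
    simp only [compile, at_append, at_cons, compile_length, Exp.compile_length, List.length_append,
      List.length_cons, List.length_nil, ← add_assoc, zero_add] at hP
    obtain ⟨⟨⟨⟨p1, p2, -⟩, p3⟩, p4, -⟩, p5⟩ := hP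
    obtain ⟨g1, h1, q1, v1, f1, m1⟩ := Exp.goes hs e he hl.1 p1 hr (h0.imp_left (·.1.1)) hg
      (hB.trans' (by gcongr; omega))
    have h2 := goes_jumpZero (by rw [q1]; exact p2) h1.bounded
    rw [v1, if_pos hv] at h2
    obtain ⟨g3, h3, q3, r3, z3⟩ := ih (g := ⟨g.pc + e.cost + 1 + c.size + 1, g1.reg, g1.mem⟩) hl.2.2 hs p5 (Rep_of_eq hr f1 m1)
      (by simp only [f1 0 z]; exact h0.imp_left (·.2)) h2.bounded
      (hB.trans' (by gcongr; omega))
    exact ⟨g3, (h1.trans h2).trans h3, by simp only [q3, size]; omega, r3,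
      by simpa [f1 0 z] using z3⟩
  | @whileTrue s s' s'' t t' e c he hv h h' ih ih' =>
    have hl' := hl
    have h0' := h0
    have hP' := hP
    simp only [maxLit, max_le_iff] at hl
    simp only [raw, Bool.and_eq_true] at h0
    simp only [compile, at_append, at_cons, compile_length, Exp.compile_length, List.length_append,
      List.length_cons, List.length_nil, ← add_assoc, zero_add] at hP
    obtain ⟨⟨⟨p1, p2, -⟩, p3⟩, p4, -⟩ := hP
    obtain ⟨g1, h1, q1, v1, f1, m1⟩ := Exp.goes hs e he hl.1 p1 hr (h0.imp_left (·.1)) hg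
      (hB.trans' (by gcongr; omega))
    have h2 := goes_jumpZero (by rw [q1]; exact p2) h1.bounded
    rw [v1, if_neg hv, q1] at h2
    obtain ⟨g3, h3, q3, r3, z3⟩ := ih (g := ⟨g.pc + e.cost + 1, g1.reg, g1.mem⟩) hl.2 hs p3 (Rep_of_eq hr f1 m1)
      (by simp only [f1 0 z]; exact h0.imp_left (·.2)) h2.bounded
      (hB.trans' (by gcongr; omega))
    have h4 := goes_jump (c := g3) (B := B) (by rw [q3]; exact p4) h3.bounded
    simp only [f1 0 z] at z3
    obtain ⟨g5, h5, q5, r5, z5⟩ := ih' (g := ⟨g.pc, g3.reg, g3.mem⟩) hl' (h.store_below hl.2 hs) hP' r3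
      (by simp only [z3]; exact h0') h4.bounded
      (hB.trans' (by rw [add_assoc M, ← add_mul]; gcongr; omega))
    exact ⟨g5, (((h1.trans h2).trans h3).trans h4).trans h5, q5, r5, z5.trans z3⟩
  | @whileFalse s e c he hv =>
    simp only [maxLit, max_le_iff] at hl
    simp only [raw, Bool.and_eq_true] at h0
    simp only [compile, at_append, at_cons, compile_length, Exp.compile_length, List.length_append,
      List.length_cons, List.length_nil, ← add_assoc, zero_add] at hP
    obtain ⟨⟨⟨p1, p2, -⟩, p3⟩, p4, -⟩ := hP
    obtain ⟨g1, h1, q1, v1, f1, m1⟩ := Exp.goes hs e he hl.1 p1 hr (h0.imp_left (·.1)) hg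
      (hB.trans' (by gcongr; omega))
    have h2 := goes_jumpZero (by rw [q1]; exact p2) h1.bounded
    rw [v1, if_pos hv] at h2
    exact ⟨_, h1.trans h2, by simp only [size]; omega, Rep_of_eq hr f1 m1, f1 0 z⟩

end Cmd

end RAM

namespace RAM

/-! ### Weakest preconditions -/

namespace Cmd

/-- The variables that a command may change. -/
def wr : Cmd → ℕ → Bool
  | skip, _ => false
  | assign d _, r => d == r
  | store _ _ _, _ => false
  | seq c d, r => c.wr r || d.wr r
  | ite _ c d, r => c.wr r || d.wr r
  | Cmd.while _ c, r => c.wr r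

/-- The arrays that a command may change. -/
def wa : Cmd → Fin 16 → Bool
  | skip, _ => false
  | assign _ _, _ => false
  | store k _ _, r => k == r
  | seq c d, r => c.wa r || d.wa r
  | ite _ c d, r => c.wa r || d.wa r
  | Cmd.while _ c, r => c.wa r

/-- The two stores differ only in what the command may change. -/
def Frame (c : Cmd) (s s' : Store) : Prop :=
  (∀ r, c.wr r = false → s'.reg r = s.reg r) ∧ ∀ k, c.wa k = false → s'.arr k = s.arr k

theorem Frame.refl (c : Cmd) (s : Store) : Frame c s s := ⟨fun _ _ => rfl, fun _ _ => rfl⟩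

theorem Frame.trans {c : Cmd} {s s' s'' : Store} (h : Frame c s s') (h' : Frame c s' s'') :
    Frame c s s'' :=
  ⟨fun r hr => (h'.1 r hr).trans (h.1 r hr), fun k hk => (h'.2 k hk).trans (h.2 k hk)⟩

theorem Frame.mono {c d : Cmd} {s s' : Store} (h : Frame c s s')
    (hr : ∀ r, d.wr r = false → c.wr r = false) (ha : ∀ k, d.wa k = false → c.wa k = false) :
    Frame d s s' :=
  ⟨fun r h1 => h.1 r (hr r h1), fun k h1 => h.2 k (ha k h1)⟩

/-- What a command cannot change is computed from its syntax, so later proofs settle preservation by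
`rfl` or `decide`. -/
theorem Exec.frame {W K : ℕ} {c : Cmd} {s s' : Store} {t : ℕ} (h : Exec W K c s t s') :
    Frame c s s' := by
  induction h with
  | skip s => exact Frame.refl _ _
  | assign =>
    refine ⟨fun r hr => ?_, fun _ _ => rfl⟩
    simp only [wr, beq_eq_false_iff_ne] at hr
    simp [Store.set, Function.update_of_ne (Ne.symm hr)]
  | store =>
    refine ⟨fun _ _ => rfl, fun r hr => ?_⟩
    simp only [wa, beq_eq_false_iff_ne] at hr
    simp [Store.put, Function.update_of_ne (Ne.symm hr)]
  | seq _ _ ih ih' =>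
    exact Frame.trans (ih.mono (by simp +contextual [wr]) (by simp +contextual [wa]))
      (ih'.mono (by simp +contextual [wr]) (by simp +contextual [wa]))
  | iteTrue _ _ _ ih => exact ih.mono (by simp +contextual [wr]) (by simp +contextual [wa])
  | iteFalse _ _ _ ih => exact ih.mono (by simp +contextual [wr]) (by simp +contextual [wa])
  | whileTrue _ _ _ _ ih ih' => exact Frame.trans (ih.mono (by simp [wr]) (by simp [wa])) ih'
  | whileFalse => exact Frame.refl _ _

/-- The command terminates, and its running time and the final store satisfy `Q`. -/
def wp (W K : ℕ) (c : Cmd) (s : Store) (Q : ℕ → Store → Prop) : Prop :=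
  ∃ t s', Exec W K c s t s' ∧ Q t s'

variable {W K : ℕ} {s : Store} {Q : ℕ → Store → Prop}

theorem wp.imp {c : Cmd} {Q' : ℕ → Store → Prop} (h : wp W K c s Q)
    (hQ : ∀ t s', Frame c s s' → Q t s' → Q' t s') : wp W K c s Q' :=
  let ⟨t, s', he, hq⟩ := h
  ⟨t, s', he, hQ t s' he.frame hq⟩

theorem wp_skip (h : Q 0 s) : wp W K skip s Q := ⟨0, s, .skip s, h⟩

theorem wp_assign {d : ℕ} {e : Exp} (h : e.Ok W K s) (hQ : Q (e.cost + 1) (s.set d (e.eval s))) :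
    wp W K (assign d e) s Q := ⟨_, _, .assign h, hQ⟩

theorem wp_store {k : Fin 16} {i e : Exp} (hi : i.Ok W K s) (he : e.Ok W K s)
    (hk : k = 0 → i.eval s < W)
    (hQ : Q (i.cost + Exp.addrCost k + e.cost + 1) (s.put k (i.eval s) (e.eval s))) :
    wp W K (store k i e) s Q := ⟨_, _, .store hi he hk, hQ⟩

theorem wp_seq {c d : Cmd} (h : wp W K c s fun t s' => wp W K d s' fun t' s'' => Q (t + t') s'') :
    wp W K (seq c d) s Q :=
  let ⟨_, _, h1, _, _, h2, hQ⟩ := h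
  ⟨_, _, .seq h1 h2, hQ⟩

theorem wp_ite {e : Exp} {c d : Cmd} (he : e.Ok W K s)
    (h1 : e.eval s ≠ 0 → wp W K c s fun t s' => Q (e.cost + 1 + t + 1) s')
    (h2 : e.eval s = 0 → wp W K d s fun t s' => Q (e.cost + 1 + t) s') :
    wp W K (ite e c d) s Q := by
  by_cases h : e.eval s = 0
  · obtain ⟨t, s', h3, h4⟩ := h2 h
    exact ⟨_, _, .iteFalse he h h3, h4⟩
  · obtain ⟨t, s', h3, h4⟩ := h1 h
    exact ⟨_, _, .iteTrue he h h3, h4⟩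

/-- A sequence of commands. -/
def block : List Cmd → Cmd
  | [] => skip
  | c :: l => seq c (block l)

/-- The command repeated `m` times. -/
def iter (c : Cmd) : ℕ → Cmd
  | 0 => skip
  | m + 1 => seq c (iter c m)

theorem wp_iter_add {c : Cmd} (m m' : ℕ)
    (h : wp W K (iter c m) s fun t s' => wp W K (iter c m') s' fun t' s'' => Q (t + t') s'') :
    wp W K (iter c (m + m')) s Q := by
  induction m generalizing s Q with
  | zero =>
    obtain ⟨t, s', h1, h2⟩ := h
    cases h1
    simpa using h2
  | succ m ih =>
    obtain ⟨t, s', h1, h2⟩ := h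
    cases h1 with
    | seq h3 h4 =>
      rw [Nat.add_right_comm]
      refine wp_seq ⟨_, _, h3, ih ⟨_, _, h4, ?_⟩⟩
      simpa only [add_assoc] using h2

/-- `i := i + 1`. -/
def inc (i : ℕ) : Cmd := assign i (.addl (.var i) 1)

/-- For all `i` less than `N`. -/
def loop (i N : ℕ) (c : Cmd) : Cmd :=
  seq (assign i (.lit 0)) (Cmd.while (.sub (.var N) (.var i)) (seq c (inc i)))

/-- Unrolls the loop. The test takes 3 steps, and the conditional jump and the jump back add 2,
whence 5 per round; initialising the counter (2) and the final failing test (4) make 6. -/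
theorem wp_loop_iter {i N : ℕ} {c : Cmd} (hi : c.wr i = false) (hN : c.wr N = false) (hne : i ≠ N)
    (h : wp W K (iter (seq c (inc i)) (s.reg N)) (s.set i 0) fun t s' =>
      s'.reg i = s.reg N → Q (t + 5 * s.reg N + 6) s') :
    wp W K (Cmd.loop i N c) s Q := by
  have key : ∀ m (s1 : Store) (Q : ℕ → Store → Prop), s1.reg i + m = s1.reg N →
      (wp W K (iter (seq c (inc i)) m) s1 fun t s' => s'.reg i = s1.reg N → Q (t + 5 * m + 4) s') →
      wp W K (Cmd.while (.sub (.var N) (.var i)) (seq c (inc i))) s1 Q := by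
    intro m
    induction m with
    | zero =>
      rintro s1 Q h1 ⟨t, s', h2, h3⟩
      cases h2
      refine ⟨_, _, .whileFalse ⟨trivial, trivial⟩ (by simp [Exp.eval]; omega), ?_⟩
      simpa [Exp.cost] using h3 (by omega)
    | succ m ih =>
      rintro s1 Q h1 ⟨t, s', h2, h3⟩
      cases h2 with
      | @seq _ s2 _ t1 t2 _ _ h4 h5 =>
      cases h4 with
      | @seq _ s3 _ t3 t4 _ _ h6 h7 =>
      have hs2 : s2.reg i = s1.reg i + 1 := by
        cases h7
        simp [Store.set, Exp.eval, h6.frame.1 i hi]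
      have hs2' : s2.reg N = s1.reg N := by
        cases h7
        simp [Store.set, Function.update_of_ne hne.symm, h6.frame.1 N hN]
      obtain ⟨t5, s5, h8, h9⟩ := ih s2 (fun t' s'' => Q (3 + 1 + (t3 + t4) + 1 + t') s'') (by omega)
        ⟨t2, s', h5, fun h => by
          have := h3 (by rw [h, hs2'])
          refine cast ?_ this
          congr 1; ring⟩
      exact ⟨_, _, .whileTrue ⟨trivial, trivial⟩ (by simp [Exp.eval]; omega) (.seq h6 h7) h8, h9⟩
  refine wp_seq (wp_assign trivial (key (s.reg N) _ _ ?_ (h.imp fun t s' _ hq h => ?_)))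
  · simp [Store.set, Exp.eval, Function.update_of_ne hne.symm]
  · simp only [Store.set, Function.update_of_ne hne.symm] at h
    refine cast ?_ (hq h)
    simp only [Exp.cost]
    congr 1; ring

/-- The 9 is the overhead 5 of a round plus 4 for the increment. The invariant after the body refers
to the store with the counter already advanced. -/
theorem wp_loop {i N : ℕ} {c : Cmd} (Inv : ℕ → Store → Prop) (T : ℕ) (hi : c.wr i = false)
    (hN : c.wr N = false) (hne : i ≠ N) (h0 : Inv 0 (s.set i 0))
    (hstep : ∀ j s', j < s.reg N → s'.reg i = j → Frame (Cmd.loop i N c) s s' → Inv j s' →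
      wp W K c s' fun t s'' => t ≤ T ∧ Inv (j + 1) (s''.set i (j + 1)))
    (hend : ∀ t s', t ≤ (T + 9) * s.reg N + 6 → s'.reg i = s.reg N → Frame (Cmd.loop i N c) s s' →
      Inv (s.reg N) s' → Q t s') :
    wp W K (Cmd.loop i N c) s Q := by
  have key : ∀ m j (s1 : Store), j + m = s.reg N → s1.reg i = j → Frame (Cmd.loop i N c) s s1 →
      Inv j s1 → wp W K (iter (seq c (inc i)) m) s1 fun t s' => t ≤ (T + 4) * m ∧
        Frame (Cmd.loop i N c) s s' ∧ Inv (s.reg N) s' := by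
    intro m
    induction m with
    | zero =>
      intro j s1 h1 h2 h3 h4
      exact wp_skip ⟨by simp, h3, by simpa [← h1] using h4⟩
    | succ m ih =>
      intro j s1 h1 h2 h3 h4
      refine wp_seq (wp_seq ((hstep j s1 (by omega) h2 h3 h4).imp fun t s2 hf hq => ?_))
      have e2 : s2.reg i = j := by rw [hf.1 i hi, h2]
      refine wp_assign trivial ?_
      simp only [Exp.eval, e2]
      refine (ih (j + 1) _ (by omega) (by simp [Store.set]) (h3.trans ?_) hq.2).imp
        fun t' s' _ h => ⟨?_, h.2⟩
      · refine ⟨fun r hr => ?_, fun k hk => ?_⟩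
        · simp only [Cmd.loop, wr, inc, Bool.or_eq_false_iff, beq_eq_false_iff_ne] at hr
          simp [Store.set, Function.update_of_ne (Ne.symm hr.1), hf.1 r hr.2.1]
        · simp only [Cmd.loop, wa, inc, Bool.or_eq_false_iff] at hk
          simp [Store.set, hf.2 k hk.2.1]
      · have h1 := h.1
        have h2 := hq.1
        simp only [Exp.cost]
        nlinarith
  refine wp_loop_iter hi hN hne ((key (s.reg N) 0 _ (by simp) (by simp [Store.set]) ?_ h0).imp
    fun t s' _ h he => hend _ _ ?_ he h.2.1 h.2.2)
  · refine ⟨fun r hr => ?_, fun k hk => rfl⟩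
    simp only [Cmd.loop, wr, inc, Bool.or_eq_false_iff, beq_eq_false_iff_ne] at hr
    simp [Store.set, Function.update_of_ne (Ne.symm hr.1)]
  · have := h.1
    nlinarith

/-- The store in which a variable and an array have been replaced. -/
def _root_.RAM.Store.upd (s : Store) (i j : ℕ) (k : Fin 16) (g : ℕ → ℕ) : Store :=
  ⟨Function.update s.reg i j, Function.update s.arr k g⟩

/-- Fills the first `N` cells of array `k` with the values of an expression. -/
def map (i N : ℕ) (k : Fin 16) (e : Exp) : Cmd := Cmd.loop i N (store k (.var i) e)

/-- When cell `j` is computed, the cells below `j` have been overwritten. Quantifying over all `g`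
that agree with the old array from `j` on permits maps in place that read cell `j` itself. -/
theorem wp_map {i N : ℕ} {k : Fin 16} {e : Exp} (f : ℕ → ℕ) (hk : k ≠ 0) (hne : i ≠ N)
    (he : ∀ j < s.reg N, ∀ g, (∀ x, j ≤ x → g x = s.arr k x) →
      e.Ok W K (s.upd i j k g) ∧ e.eval (s.upd i j k g) = f j)
    (hQ : ∀ t ≤ (e.cost + 18) * s.reg N + 6,
      Q t (s.upd i (s.reg N) k fun x => if x < s.reg N then f x else s.arr k x)) :
    wp W K (map i N k e) s Q := by

  refine wp_loop (fun j s' => s' = s.upd i j k fun x => if x < j then f x else s.arr k x)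
    (1 + 7 + e.cost + 1) rfl rfl hne ?_ ?_ ?_
  · simp [Store.set, Store.upd]
  · rintro j s' hj hij - rfl
    obtain ⟨h1, h2⟩ := he j hj (fun x => if x < j then f x else s.arr k x)
      (fun x hx => if_neg (by omega))
    refine wp_store trivial h1 (fun h => absurd h hk) ⟨by simp [Exp.cost, Exp.addrCost, hk], ?_⟩
    rw [h2]
    ext x y
    · simp [Store.set, Store.upd, Store.put]
    · by_cases hx : x = k
      · subst hx
        simp only [Store.set, Store.upd, Store.put, Function.update_self, Exp.eval,
          Function.update_apply]
        split_ifs <;> first | rfl | omega | (subst_vars; rfl)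
      · simp [Store.set, Store.upd, Store.put, Function.update_of_ne hx]
  · rintro t s' ht - - rfl
    exact hQ t (ht.trans (by gcongr ?_ * _ + _; omega))

/-- For all `i` less than `N` that satisfy the condition, stores a value. -/
def scatter (i N : ℕ) (b : Exp) (k : Fin 16) (d e : Exp) : Cmd :=
  Cmd.loop i N (ite b (store k d e) skip)

-- Several `j` may hit the same cell. Since the stored value is the constant `c` and no expression
-- depends on the array written to, their order is irrelevant.
open Classical in
theorem wp_scatter {i N : ℕ} {k : Fin 16} {b d e : Exp} (P : ℕ → Prop) (f : ℕ → ℕ) (c : ℕ)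
    (hk : k ≠ 0) (hne : i ≠ N)
    (he : ∀ j < s.reg N, ∀ g, b.Ok W K (s.upd i j k g) ∧ (b.eval (s.upd i j k g) ≠ 0 ↔ P j) ∧
      d.Ok W K (s.upd i j k g) ∧ d.eval (s.upd i j k g) = f j ∧
      e.Ok W K (s.upd i j k g) ∧ e.eval (s.upd i j k g) = c)
    (hQ : ∀ t ≤ (b.cost + d.cost + e.cost + 19) * s.reg N + 6,
      Q t (s.upd i (s.reg N) k fun x => if ∃ j < s.reg N, P j ∧ f j = x then c else s.arr k x)) :
    wp W K (scatter i N b k d e) s Q := by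
  refine wp_loop (fun j s' => s' = s.upd i j k fun x =>
      if ∃ j' < j, P j' ∧ f j' = x then c else s.arr k x)
    (b.cost + d.cost + e.cost + 10) rfl rfl hne ?_ ?_ ?_
  · simp [Store.set, Store.upd]
  · rintro j s' hj hij - rfl
    obtain ⟨h1, h2, h3, h4, h5, h6⟩ := he j hj _
    refine wp_ite h1 (fun hb => ?_) (fun hb => ?_)
    · refine wp_store h3 h5 (fun h => absurd h hk)
        ⟨by simp [Exp.addrCost, hk]; omega, ?_⟩
      rw [h6, h4]
      have hP := h2.1 hb
      ext x y
      · simp [Store.set, Store.upd, Store.put]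
      · by_cases hx : x = k
        · subst hx
          simp only [Store.set, Store.upd, Store.put, Function.update_self, Function.update_apply]
          by_cases hy : y = f j
          · rw [if_pos hy, if_pos ⟨j, by omega, hP, hy.symm⟩]
          · rw [if_neg hy]
            refine if_congr ⟨fun ⟨z, h1, h2⟩ => ⟨z, by omega, h2⟩, fun ⟨z, h1, z2, z3⟩ => ?_⟩ rfl rfl
            rcases Nat.lt_succ_iff_lt_or_eq.1 h1 with h | rfl
            · exact ⟨z, h, z2, z3⟩
            · exact absurd z3.symm hy
        · simp [Store.set, Store.upd, Store.put, Function.update_of_ne hx]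
    · refine wp_skip ⟨by omega, ?_⟩
      have hP : ¬ P j := fun h => h2.2 h hb
      ext x y
      · simp [Store.set, Store.upd]
      · simp only [Store.set, Store.upd, Function.update_apply]
        split_ifs with hx
        · refine if_congr ⟨fun ⟨z, h1, h2⟩ => ⟨z, by omega, h2⟩, fun ⟨z, h1, z2, z3⟩ => ?_⟩ rfl rfl
          rcases Nat.lt_succ_iff_lt_or_eq.1 h1 with h | rfl
          · exact ⟨z, h, z2, z3⟩
          · exact absurd z2 hP
        · rfl
  · rintro t s' ht - - rfl
    exact hQ t (ht.trans (by gcongr ?_ * _ + _; omega))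

/-- The number in the invariant is a time budget that pays for each round, including test and jumps.
It serves as termination measure and allows amortised bounds. -/
theorem wp_while {e : Exp} {c : Cmd} (Inv : ℕ → Store → Prop) (m : ℕ) (h0 : Inv m s)
    (hok : ∀ m s', Inv m s' → e.Ok W K s')
    (hstep : ∀ m s', Inv m s' → e.eval s' ≠ 0 → wp W K c s' fun t s'' =>
      ∃ m', m' + t + e.cost + 2 ≤ m ∧ Inv m' s'')
    (hend : ∀ t s' m', t + m' ≤ m + e.cost + 1 → e.eval s' = 0 → Inv m' s' → Q t s') :
    wp W K (Cmd.while e c) s Q := by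
  induction m using Nat.strong_induction_on generalizing s Q with
  | _ m ih =>
    by_cases h : e.eval s = 0
    · exact ⟨_, _, .whileFalse (hok _ _ h0) h, hend _ _ m (by omega) h h0⟩
    · obtain ⟨t, s1, h1, m', h2, h3⟩ := hstep m s h0 h
      obtain ⟨t', s2, h4, h5⟩ := ih m' (by omega) (Q := fun t' s2 => Q (e.cost + 1 + t + 1 + t') s2)
        h3 (fun t' s2 m2 h4 h5 h6 => hend _ _ m2 (by omega) h5 h6)
      exact ⟨_, _, .whileTrue (hok _ _ h0) h h1 h4, h5⟩

end Cmd

end RAM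

namespace RAM

/-! ### Graphs in memory -/

/-- A graph with states below `n`, actions below `NA` and edges below `E`: the source of an action,
the action of an edge, and the destination of an edge. -/
structure Graph where
  n : ℕ
  NA : ℕ
  E : ℕ
  src : ℕ → ℕ
  act : ℕ → ℕ
  dst : ℕ → ℕ
  src_lt : ∀ x < NA, src x < n
  act_lt : ∀ j < E, act j < NA
  dst_lt : ∀ j < E, dst j < n

/-- One plus the last number `j < m` with `d j = t`, or `0`. -/
def lastIdx (d : ℕ → ℕ) : ℕ → ℕ → ℕ
  | 0, _ => 0
  | m + 1, t => if d m = t then m + 1 else lastIdx d m t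

/-- The number of `j < m` with `d j = t`. -/
def countIdx (d : ℕ → ℕ) : ℕ → ℕ → ℕ
  | 0, _ => 0
  | m + 1, t => (if d m = t then 1 else 0) + countIdx d m t

/-- The edges into `t` form a linked list from the last to the first; `countIdx` is the number of
links left. Links are shifted by one so that `0` can mark the end. -/
theorem lastIdx_spec (d : ℕ → ℕ) (m t : ℕ) :
    (lastIdx d m t = 0 ∧ countIdx d m t = 0 ∧ ∀ j < m, d j ≠ t) ∨
      ∃ q < m, lastIdx d m t = q + 1 ∧ d q = t ∧ countIdx d m t = countIdx d q t + 1 ∧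
        ∀ j < m, q < j → d j ≠ t := by
  induction m with
  | zero => simp [lastIdx, countIdx]
  | succ m ih =>
    by_cases h : d m = t
    · exact .inr ⟨m, by omega, by simp [lastIdx, h], h, by simp [countIdx, h, add_comm],
        fun j h1 h2 => by omega⟩
    · rcases ih with ⟨h1, h2, h3⟩ | ⟨q, h1, h2, h3, h4, h5⟩
      · refine .inl ⟨by simp [lastIdx, h, h1], by simp [countIdx, h, h2], fun j hj => ?_⟩
        rcases Nat.lt_succ_iff_lt_or_eq.1 hj with h | rfl
        exacts [h3 j h, h]
      · refine .inr ⟨q, by omega, by simp [lastIdx, h, h2], h3, by simp [countIdx, h, h4],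
          fun j hj hq => ?_⟩
        rcases Nat.lt_succ_iff_lt_or_eq.1 hj with h | rfl
        exacts [h5 j h hq, h]

/-- Every edge has exactly one destination. This makes the total time of the backward search linear.
-/
theorem sum_countIdx (d : ℕ → ℕ) (n m : ℕ) (h : ∀ j < m, d j < n) :
    ∑ t ∈ Finset.range n, countIdx d m t = m := by
  induction m with
  | zero => simp [countIdx]
  | succ m ih =>
    simp only [countIdx, Finset.sum_add_distrib]
    rw [ih fun j hj => h j (by omega), Finset.sum_ite_eq, if_pos (by simpa using h m (by omega))]
    omega

/-- The store holds the graph, with lists of the edges into each state. -/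
structure Graph.On (g : Graph) (s : Store) : Prop where
  n : s.reg 0 = g.n
  NA : s.reg 1 = g.NA
  E : s.reg 2 = g.E
  src : ∀ x < g.NA, s.arr 1 x = g.src x
  act : ∀ j < g.E, s.arr 2 j = g.act j
  dst : ∀ j < g.E, s.arr 3 j = g.dst j
  head : ∀ t < g.n, s.arr 4 t = lastIdx g.dst g.E t
  next : ∀ j < g.E, s.arr 5 j = lastIdx g.dst j (g.dst j)

theorem Graph.On.of_eq {g : Graph} {s s' : Store} (h : g.On s) (h0 : ∀ r < 3, s'.reg r = s.reg r)
    (h1 : ∀ k : Fin 16, k ≠ 0 → k < 6 → s'.arr k = s.arr k) : g.On s' where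
  n := (h0 0 (by omega)).trans h.n
  NA := (h0 1 (by omega)).trans h.NA
  E := (h0 2 (by omega)).trans h.E
  src := by rw [h1 1 (by decide) (by decide)]; exact h.src
  act := by rw [h1 2 (by decide) (by decide)]; exact h.act
  dst := by rw [h1 3 (by decide) (by decide)]; exact h.dst
  head := by rw [h1 4 (by decide) (by decide)]; exact h.head
  next := by rw [h1 5 (by decide) (by decide)]; exact h.next

/-- The action of edge `j` is enabled in array `6`, and its source is in array `7`. -/
def Graph.En (g : Graph) (s : Store) (j : ℕ) : Prop :=
  s.arr 6 (g.act j) = 1 ∧ s.arr 7 (g.src (g.act j)) = 1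

open Exp Cmd

/-- Adds the state in variable `23` to the set in array `10` and to the queue. -/
def push : Cmd :=
  block [.store 10 (var 23) (lit 1), .store 11 (var 20) (var 23), inc 20]

/-- Backward step along the edge before the one in variable `21`. -/
def bfsEdge : Cmd :=
  block [.assign 21 (sub (var 21) (lit 1)), .assign 23 (arr 1 (arr 2 (var 21))),
    .ite (sub (arr 6 (arr 2 (var 21))) (sub (lit 1) (arr 7 (var 23))))
      (.ite (arr 10 (var 23)) .skip push) .skip,
    .assign 21 (arr 5 (var 21))]

/-- Processes the first state of the queue. -/
def bfsState : Cmd :=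
  block [.assign 21 (arr 4 (arr 11 (var 19))), inc 19, .while (var 21) bfsEdge]

/-- Puts the states of the set in array `10` into the queue. -/
def bfsInit : Cmd :=
  .loop 10 0 (.ite (arr 10 (var 10)) (block [.store 11 (var 20) (var 10), inc 20]) .skip)

/-- Backward search: closes the set in array `10`. -/
def bfs : Cmd :=
  block [.assign 20 (lit 0), bfsInit, .assign 19 (lit 0),
    .while (sub (var 20) (var 19)) bfsState]

/-- The queue enumerates the set in array `10`, which lies between the set `X₀` and its closure. -/
structure BfsInv (g : Graph) (X₀ : ℕ → ℕ) (En : ℕ → Prop) (s : Store) : Prop where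
  bit : ∀ y < g.n, s.arr 10 y ≤ 1
  mem : ∀ y < g.n, s.arr 10 y = 1 ↔ ∃ i < s.reg 20, s.arr 11 i = y
  lt : ∀ i < s.reg 20, s.arr 11 i < g.n
  inj : ∀ i < s.reg 20, ∀ j < s.reg 20, s.arr 11 i = s.arr 11 j → i = j
  sub : ∀ y < g.n, X₀ y = 1 → s.arr 10 y = 1
  least : ∀ Z : Set ℕ, (∀ y < g.n, X₀ y = 1 → y ∈ Z) →
    (∀ j < g.E, En j → g.dst j ∈ Z → g.src (g.act j) ∈ Z) → ∀ y < g.n, s.arr 10 y = 1 → y ∈ Z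

theorem BfsInv.of_eq {g : Graph} {X₀ : ℕ → ℕ} {En : ℕ → Prop} {s s' : Store}
    (h : BfsInv g X₀ En s) (h20 : s'.reg 20 = s.reg 20) (h10 : s'.arr 10 = s.arr 10)
    (h11 : s'.arr 11 = s.arr 11) : BfsInv g X₀ En s' := by
  constructor
  · rw [h10]; exact h.bit
  · rw [h10, h20, h11]; exact h.mem
  · rw [h20, h11]; exact h.lt
  · rw [h20, h11]; exact h.inj
  · rw [h10]; exact h.sub
  · rw [h10]; exact h.least

theorem BfsInv.push {g : Graph} {X₀ : ℕ → ℕ} {En : ℕ → Prop} {s s' : Store} {j : ℕ}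
    (h : BfsInv g X₀ En s) (hj : j < g.E) (hE : En j) (hd : s.arr 10 (g.dst j) = 1)
    (hy : s.arr 10 (g.src (g.act j)) ≠ 1) (h20 : s'.reg 20 = s.reg 20 + 1)
    (h10 : s'.arr 10 = Function.update (s.arr 10) (g.src (g.act j)) 1)
    (h11 : s'.arr 11 = Function.update (s.arr 11) (s.reg 20) (g.src (g.act j))) :
    BfsInv g X₀ En s' := by
  have hyn : g.src (g.act j) < g.n := g.src_lt _ (g.act_lt j hj)
  have hlt : ∀ i < s.reg 20, Function.update (s.arr 11) (s.reg 20) (g.src (g.act j)) i =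
      s.arr 11 i := fun i hi => Function.update_of_ne (by omega) _ _
  have hnew : ∀ i < s.reg 20, s.arr 11 i ≠ g.src (g.act j) := fun i hi h' =>
    hy ((h.mem _ hyn).2 ⟨i, hi, h'⟩)
  constructor
  · intro y hyn'
    rw [h10, Function.update_apply]; split
    · exact le_rfl
    · exact h.bit y hyn'
  · intro y hyn'
    rw [h10, h20, h11, Function.update_apply]
    split
    · subst y
      exact ⟨fun _ => ⟨s.reg 20, by omega, by simp⟩, fun _ => rfl⟩
    · rw [h.mem y hyn']
      constructor
      · rintro ⟨i, hi, rfl⟩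
        exact ⟨i, by omega, hlt i hi⟩
      · rintro ⟨i, hi, h'⟩
        rcases Nat.lt_succ_iff_lt_or_eq.1 hi with hi | rfl
        · exact ⟨i, hi, by rw [← h', hlt i hi]⟩
        · simp at h'; omega
  · intro i hi
    rw [h11]; rw [h20] at hi
    rcases Nat.lt_succ_iff_lt_or_eq.1 hi with hi | rfl
    · rw [hlt i hi]; exact h.lt i hi
    · simpa using hyn
  · intro i hi i' hi' he
    rw [h11] at he; rw [h20] at hi hi'
    rcases Nat.lt_succ_iff_lt_or_eq.1 hi with hi | rfl <;>
      rcases Nat.lt_succ_iff_lt_or_eq.1 hi' with hi' | rfl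
    · rw [hlt i hi, hlt i' hi'] at he; exact h.inj i hi i' hi' he
    · rw [hlt i hi, Function.update_self] at he; exact absurd he (hnew i hi)
    · rw [hlt i' hi', Function.update_self] at he; exact absurd he.symm (hnew i' hi')
    · rfl
  · intro y hyn' hy0
    rw [h10, Function.update_apply]; split
    · rfl
    · exact h.sub y hyn' hy0
  · intro Z hZ hZ' y hyn'
    rw [h10, Function.update_apply]; split
    · subst y
      exact fun _ => hZ' j hj hE (h.least Z hZ hZ' _ (g.dst_lt j hj) hd)
    · exact h.least Z hZ hZ' y hyn'

variable {W K : ℕ} {g : Graph} {X₀ : ℕ → ℕ} {s : Store} {Q : ℕ → Store → Prop}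

theorem wp_bfsEdge (hg : g.On s) (hOK : ∀ x < g.NA, s.arr 6 x ≤ 1) (hA : ∀ y < g.n, s.arr 7 y ≤ 1)
    {q : ℕ} (hq : q < g.E) (h21 : s.reg 21 = q + 1) (hI : BfsInv g X₀ (g.En s) s)
    (hd : s.arr 10 (g.dst q) = 1)
    (hQ : ∀ t s', t ≤ 115 → s'.reg 21 = lastIdx g.dst q (g.dst q) → BfsInv g X₀ (g.En s) s' →
      (g.En s q → s'.arr 10 (g.src (g.act q)) = 1) →
      (∀ y < g.n, s.arr 10 y = 1 → s'.arr 10 y = 1) → s.reg 20 ≤ s'.reg 20 →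
      (∀ i < s.reg 20, s'.arr 11 i = s.arr 11 i) → Q t s') :
    wp W K bfsEdge s Q := by
  have hx : g.act q < g.NA := g.act_lt q hq
  have hy : g.src (g.act q) < g.n := g.src_lt _ hx
  have b1 := hOK _ hx
  have b2 := hA _ hy
  have e1 := hg.act q hq
  have e2 := hg.src _ hx
  have e3 := hg.next q hq
  refine wp_seq (wp_assign ⟨trivial, trivial⟩ (wp_seq (wp_assign (by simp [Exp.Ok]) ?_)))
  simp only [Exp.eval, Store.set, Function.update_self, h21, Nat.add_sub_cancel, e1, e2]
  -- For bits, `x - (1 - y)` with truncated subtraction is the conjunction of `x` and `y`.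
  refine wp_seq (wp_ite (by simp [Exp.Ok]) (fun hc => ?_) (fun hc => ?_))
  · simp [Exp.eval, e1] at hc
    have hE : g.En s q := ⟨by omega, by omega⟩
    refine wp_ite (by simp [Exp.Ok]) (fun hc => ?_) (fun hc => ?_)
    · simp [Exp.eval] at hc
      have := hI.bit _ hy
      refine wp_skip (wp_seq (wp_assign (by simp [Exp.Ok]) (wp_skip ?_)))
      refine hQ _ _ (by simp [Exp.cost, Exp.addrCost]) (by simp [Store.set, Exp.eval, e3])
        (hI.of_eq (by simp [Store.set]) rfl rfl) (fun _ => by simp [Store.set]; omega)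
        (fun _ _ h => h) (by simp [Store.set]) (fun _ _ => rfl)
    · simp [Exp.eval] at hc
      refine wp_seq (wp_store trivial trivial (by simp) (wp_seq (wp_store trivial trivial (by simp)
        (wp_seq (wp_assign trivial (wp_skip (wp_seq (wp_assign (by simp [Exp.Ok]) (wp_skip ?_)))))))))
      refine hQ _ _ (by simp [Exp.cost, Exp.addrCost])
        (by simp [Store.set, Store.put, Exp.eval, e3])
        (hI.push hq hE hd (by omega) (by simp [Store.set, Store.put, Exp.eval])
          (by simp [Store.set, Store.put, Exp.eval]) (by simp [Store.set, Store.put, Exp.eval]))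
        (fun _ => by simp [Store.set, Store.put, Exp.eval])
        (fun y _ h => by simp [Store.set, Store.put, Exp.eval, Function.update_apply, h])
        (by simp [Store.set, Store.put, Exp.eval]) (fun i hi => ?_)
      simp [Store.set, Store.put, Exp.eval, Function.update_apply]
      omega
  · simp [Exp.eval, e1] at hc
    refine wp_skip (wp_seq (wp_assign (by simp [Exp.Ok]) (wp_skip ?_)))
    refine hQ _ _ (by simp [Exp.cost, Exp.addrCost]) (by simp [Store.set, Exp.eval, e3])
      (hI.of_eq (by simp [Store.set]) rfl rfl) (fun h => by have := h.1; have := h.2; omega)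
      (fun _ _ h => h) (by simp [Store.set]) (fun _ _ => rfl)

theorem Graph.En.congr {s s' : Store} (h6 : s'.arr 6 = s.arr 6) (h7 : s'.arr 7 = s.arr 7) :
    g.En s' = g.En s := by
  funext j; simp [Graph.En, h6, h7]

theorem wp_bfsState (hg : g.On s) (hOK : ∀ x < g.NA, s.arr 6 x ≤ 1)
    (hA : ∀ y < g.n, s.arr 7 y ≤ 1) (hI : BfsInv g X₀ (g.En s) s) (hh : s.reg 19 < s.reg 20)
    (hQ : ∀ t s', t ≤ 120 * countIdx g.dst g.E (s.arr 11 (s.reg 19)) + 30 →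
      Frame bfsState s s' → s'.reg 19 = s.reg 19 + 1 → BfsInv g X₀ (g.En s) s' →
      (∀ j < g.E, g.dst j = s.arr 11 (s.reg 19) → g.En s j → s'.arr 10 (g.src (g.act j)) = 1) →
      (∀ y < g.n, s.arr 10 y = 1 → s'.arr 10 y = 1) → s.reg 20 ≤ s'.reg 20 →
      (∀ i < s.reg 20, s'.arr 11 i = s.arr 11 i) → Q t s') :
    wp W K bfsState s Q := by
  set t₀ := s.arr 11 (s.reg 19) with ht₀
  have ht : t₀ < g.n := hI.lt _ hh
  have hX : s.arr 10 t₀ = 1 := (hI.mem _ ht).2 ⟨_, hh, rfl⟩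
  suffices h : wp W K bfsState s fun t s' => t ≤ 120 * countIdx g.dst g.E t₀ + 30 ∧
      s'.reg 19 = s.reg 19 + 1 ∧ BfsInv g X₀ (g.En s) s' ∧
      (∀ j < g.E, g.dst j = t₀ → g.En s j → s'.arr 10 (g.src (g.act j)) = 1) ∧
      (∀ y < g.n, s.arr 10 y = 1 → s'.arr 10 y = 1) ∧ s.reg 20 ≤ s'.reg 20 ∧
      (∀ i < s.reg 20, s'.arr 11 i = s.arr 11 i) by
    refine h.imp fun t s' hf ⟨h1, h2, h3, h4, h5, h6, h7⟩ => hQ t s' h1 hf h2 h3 h4 h5 h6 h7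
  refine wp_seq (wp_assign (by simp [Exp.Ok]) (wp_seq (wp_assign trivial (wp_seq ?_))))
  -- The edges into `t₀` with numbers from `m` on have been treated. Each remaining one has a budget
  -- of 120: at most 115 for `bfsEdge`, and the overhead of the loop.
  refine wp_while (fun M s' => ∃ m ≤ g.E, s'.reg 21 = lastIdx g.dst m t₀ ∧
      M = 120 * countIdx g.dst m t₀ ∧ g.On s' ∧ s'.arr 6 = s.arr 6 ∧ s'.arr 7 = s.arr 7 ∧
      s'.reg 19 = s.reg 19 + 1 ∧ BfsInv g X₀ (g.En s) s' ∧
      (∀ j < g.E, m ≤ j → g.dst j = t₀ → g.En s j → s'.arr 10 (g.src (g.act j)) = 1) ∧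
      (∀ y < g.n, s.arr 10 y = 1 → s'.arr 10 y = 1) ∧ s.reg 20 ≤ s'.reg 20 ∧
      (∀ i < s.reg 20, s'.arr 11 i = s.arr 11 i)) (120 * countIdx g.dst g.E t₀) ?_
      (fun _ _ _ => trivial) ?_ ?_
  · refine ⟨g.E, le_rfl, ?_, rfl, hg.of_eq (fun r hr => ?_) (fun _ _ _ => rfl), rfl, rfl, ?_,
      hI.of_eq ?_ rfl rfl, fun j h1 h2 => by omega, fun _ _ h => h, ?_, fun _ _ => rfl⟩
    · simp [Store.set, Exp.eval, hg.head _ ht, ← ht₀]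
    · simp only [Store.set, Function.update_apply]
      rw [if_neg (by omega), if_neg (by omega)]
    all_goals simp [Store.set, Exp.eval]
  · rintro M s' ⟨m, hm, h21, rfl, hg', h6, h7, h19, hI', hdone, hmono, htl, hpre⟩ hne
    rcases lastIdx_spec g.dst m t₀ with ⟨h1, -, -⟩ | ⟨q, hqm, h1, hdq, hcnt, hlast⟩
    · exact absurd (h21.trans h1) hne
    have hEn : g.En s' = g.En s := Graph.En.congr h6 h7
    suffices h : wp W K bfsEdge s' fun t s'' => t ≤ 115 ∧
        s''.reg 21 = lastIdx g.dst q (g.dst q) ∧ BfsInv g X₀ (g.En s) s'' ∧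
        (g.En s q → s''.arr 10 (g.src (g.act q)) = 1) ∧
        (∀ y < g.n, s'.arr 10 y = 1 → s''.arr 10 y = 1) ∧ s'.reg 20 ≤ s''.reg 20 ∧
        (∀ i < s'.reg 20, s''.arr 11 i = s'.arr 11 i) by
      refine h.imp fun t s'' hf ⟨b1, b2, b3, b4, b5, b6, b7⟩ => ⟨120 * countIdx g.dst q t₀, ?_, q,
        by omega, by rw [b2, hdq], rfl, hg'.of_eq (fun r hr => hf.1 r ?_) (fun k hk h1 => hf.2 k ?_),
        (hf.2 6 rfl).trans h6, (hf.2 7 rfl).trans h7, (hf.1 19 rfl).trans h19, b3, ?_,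
        fun y hy h => b5 y hy (hmono y hy h), htl.trans b6, fun i hi => ?_⟩
      · simp only [Exp.cost]; omega
      · interval_cases r <;> rfl
      · revert k; decide
      · intro j hj hqj hdj hEj
        rcases hqj.eq_or_lt with rfl | hqj
        · exact b4 hEj
        · by_cases hmj : m ≤ j
          · exact b5 _ (g.src_lt _ (g.act_lt j hj)) (hdone j hj hmj hdj hEj)
          · exact absurd hdj (hlast j (by omega) hqj)
      · rw [b7 i (by omega), hpre i hi]
    refine wp_bfsEdge (X₀ := X₀) hg' (by rw [h6]; exact hOK) (by rw [h7]; exact hA)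
      (q := q) (by omega) (h21.trans h1) (hEn ▸ hI') (by rw [hdq]; exact hmono _ ht hX) ?_
    rw [hEn]
    exact fun t s'' a1 a2 a3 a4 a5 a6 a7 => ⟨a1, a2, a3, a4, a5, a6, a7⟩
  · rintro t s' M ht' h0 ⟨m, hm, h21, rfl, hg', h6, h7, h19, hI', hdone, hmono, htl, hpre⟩
    refine wp_skip ⟨by simp [Exp.cost, Exp.addrCost] at ht' ⊢; omega, h19, hI', ?_, hmono, htl, hpre⟩
    rcases lastIdx_spec g.dst m t₀ with ⟨h1, -, h2⟩ | ⟨q, hqm, h1, -⟩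
    · intro j hj hdj hEj
      by_cases hmj : m ≤ j
      · exact hdone j hj hmj hdj hEj
      · exact absurd hdj (h2 j (by omega))
    · simp only [Exp.eval] at h0; omega

theorem wp_bfsInit (hg : g.On s) (h20 : s.reg 20 = 0) (hX : ∀ y < g.n, s.arr 10 y ≤ 1)
    (hQ : ∀ t s', t ≤ 60 * g.n + 6 → Frame bfsInit s s' →
      BfsInv g (s.arr 10) (g.En s) s' → Q t s') :
    wp W K bfsInit s Q := by
  refine wp_loop (fun m s' => (∀ y < g.n, (y < m ∧ s.arr 10 y = 1) ↔
      ∃ i < s'.reg 20, s'.arr 11 i = y) ∧ (∀ i < s'.reg 20, s'.arr 11 i < m) ∧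
      (∀ i < s'.reg 20, ∀ j < s'.reg 20, s'.arr 11 i = s'.arr 11 j → i = j)) 50 rfl rfl
      (by decide) ?_ ?_ ?_
  · simp [Store.set, h20]
  · rintro m s' hm h10 hf ⟨h1, h2, h3⟩
    have hX' : s'.arr 10 = s.arr 10 := hf.2 10 rfl
    rw [hg.n] at hm
    refine wp_ite (by simp [Exp.Ok]) (fun hc => ?_) (fun hc => ?_)
    · simp only [Exp.eval, hX', h10] at hc
      have hb := hX m hm
      have hlt : ∀ i < s'.reg 20, Function.update (s'.arr 11) (s'.reg 20) m i = s'.arr 11 i :=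
        fun i hi => Function.update_of_ne (by omega) _ _
      refine wp_seq (wp_store trivial trivial (by simp) (wp_seq (wp_assign trivial (wp_skip
        ⟨by simp [Exp.cost, Exp.addrCost], ?_⟩))))
      simp only [Store.set, Store.put, Exp.eval, h10, Function.update_self,
        Function.update_of_ne (show (20 : ℕ) ≠ 10 by decide)]
      refine ⟨fun y hy => ?_, fun i hi => ?_, fun i hi j hj he => ?_⟩
      · constructor
        · rintro ⟨hym, hy1⟩
          by_cases hy : y = m
          · exact ⟨s'.reg 20, by omega, by simp [hy]⟩
          · obtain ⟨i, hi, hi'⟩ := (h1 y ‹_›).1 ⟨by omega, hy1⟩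
            exact ⟨i, by omega, by rw [hlt i hi, hi']⟩
        · rintro ⟨i, hi, hi'⟩
          rcases Nat.lt_succ_iff_lt_or_eq.1 hi with hi | rfl
          · rw [hlt i hi] at hi'
            have := (h1 y hy).2 ⟨i, hi, hi'⟩
            exact ⟨by omega, this.2⟩
          · simp at hi'
            subst hi'
            exact ⟨by omega, by omega⟩
      · rcases Nat.lt_succ_iff_lt_or_eq.1 hi with hi | rfl
        · rw [hlt i hi]; have := h2 i hi; omega
        · simp
      · rcases Nat.lt_succ_iff_lt_or_eq.1 hi with hi | rfl <;>
          rcases Nat.lt_succ_iff_lt_or_eq.1 hj with hj | rfl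
        · rw [hlt i hi, hlt j hj] at he; exact h3 i hi j hj he
        · rw [hlt i hi, Function.update_self] at he; have := h2 i hi; omega
        · rw [hlt j hj, Function.update_self] at he; have := h2 j hj; omega
        · rfl
    · simp only [Exp.eval, hX', h10] at hc
      refine wp_skip ⟨by simp [Exp.cost, Exp.addrCost], ?_⟩
      simp only [Store.set, Function.update_of_ne (show (20 : ℕ) ≠ 10 by decide)]
      refine ⟨fun y hy => ?_, fun i hi => by have := h2 i hi; omega, h3⟩
      rw [← h1 y hy]
      refine ⟨fun ⟨a, b⟩ => ⟨?_, b⟩, fun ⟨a, b⟩ => ⟨by omega, b⟩⟩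
      rcases Nat.lt_succ_iff_lt_or_eq.1 a with a | rfl
      · exact a
      · omega
  · rintro t s' ht - hf ⟨h1, h2, h3⟩
    have hX' : s'.arr 10 = s.arr 10 := hf.2 10 rfl
    rw [hg.n] at ht h1 h2
    refine hQ t s' (by omega) hf ⟨by rw [hX']; exact hX, fun y hy => ?_, h2, h3,
      fun y _ h => by rw [hX']; exact h, fun Z hZ _ y hy h => hZ y hy (by rw [← hX']; exact h)⟩
    rw [← h1 y hy, hX']
    simp [hy]

/-- No state enters the queue twice, so each list of incoming edges is traversed at most once. When
the queue is exhausted, all members of the set have been processed, and hence the set is closed. -/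
theorem wp_bfs (hg : g.On s) (hOK : ∀ x < g.NA, s.arr 6 x ≤ 1) (hA : ∀ y < g.n, s.arr 7 y ≤ 1)
    (hX : ∀ y < g.n, s.arr 10 y ≤ 1)
    (hQ : ∀ t s', t ≤ 120 * g.n + 120 * g.E + 30 → Frame bfs s s' →
      (∀ y < g.n, s'.arr 10 y ≤ 1) → (∀ y < g.n, s.arr 10 y = 1 → s'.arr 10 y = 1) →
      (∀ j < g.E, g.En s j → s'.arr 10 (g.dst j) = 1 → s'.arr 10 (g.src (g.act j)) = 1) →
      (∀ Z : Set ℕ, (∀ y < g.n, s.arr 10 y = 1 → y ∈ Z) →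
        (∀ j < g.E, g.En s j → g.dst j ∈ Z → g.src (g.act j) ∈ Z) →
        ∀ y < g.n, s'.arr 10 y = 1 → y ∈ Z) → Q t s') :
    wp W K bfs s Q := by
  suffices h : wp W K bfs s fun t s' => t ≤ 120 * g.n + 120 * g.E + 30 ∧
      BfsInv g (s.arr 10) (g.En s) s' ∧
      (∀ j < g.E, g.En s j → s'.arr 10 (g.dst j) = 1 → s'.arr 10 (g.src (g.act j)) = 1) from
    h.imp fun t s' hf ⟨h1, h2, h3⟩ => hQ t s' h1 hf h2.bit h2.sub h3 h2.least
  refine wp_seq (wp_assign trivial (wp_seq (wp_bfsInit (g := g) (hg.of_eq (fun r hr => ?_)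
    (fun _ _ _ => rfl)) (by simp [Store.set, Exp.eval]) hX fun t₁ s₁ ht₁ hf₁ hI₁ =>
      wp_seq (wp_assign trivial (wp_seq ?_)))))
  · simp only [Store.set, Function.update_of_ne (show r ≠ 20 by omega)]
  have hEn : g.En (s.set 20 (Exp.eval s (lit 0))) = g.En s := rfl
  rw [hEn] at hI₁
  have hI₁ : BfsInv g (s.arr 10) (g.En s) s₁ := hI₁
  -- The time budget: the cost of all states not among the first `m` of the queue. Initially it is
  -- linear in states and edges, and processing a state consumes its own summand.
  let Φ (s' : Store) (m : ℕ) : ℕ :=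
    ∑ t ∈ Finset.range g.n \ (Finset.range m).image (s'.arr 11), (120 * countIdx g.dst g.E t + 40)
  have hΦ : ∀ s', Φ s' 0 = 120 * g.E + 40 * g.n := by
    intro s'
    simp only [Φ, Finset.range_zero, Finset.image_empty, Finset.sdiff_empty,
      Finset.sum_add_distrib, ← Finset.mul_sum, sum_countIdx g.dst g.n g.E g.dst_lt]
    simp [mul_comm]
  refine wp_while (fun M s' => M = Φ s' (s'.reg 19) ∧ s'.reg 19 ≤ s'.reg 20 ∧ g.On s' ∧
      s'.arr 6 = s.arr 6 ∧ s'.arr 7 = s.arr 7 ∧ BfsInv g (s.arr 10) (g.En s) s' ∧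
      ∀ i < s'.reg 19, ∀ j < g.E, g.dst j = s'.arr 11 i → g.En s j →
        s'.arr 10 (g.src (g.act j)) = 1) (120 * g.E + 40 * g.n) ?_ (fun _ _ _ => by simp [Exp.Ok])
      ?_ ?_
  · refine ⟨by simp [Store.set, Exp.eval, hΦ], by simp [Store.set, Exp.eval],
      hg.of_eq (fun r hr => ?_) (fun k hk hk6 => ?_), hf₁.2 6 rfl, hf₁.2 7 rfl,
      hI₁.of_eq (by simp [Store.set]) rfl rfl, by simp [Store.set, Exp.eval]⟩
    · simp only [Store.set, Function.update_of_ne (show r ≠ 19 by omega)]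
      rw [hf₁.1 r (by interval_cases r <;> rfl)]
      simp only [Store.set, Function.update_of_ne (show r ≠ 20 by omega)]
    · refine (hf₁.2 k ?_).trans rfl
      revert k; decide
  · rintro M s' ⟨rfl, hle, hg', h6, h7, hI', hdone⟩ hc
    simp only [Exp.eval] at hc
    have hEn : g.En s' = g.En s := Graph.En.congr h6 h7
    have hlt : s'.reg 19 < s'.reg 20 := by omega
    refine wp_bfsState (X₀ := s.arr 10) hg' (by rw [h6]; exact hOK) (by rw [h7]; exact hA)
      (hEn ▸ hI') hlt ?_
    rw [hEn]
    intro t s'' b1 hf b2 b3 b4 b5 b6 b7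
    refine ⟨Φ s'' (s''.reg 19), ?_, rfl, by omega, hg'.of_eq (fun r hr => hf.1 r ?_)
      (fun k hk h1 => hf.2 k ?_), (hf.2 6 rfl).trans h6, (hf.2 7 rfl).trans h7, b3, ?_⟩
    · have himg : (Finset.range (s'.reg 19 + 1)).image (s''.arr 11) =
          insert (s'.arr 11 (s'.reg 19)) ((Finset.range (s'.reg 19)).image (s'.arr 11)) := by
        rw [Finset.range_add_one, Finset.image_insert, b7 _ hlt]
        congr 1
        exact Finset.image_congr fun i hi => b7 i (by simp at hi; omega)
      have hmem : s'.arr 11 (s'.reg 19) ∈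
          Finset.range g.n \ (Finset.range (s'.reg 19)).image (s'.arr 11) := by
        simp only [Finset.mem_sdiff, Finset.mem_range, Finset.mem_image, not_exists, not_and]
        refine ⟨hI'.lt _ hlt, fun i hi he => ?_⟩
        have := hI'.inj i (by omega) _ hlt he
        omega
      have := Finset.sum_erase_add _ (fun t => 120 * countIdx g.dst g.E t + 40) hmem
      have hset : Finset.range g.n \ insert (s'.arr 11 (s'.reg 19))
          ((Finset.range (s'.reg 19)).image (s'.arr 11)) =
          (Finset.range g.n \ (Finset.range (s'.reg 19)).image (s'.arr 11)).erase
            (s'.arr 11 (s'.reg 19)) := by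
        ext x; simp only [Finset.mem_sdiff, Finset.mem_insert, Finset.mem_erase]; tauto
      simp only [Φ, b2, himg, hset, Exp.cost]
      omega
    · interval_cases r <;> rfl
    · revert k; decide
    · intro i hi j hj hd hE
      rw [b2] at hi
      have hsrc := g.src_lt _ (g.act_lt j hj)
      rcases Nat.lt_succ_iff_lt_or_eq.1 hi with hi | rfl
      · rw [b7 i (by omega)] at hd
        exact b5 _ hsrc (hdone i hi j hj hd hE)
      · rw [b7 _ hlt] at hd
        exact b4 j hj hd hE
  · rintro t s' M ht hc ⟨rfl, hle, hg', h6, h7, hI', hdone⟩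
    simp only [Exp.eval] at hc
    refine wp_skip ⟨by simp only [Exp.cost] at ht ⊢; omega, hI', fun j hj hE hd => ?_⟩
    obtain ⟨i, hi, hi'⟩ := (hI'.mem _ (g.dst_lt j hj)).1 hd
    exact hdone i (by omega) j hj hi'.symm hE

end RAM

-- One round of a fixed point computation in linear time

namespace RAM

open Exp Cmd

variable {S : Type u} {Act : Type v} {AP : Type w} {n : ℕ}

/-- The graph consists of the actions and the destinations of the Markov decision process. -/
structure Graph.Represents (g : Graph) (G : MDP S Act AP) (e : S ≃ Fin n) : Prop where
  n_eq : g.n = n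
  exists_act : ∀ s, ∀ a ∈ G.mov s, ∃ x < g.NA, g.src x = e s ∧
    ∀ t, t ∈ G.dest s a ↔ ∃ j < g.E, g.act j = x ∧ g.dst j = e t
  exists_mov : ∀ x < g.NA, ∃ s, ∃ a ∈ G.mov s, g.src x = e s ∧
    ∀ t, t ∈ G.dest s a ↔ ∃ j < g.E, g.act j = x ∧ g.dst j = e t

open Classical in
/-- The array holds the characteristic vector of the set. -/
def Vec (e : S ≃ Fin n) (X : Set S) (f : ℕ → ℕ) : Prop := ∀ s, f (e s) = if s ∈ X then 1 else 0

theorem exists_index (e : S ≃ Fin n) {j : ℕ} (h : j < n) : ∃ s, (e s : ℕ) = j :=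
  ⟨e.symm ⟨j, h⟩, by simp⟩

theorem Vec.le_one {e : S ≃ Fin n} {X : Set S} {f : ℕ → ℕ} (h : Vec e X f) {j : ℕ} (hj : j < n) :
    f j ≤ 1 := by
  obtain ⟨s, rfl⟩ := exists_index e hj
  rw [h s]; split <;> simp

theorem Vec.eq_one {e : S ≃ Fin n} {X : Set S} {f : ℕ → ℕ} (h : Vec e X f) (s : S) :
    f (e s) = 1 ↔ s ∈ X := by
  rw [h s]; split <;> simp_all

theorem Vec.congr {e : S ≃ Fin n} {X : Set S} {f f' : ℕ → ℕ} (h : Vec e X f)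
    (hf : ∀ j < n, f' j = f j) : Vec e X f' := fun s => by rw [hf _ (e s).2, h s]

theorem Vec.of_iff {e : S ≃ Fin n} {X : Set S} {f : ℕ → ℕ} (h1 : ∀ j < n, f j ≤ 1)
    (h : ∀ s, f (e s) = 1 ↔ s ∈ X) : Vec e X f := fun s => by
  have h1 := h1 _ (e s).2
  have h := h s
  split
  · simp_all
  · have : f (e s) ≠ 1 := by simp_all
    omega

/-- One round of the fixed point computation, on the arrays `7`, `8`, `9`. -/
def roundCmd : Cmd :=
  block [.map 10 1 6 (var 14),
    .scatter 10 2 (add (sub (arr 9 (arr 3 (var 10))) (var 14)) (sub (var 14) (arr 9 (arr 3 (var 10)))))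
      6 (arr 2 (var 10)) (sub (lit 1) (var 14)),
    .map 10 0 10 (arr 8 (var 10)),
    .ite (var 17) bfs
      (.scatter 10 1 (sub (arr 6 (var 10)) (sub (lit 1) (arr 7 (arr 1 (var 10))))) 10
        (arr 1 (var 10)) (lit 1)),
    .map 10 0 9 (arr 10 (var 10))]

variable {W K : ℕ} {g : Graph} {s : Store} {Q : ℕ → Store → Prop} {G : MDP S Act AP}
  {e : S ≃ Fin n}

open Classical in
/-- The flags of the enabled actions. -/
theorem Graph.Represents.enabled_iff (hr : g.Represents G e) (all : Bool) {Y : Set S} {f : ℕ → ℕ}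
    (hY : Vec e Y f) {s : S} {a : Act} {x v : ℕ} (hv : v = if all then 1 else 0)
    (hx : ∀ t, t ∈ G.dest s a ↔ ∃ j < g.E, g.act j = x ∧ g.dst j = e t) :
    (if ∃ j < g.E, f (g.dst j) ≠ v ∧ g.act j = x then 1 - v else v) = 1 ↔
      if all then G.dest s a ⊆ Y else (G.dest s a ∩ Y).Nonempty := by
  have hdst : ∀ j < g.E, ∃ t, (e t : ℕ) = g.dst j := fun j hj =>
    exists_index e (hr.n_eq ▸ g.dst_lt j hj)
  cases all
  · simp only [Bool.false_eq_true, if_false] at hv ⊢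
    subst hv
    constructor
    · intro h
      split_ifs at h with h'
      obtain ⟨j, hj, h1, h2⟩ := h'
      obtain ⟨t, ht⟩ := hdst j hj
      refine ⟨t, (hx t).2 ⟨j, hj, h2, ht.symm⟩, (hY.eq_one t).1 ?_⟩
      have := hY.le_one (e t).2
      rw [ht] at this ⊢; omega
    · rintro ⟨t, ht, htY⟩
      obtain ⟨j, hj, h1, h2⟩ := (hx t).1 ht
      rw [if_pos ⟨j, hj, by rw [h2, (hY.eq_one t).2 htY]; simp, h1⟩]
  · simp only [if_true] at hv ⊢
    subst hv
    constructor
    · intro h t ht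
      obtain ⟨j, hj, h1, h2⟩ := (hx t).1 ht
      by_contra hc
      rw [if_pos ⟨j, hj, by rw [h2]; exact fun h => hc ((hY.eq_one t).1 h), h1⟩] at h
      omega
    · intro h
      rw [if_neg]
      rintro ⟨j, hj, h1, h2⟩
      obtain ⟨t, ht⟩ := hdst j hj
      exact h1 (ht ▸ (hY.eq_one t).2 (h ((hx t).2 ⟨j, hj, h2, ht.symm⟩)))

/-- Both kinds of predecessors are treated uniformly: the flag of an action starts as the bit `all`
and flips if some destination has a bit in `Y` different from it. The search is used only with
`all`, where the flags say which actions stay in `Y`. -/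
theorem wp_roundCmd (hK : 1 ≤ K) (hn : 0 < n) (hg : g.On s) (hr : g.Represents G e)
    (reach all : Bool) (hra : reach = true → all = true) {A B Y : Set S} (hA : Vec e A (s.arr 7))
    (hB : Vec e B (s.arr 8)) (hY : Vec e Y (s.arr 9)) (h14 : s.reg 14 = if all then 1 else 0)
    (h17 : s.reg 17 = if reach then 1 else 0)
    (hQ : ∀ t s', t ≤ 300 * (n + g.NA + g.E) → Frame roundCmd s s' →
      Vec e (G.round reach all A B Y) (s'.arr 9) → Q t s') :
    wp W K roundCmd s Q := by
  classical
  have hv1 : s.reg 14 ≤ 1 := by rw [h14]; split <;> simp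
  have hgn := hr.n_eq
  have hdst : ∀ j < g.E, ∃ t, (e t : ℕ) = g.dst j := fun j hj =>
    exists_index e (hgn ▸ g.dst_lt j hj)
  have hsrc : ∀ x < g.NA, ∃ t, (e t : ℕ) = g.src x := fun x hx =>
    exists_index e (hgn ▸ g.src_lt x hx)
  suffices h : wp W K roundCmd s fun t s' => t ≤ 300 * (n + g.NA + g.E) ∧
      Vec e (G.round reach all A B Y) (s'.arr 9) from
    h.imp fun t s' hf ⟨h1, h2⟩ => hQ t s' h1 hf h2
  refine wp_seq (wp_map (fun _ => s.reg 14) (by decide) (by decide)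
    (fun j _ f _ => by simp [Exp.Ok, Exp.eval, Store.upd]) fun t1 ht1 => ?_)
  refine wp_seq (wp_scatter (fun j => s.arr 9 (g.dst j) ≠ s.reg 14) g.act (1 - s.reg 14)
    (by decide) (by decide) (fun j hj f => ?_) fun t2 ht2 => ?_)
  · have hj' : j < g.E := by simpa [Store.upd, hg.E] using hj
    have h1 := hY.le_one (hgn ▸ g.dst_lt j hj')
    simp [Exp.Ok, Exp.eval, Store.upd, hg.dst j hj', hg.act j hj']
    omega
  refine wp_seq (wp_map (s.arr 8) (by decide) (by decide)
    (fun j _ f _ => by simp [Exp.Ok, Exp.eval, Store.upd]) fun t3 ht3 => ?_)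
  simp only [Store.upd, Exp.cost, Exp.addrCost] at ht1 ht2 ht3 ⊢
  simp [hg.n, hg.NA, hg.E, hgn] at ht1 ht2 ht3 ⊢
  -- The content of array `6` after the first two passes.
  set ok : ℕ → ℕ := fun x => if ∃ j < g.E, ¬ s.arr 9 (g.dst j) = s.reg 14 ∧ g.act j = x then
      1 - s.reg 14 else if x < g.NA then s.reg 14 else s.arr 6 x with hok
  have hok1 : ∀ x, x < g.NA → ok x ≤ 1 := by
    intro x hx; simp only [hok, if_pos hx]; split <;> omega
  have hokiff : ∀ {s' : S} {a : Act} {x : ℕ}, x < g.NA →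
      (∀ t, t ∈ G.dest s' a ↔ ∃ j < g.E, g.act j = x ∧ g.dst j = e t) →
      (ok x = 1 ↔ if all then G.dest s' a ⊆ Y else (G.dest s' a ∩ Y).Nonempty) := by
    intro s' a x hx h
    rw [← hr.enabled_iff all hY h14 h]
    simp only [hok, if_pos hx, ne_eq]
  refine wp_seq (wp_ite trivial (fun hc => ?_) (fun hc => ?_))
  · simp [Exp.eval, h17] at hc
    subst hc
    obtain rfl := hra rfl
    refine wp_bfs (g := g) (hg.of_eq (fun r hr => ?_) (fun k hk hk6 => ?_)) ?_ ?_ ?_ ?_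
    · simp only; rw [Function.update_of_ne (by omega)]
    · have h6 : k ≠ 6 := by rintro rfl; revert hk6; decide
      have h10 : k ≠ 10 := by rintro rfl; revert hk6; decide
      simp [Function.update_of_ne h6, Function.update_of_ne h10]
    · simpa using hok1
    · simpa [hgn] using fun y hy => hA.le_one hy
    · simp +contextual [hgn]
      exact fun y hy => hB.le_one hy
    · intro t4 s4 ht4 hf4 hb1 hb2 hb3 hb4
      refine wp_seq (wp_map (s4.arr 10) (by decide) (by decide)
        (fun j _ f _ => by simp [Exp.Ok, Exp.eval, Store.upd]) fun t5 ht5 => wp_skip ?_)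
      have h40 : s4.reg 0 = n := by rw [hf4.1 0 rfl]; simp [hg.n, hgn]
      rw [h40] at ht5 ⊢
      simp [Exp.cost, Exp.addrCost] at ht5
      refine ⟨by simp only [Exp.cost]; omega, ?_⟩
      simp only [Store.upd, Function.update_self, MDP.round]
      simp [Graph.En, hgn] at hb1 hb2 hb3 hb4
      refine Vec.of_iff (fun j hj => by simpa [hj] using hb1 j hj) fun s' => ?_
      simp only [if_pos (e s').2, if_true]
      constructor
      · intro h1 Z hBZ hcl
        -- Leastness of the computed set is applied to the image of `Z` under the numbering of
        -- states; the other inclusion applies the definition of `reachSet` to the computed set.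
        suffices h : (e s' : ℕ) ∈ {y | ∃ z ∈ Z, (e z : ℕ) = y} by
          obtain ⟨z, hz, hz'⟩ := h
          rwa [← e.injective (Fin.ext hz')]
        refine hb4 {y | ∃ z ∈ Z, (e z : ℕ) = y} (fun y hy h => ?_)
          (fun j hj h1 h2 hz => ?_) (e s') (e s').2 h1
        · obtain ⟨z, rfl⟩ := exists_index e hy
          simp only [(e z).2, if_true] at h
          exact ⟨z, hBZ ((hB.eq_one z).1 h), rfl⟩
        · obtain ⟨z, hz, hz'⟩ := hz
          obtain ⟨z', a, ha, hz2, hd⟩ := hr.exists_mov _ (g.act_lt j hj)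
          refine ⟨z', hcl z' ((hA.eq_one z').1 (hz2 ▸ h2)) ⟨a, ha, ?_, z, ?_, hz⟩, hz2.symm⟩
          · simpa using (hokiff (g.act_lt j hj) hd).1 h1
          · exact (hd z).2 ⟨j, hj, rfl, hz'.symm⟩
      · intro h1
        refine h1 {z | s4.arr 10 (e z) = 1} (fun z hz => hb2 _ (e z).2 ?_) ?_
        · simpa using (hB.eq_one z).2 hz
        · rintro z hz ⟨a, ha, h2, t, ht, ht'⟩
          obtain ⟨x, hx, hx', hd⟩ := hr.exists_act z a ha
          obtain ⟨j, hj, rfl, hj'⟩ := (hd t).1 ht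
          have := hb3 j hj ((hokiff hx hd).2 (by simpa using h2)) (hx' ▸ (hA.eq_one z).2 hz)
            (hj' ▸ ht')
          rwa [hx'] at this
  · simp [Exp.eval, h17] at hc
    subst hc
    refine wp_scatter (fun x => ok x = 1 ∧ s.arr 7 (g.src x) = 1) g.src 1
      (by decide) (by decide) (fun j hj f => ?_) fun t4 ht4 => ?_
    · have hj' : j < g.NA := by simpa [hg.NA] using hj
      have h1 := hok1 j hj'
      have h2 := hA.le_one (hgn ▸ g.src_lt j hj')
      simp [Exp.Ok, Exp.eval, Store.upd, hg.src j hj']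
      omega
    simp [Store.upd, hg.NA, Exp.cost, Exp.addrCost] at ht4 ⊢
    refine wp_seq (wp_map (fun x => if ∃ j < g.NA, (ok j = 1 ∧ s.arr 7 (g.src j) = 1) ∧ g.src j = x
      then 1 else if x < n then s.arr 8 x else s.arr 10 x) (by decide) (by decide)
      (fun j _ f _ => by simp [Exp.Ok, Exp.eval, Store.upd]) fun t5 ht5 => wp_skip ?_)
    simp [Exp.cost, Exp.addrCost, hg.n, hgn] at ht5
    refine ⟨by omega, ?_⟩
    simp only [Store.upd, Function.update_self, MDP.round]
    refine Vec.of_iff (fun j hj => ?_) fun s' => ?_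
    · simp [hj, hg.n, hgn]
      have := hB.le_one hj
      split <;> omega
    · simp only [Function.update_of_ne (show (0 : ℕ) ≠ 10 by decide), hg.n, hgn, (e s').2, if_true,
        Bool.false_eq_true, if_false, MDP.stepSet, Set.mem_union, Set.mem_inter_iff]
      constructor
      · intro h
        split_ifs at h with h'
        · obtain ⟨j, hj, ⟨h1, h2⟩, h3⟩ := h'
          obtain ⟨z, a, ha, hz, hd⟩ := hr.exists_mov j hj
          obtain rfl : z = s' := e.injective (Fin.ext (hz.symm.trans h3))
          exact .inr ⟨(hA.eq_one z).1 (h3 ▸ h2), a, ha, (hokiff hj hd).1 h1⟩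
        · exact .inl ((hB.eq_one s').1 h)
      · rintro (h | ⟨h, a, ha, h1⟩)
        · rw [(hB.eq_one s').2 h]; simp
        · obtain ⟨x, hx, hx', hd⟩ := hr.exists_act s' a ha
          rw [if_pos ⟨x, hx, ⟨(hokiff hx hd).2 h1, hx' ▸ (hA.eq_one s').2 h⟩, hx'⟩]

/-- The fixed point computation: as many rounds as the variable `16` says. -/
def sweep : Cmd := .loop 18 16 roundCmd

theorem wp_sweep (hK : 1 ≤ K) (hn : 0 < n) (hg : g.On s) (hr : g.Represents G e)
    (reach all : Bool) (hra : reach = true → all = true) {A B Y : Set S} (hA : Vec e A (s.arr 7))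
    (hB : Vec e B (s.arr 8)) (hY : Vec e Y (s.arr 9)) (h14 : s.reg 14 = if all then 1 else 0)
    (h17 : s.reg 17 = if reach then 1 else 0)
    (hQ : ∀ t s', t ≤ 320 * ((n + g.NA + g.E) * s.reg 16) + 6 → Frame sweep s s' →
      Vec e ((G.round reach all A B)^[s.reg 16] Y) (s'.arr 9) → Q t s') :
    wp W K sweep s Q := by
  refine wp_loop (fun j s' => Vec e ((G.round reach all A B)^[j] Y) (s'.arr 9))
    (300 * (n + g.NA + g.E)) rfl rfl (by decide) hY ?_ ?_
  · intro j s' hj h18 hf hI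
    refine wp_roundCmd hK hn (hg.of_eq (fun r hr => hf.1 r ?_) (fun k hk h1 => hf.2 k ?_)) hr reach
      all hra (hf.2 7 rfl ▸ hA) (hf.2 8 rfl ▸ hB) hI (by rw [hf.1 14 rfl, h14])
      (by rw [hf.1 17 rfl, h17]) fun t s'' ht hf' h => ⟨ht, ?_⟩
    · interval_cases r <;> rfl
    · revert k; decide
    · rw [Function.iterate_succ_apply']; exact h
  · intro t s' ht h18 hf hI
    refine hQ t s' (ht.trans ?_) hf hI
    rw [← mul_assoc]
    gcongr ?_ * _ + _
    omega

end RAM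

-- The temporal operators on the machine

namespace RAM

open Exp Cmd

variable {S : Type u} {Act : Type v} {AP : Type w} {n : ℕ}

variable {W K : ℕ} {g : Graph} {s : Store} {Q : ℕ → Store → Prop} {G : MDP S Act AP}
  {e : S ≃ Fin n}

theorem Graph.On.of_frame {s' : Store} {c : Cmd} (hg : g.On s) (hf : Frame c s s')
    (h1 : ∀ r < 3, c.wr r = false) (h2 : ∀ k : Fin 16, k ≠ 0 → k < 6 → c.wa k = false) : g.On s' :=
  hg.of_eq (fun r hr => hf.1 r (h1 r hr)) (fun k hk h => hf.2 k (h2 k hk h))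

/-- The computation for `○`. -/
def nextCmd : Cmd :=
  block [.map 10 0 9 (arr 7 (var 10)), .map 10 0 7 (lit 1), .map 10 0 8 (lit 0),
    .assign 14 (sub (lit 1) (sub (var 12) (lit 1))), .assign 17 (lit 0), .assign 16 (lit 1), sweep]

/-- The computation for `U`. -/
def untilCmd : Cmd :=
  block [.assign 17 (sub (sub (lit 1) (sub (var 12) (lit 1))) (sub (lit 1) (var 12))),
    .map 10 0 9 (var 17), .assign 14 (sub (lit 1) (sub (var 12) (lit 1))), .assign 16 (var 0),
    sweep]

/-- The preparation of the first fixed point for `W`. -/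
def waitInit : Cmd :=
  block [.map 10 0 8 (sub (arr 7 (var 10)) (sub (lit 1) (arr 8 (var 10)))), .map 10 0 9 (lit 1),
    .assign 14 (sub (lit 1) (sub (var 12) (lit 2))), .assign 17 (lit 0), .assign 16 (var 0)]

/-- The computation for `W`. -/
def waitCmd : Cmd :=
  block [waitInit, sweep,
    .ite (sub (var 12) (lit 1)) (.ite (sub (var 12) (lit 2)) .skip
      (block [.map 10 0 8 (arr 9 (var 10)), .map 10 0 9 (lit 0), .assign 14 (lit 0), sweep])) .skip]

/-- This identity and the next two test the code of a superscript by truncated subtraction: at most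
1, equal to 1, at most 2. -/
theorem strong_code (m : QMode) : 1 - (m.code - 1) = if m.strong then 1 else 0 := by cases m <;> rfl

theorem isAlmost_code (m : QMode) :
    1 - (m.code - 1) - (1 - m.code) = if m.isAlmost then 1 else 0 := by cases m <;> rfl

theorem isNonnull_code (m : QMode) : 1 - (m.code - 2) = if m.isNonnull then 1 else 0 := by
  cases m <;> rfl

/-- A single round with `A` in the place of `Y`, all states in the place of `A`, and `∅` in the
place of `B` yields the predecessor set. -/
theorem wp_nextCmd (hK : 1 ≤ K) (hn : 0 < n) (hg : g.On s) (hr : g.Represents G e) (m : QMode)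
    {A : Set S} (hA : Vec e A (s.arr 7)) (h12 : s.reg 12 = m.code)
    (hQ : ∀ t s', t ≤ 500 * (n + g.NA + g.E) → Frame nextCmd s s' →
      Vec e (G.exNext m A) (s'.arr 9) → Q t s') :
    wp W K nextCmd s Q := by
  classical
  suffices h : wp W K nextCmd s fun t s' => t ≤ 500 * (n + g.NA + g.E) ∧
      Vec e (G.exNext m A) (s'.arr 9) from
    h.imp fun t s' hf ⟨h1, h2⟩ => hQ t s' h1 hf h2
  have hgn : s.reg 0 = n := hg.n.trans hr.n_eq
  refine wp_seq (wp_map (s.arr 7) (by decide) (by decide)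
    (fun j _ f _ => by simp [Exp.Ok, Exp.eval, Store.upd]) fun t1 ht1 => ?_)
  refine wp_seq (wp_map (fun _ => 1) (by decide) (by decide)
    (fun j _ f _ => by simp [Exp.Ok, Exp.eval]) fun t2 ht2 => ?_)
  refine wp_seq (wp_map (fun _ => 0) (by decide) (by decide)
    (fun j _ f _ => by simp [Exp.Ok, Exp.eval]) fun t3 ht3 => ?_)
  simp [Store.upd, Exp.cost, Exp.addrCost, hgn] at ht1 ht2 ht3
  refine wp_seq (wp_assign (by simp [Exp.Ok]) (wp_seq (wp_assign trivial (wp_seq (wp_assign trivial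
    (wp_seq ?_))))))
  simp [Store.upd, Store.set, Exp.eval, hgn, h12, strong_code]
  refine wp_sweep (g := g) (G := G) (e := e) hK hn ?_ hr false m.strong (by simp)
    (A := Set.univ) (B := ∅) (Y := A) (fun s' => ?_) (fun s' => ?_) (fun s' => ?_) ?_ ?_ ?_
  · refine hg.of_eq (fun r hr => ?_) (fun k hk hk6 => ?_)
    · interval_cases r <;> simp [hgn]
    · fin_cases k <;> simp_all
  · simp
  · simp
  · simpa using hA s'
  · simp
  · simp
  · intro t s' ht hf h
    simp at ht h
    refine wp_skip ⟨by simp [Exp.cost]; omega, ?_⟩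
    simpa [MDP.round, MDP.stepSet, MDP.exNext] using h

/-- The bit for `almost` has two uses: it selects the backward search, and it fills the initial
vector, as only this case is a greatest fixed point. -/
theorem wp_untilCmd (hK : 1 ≤ K) (hn : 0 < n) (hg : g.On s) (hr : g.Represents G e) (m : QMode)
    {A B : Set S} (hA : Vec e A (s.arr 7)) (hB : Vec e B (s.arr 8)) (h12 : s.reg 12 = m.code)
    (hQ : ∀ t s', t ≤ 500 * ((n + g.NA + g.E) * n) → Frame untilCmd s s' →
      Vec e (G.exUntil n m A B) (s'.arr 9) → Q t s') :
    wp W K untilCmd s Q := by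
  classical
  suffices h : wp W K untilCmd s fun t s' => t ≤ 500 * ((n + g.NA + g.E) * n) ∧
      Vec e (G.exUntil n m A B) (s'.arr 9) from
    h.imp fun t s' hf ⟨h1, h2⟩ => hQ t s' h1 hf h2
  have hgn : s.reg 0 = n := hg.n.trans hr.n_eq
  have hDn : n ≤ (n + g.NA + g.E) * n := Nat.le_mul_of_pos_left _ (by omega)
  refine wp_seq (wp_assign (by simp [Exp.Ok]) ?_)
  refine wp_seq (wp_map (fun _ => if m.isAlmost then 1 else 0) (by decide) (by decide)
    (fun j _ f _ => by simp [Exp.Ok, Exp.eval, Store.upd, Store.set, h12, isAlmost_code])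
    fun t1 ht1 => ?_)
  simp [Exp.cost, hgn, Store.set] at ht1
  refine wp_seq (wp_assign (by simp [Exp.Ok]) (wp_seq (wp_assign trivial (wp_seq ?_))))
  simp [Store.upd, Store.set, Exp.eval, hgn, h12]
  refine wp_sweep (g := g) (G := G) (e := e) hK hn ?_ hr m.isAlmost m.strong (by cases m <;> simp
    [QMode.isAlmost, QMode.strong]) (A := A) (B := B) (Y := if m.isAlmost then Set.univ else ∅)
    (by simpa using hA) (by simpa using hB) (fun s' => ?_) ?_ ?_ ?_
  · refine hg.of_eq (fun r hr => ?_) (fun k hk hk6 => ?_)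
    · interval_cases r <;> simp [hgn]
    · fin_cases k <;> simp_all
  · cases m.isAlmost <;> simp
  · simpa using strong_code m
  · simpa using isAlmost_code m
  · intro t s' ht hf h
    simp at ht h
    refine wp_skip ⟨by simp [Exp.cost]; omega, ?_⟩
    simpa [MDP.exUntil] using h

theorem wp_waitInit (hg : g.On s) (hn : g.n = n) (m : QMode) {A B : Set S} (hA : Vec e A (s.arr 7))
    (hB : Vec e B (s.arr 8)) (h12 : s.reg 12 = m.code)
    (hQ : ∀ t s', t ≤ 58 * n + 30 → Frame waitInit s s' → Vec e (A ∩ B) (s'.arr 8) →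
      Vec e Set.univ (s'.arr 9) → (s'.reg 14 = if m.isNonnull then 1 else 0) → s'.reg 17 = 0 →
      s'.reg 16 = n → Q t s') :
    wp W K waitInit s Q := by
  classical
  suffices h : wp W K waitInit s fun t s' => t ≤ 58 * n + 30 ∧ Vec e (A ∩ B) (s'.arr 8) ∧
      Vec e Set.univ (s'.arr 9) ∧ (s'.reg 14 = if m.isNonnull then 1 else 0) ∧ s'.reg 17 = 0 ∧
      s'.reg 16 = n from
    h.imp fun t s' hf ⟨h1, h2, h3, h4, h5, h6⟩ => hQ t s' h1 hf h2 h3 h4 h5 h6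
  have hgn : s.reg 0 = n := hg.n.trans hn
  refine wp_seq (wp_map (fun j => s.arr 7 j - (1 - s.arr 8 j)) (by decide) (by decide)
    (fun j _ f hf => by simp [Exp.Ok, Exp.eval, Store.upd, hf]) fun t1 ht1 => ?_)
  refine wp_seq (wp_map (fun _ => 1) (by decide) (by decide)
    (fun j _ f _ => by simp [Exp.Ok, Exp.eval]) fun t2 ht2 => ?_)
  simp [Store.upd, Exp.cost, Exp.addrCost, hgn] at ht1 ht2
  refine wp_seq (wp_assign (by simp [Exp.Ok]) (wp_seq (wp_assign trivial (wp_seq (wp_assign trivial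
    (wp_skip ⟨by simp [Exp.cost]; omega, fun s' => ?_, fun s' => ?_, ?_, ?_, ?_⟩))))))
  · simp [Store.upd, Store.set, hgn, hA s', hB s']
    by_cases h1 : s' ∈ A <;> by_cases h2 : s' ∈ B <;> simp [h1, h2]
  · simp [Store.upd, Store.set, hgn]
  · simpa [Store.upd, Store.set, Exp.eval, h12] using isNonnull_code m
  · simp [Store.upd, Store.set, Exp.eval]
  · simp [Store.upd, Store.set, Exp.eval, hgn]

theorem lt_three_cases {P : ℕ → Prop} (h0 : P 0) (h1 : P 1) (h2 : P 2) : ∀ r < 3, P r := by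
  intro r hr; interval_cases r <;> assumption

/-- Every superscript starts with a greatest fixed point, in which `null` alone uses existential
predecessors. For `pos`, the result becomes the target of a second, least fixed point. -/
theorem wp_waitCmd (hK : 1 ≤ K) (hn : 0 < n) (hg : g.On s) (hr : g.Represents G e) (m : QMode)
    {A B : Set S} (hA : Vec e A (s.arr 7)) (hB : Vec e B (s.arr 8)) (h12 : s.reg 12 = m.code)
    (hQ : ∀ t s', t ≤ 1000 * ((n + g.NA + g.E) * n) → Frame waitCmd s s' →
      Vec e (G.exWait n m A B) (s'.arr 9) → Q t s') :
    wp W K waitCmd s Q := by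
  classical
  suffices h : wp W K waitCmd s fun t s' => t ≤ 1000 * ((n + g.NA + g.E) * n) ∧
      Vec e (G.exWait n m A B) (s'.arr 9) from
    h.imp fun t s' hf ⟨h1, h2⟩ => hQ t s' h1 hf h2
  have hDn : n ≤ (n + g.NA + g.E) * n := Nat.le_mul_of_pos_left _ (by omega)
  refine wp_seq (wp_waitInit hg hr.n_eq m hA hB h12 fun t1 s1 ht1 hf1 hB1 hY1 h14 h17 h16 => ?_)
  have hg1 := hg.of_frame hf1 (lt_three_cases rfl rfl rfl) (by decide)
  have hA1 : Vec e A (s1.arr 7) := hf1.2 7 rfl ▸ hA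
  refine wp_seq (wp_sweep hK hn hg1 hr false m.isNonnull (by simp) hA1 hB1 hY1 h14 h17
    fun t2 s2 ht2 hf2 h => ?_)
  rw [h16] at h ht2
  have hg2 := hg1.of_frame hf2 (lt_three_cases rfl rfl rfl) (by decide)
  have hA2 : Vec e A (s2.arr 7) := hf2.2 7 rfl ▸ hA1
  have h12' : s2.reg 12 = m.code := by rw [hf2.1 12 rfl, hf1.1 12 rfl, h12]
  have h0' : s2.reg 0 = n := hg2.n.trans hr.n_eq
  have h16' : s2.reg 16 = n := by rw [hf2.1 16 rfl, h16]
  have h17' : s2.reg 17 = 0 := by rw [hf2.1 17 rfl, h17]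
  by_cases hm : m = .pos
  · subst hm
    refine wp_seq (wp_ite (by simp [Exp.Ok]) (fun _ => ?_)
      (fun h => by simp [Exp.eval, h12', QMode.code] at h))
    refine wp_ite (by simp [Exp.Ok]) (fun h => by simp [Exp.eval, h12', QMode.code] at h)
      (fun _ => ?_)
    refine wp_seq (wp_map (s2.arr 9) (by decide) (by decide)
      (fun j _ f hf => by simp [Exp.Ok, Exp.eval, Store.upd]) fun t3 ht3 => ?_)
    refine wp_seq (wp_map (fun _ => 0) (by decide) (by decide)
      (fun j _ f _ => by simp [Exp.Ok, Exp.eval]) fun t4 ht4 => ?_)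
    simp [Store.upd, Exp.cost, Exp.addrCost, h0'] at ht3 ht4
    refine wp_seq (wp_assign (by simp [Exp.Ok]) (wp_seq ?_))
    simp [Store.upd, Store.set, Exp.eval, h0']
    refine wp_sweep (g := g) (G := G) (e := e) hK hn ?_ hr false false (by simp)
      (A := A) (Y := ∅) (by simpa using hA2) (h.congr fun j hj => ?_) (fun s' => ?_) ?_ ?_ ?_
    · refine hg2.of_eq (fun r hr => ?_) (fun k hk hk6 => ?_)
      · interval_cases r <;> simp [h0']
      · fin_cases k <;> simp_all
    · simp [hj]
    · simp
    · simp
    · simp [h17']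
    · intro t5 s5 ht5 hf5 h5
      simp [h16'] at ht5 h5
      refine wp_skip (wp_skip ⟨by simp [Exp.cost]; omega, ?_⟩)
      simpa [MDP.exWait, QMode.isNonnull] using h5
  · have hw : G.exWait n m A B = (G.round false m.isNonnull A (A ∩ B))^[n] Set.univ := by
      cases m <;> first | rfl | exact absurd rfl hm
    refine wp_seq (wp_ite (by simp [Exp.Ok]) (fun h1 => ?_) (fun _ => ?_))
    · refine wp_ite (by simp [Exp.Ok]) (fun _ => ?_) (fun h2 => ?_)
      · refine wp_skip (wp_skip ⟨by simp [Exp.cost]; omega, by rw [hw]; exact h⟩)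
      · simp [Exp.eval, h12'] at h1 h2
        cases m <;> simp_all [QMode.code]
    · refine wp_skip (wp_skip ⟨by simp [Exp.cost]; omega, by rw [hw]; exact h⟩)

end RAM

namespace RAM

open Exp Cmd

variable {S : Type u} {Act : Type v} {AP : Type w} {n : ℕ}

variable {W K : ℕ} {g : Graph} {s : Store} {Q : ℕ → Store → Prop} {G : MDP S Act AP}
  {e : S ≃ Fin n}

/-! ### A stack of sets -/

/-- The array holds a stack of characteristic vectors. -/
def StackVec (e : S ≃ Fin n) : List (Set S) → (ℕ → ℕ) → Prop
  | [], _ => True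
  | X :: L, f => Vec e X (fun j => f (n * L.length + j)) ∧ StackVec e L f

theorem StackVec.congr {L : List (Set S)} {f f' : ℕ → ℕ} (h : StackVec e L f)
    (hf : ∀ j < n * L.length, f' j = f j) : StackVec e L f' := by
  induction L with
  | nil => trivial
  | cons X L ih =>
    simp only [List.length_cons, Nat.mul_succ] at hf
    exact ⟨h.1.congr fun j hj => hf _ (by omega), ih h.2 fun j hj => hf _ (by omega)⟩

/-- The stack pointer and the stack. -/
def Stack (e : S ≃ Fin n) (L : List (Set S)) (s : Store) : Prop :=
  s.reg 6 = n * L.length ∧ StackVec e L (s.arr 12)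

theorem Stack.of_eq {L : List (Set S)} {s' : Store} (h : Stack e L s) (h6 : s'.reg 6 = s.reg 6)
    (h12 : s'.arr 12 = s.arr 12) : Stack e L s' := ⟨h6.trans h.1, h12 ▸ h.2⟩

/-- Takes a set from the stack. -/
def pop (k : Fin 16) : Cmd :=
  block [.assign 6 (sub (var 6) (var 0)), .map 10 0 k (arr 12 (add (var 6) (var 10)))]

/-- Puts a set on the stack. -/
def pushSet (k : Fin 16) : Cmd :=
  block [.loop 10 0 (.store 12 (add (var 6) (var 10)) (arr k (var 10))),
    .assign 6 (add (var 6) (var 0))]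

theorem wp_pop (hn : s.reg 0 = n) (hK : n ≤ K) {k : Fin 16} (hk : k ≠ 0) (hk' : k ≠ 12)
    {X : Set S} {L : List (Set S)} (hL : Stack e (X :: L) s)
    (hQ : ∀ t s', t ≤ 29 * n + 10 → Frame (pop k) s s' → Vec e X (s'.arr k) → Stack e L s' →
      Q t s') :
    wp W K (pop k) s Q := by
  suffices h : wp W K (pop k) s fun t s' => t ≤ 29 * n + 10 ∧ Vec e X (s'.arr k) ∧ Stack e L s' from
    h.imp fun t s' hf ⟨h1, h2, h3⟩ => hQ t s' h1 hf h2 h3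
  have h6 : s.reg 6 - n = n * L.length := by
    rw [hL.1, List.length_cons, Nat.mul_succ, Nat.add_sub_cancel]
  refine wp_seq (wp_assign (by simp [Exp.Ok]) (wp_seq (wp_map
    (fun j => s.arr 12 (n * L.length + j)) hk (by decide) (fun j hj f hf => ?_)
    fun t ht => wp_skip ⟨?_, fun s' => ?_, ?_, ?_⟩)))
  · simp [Store.set, Exp.eval, hn] at hj
    simp [Exp.Ok, Exp.eval, Store.upd, Store.set, hn, h6, Function.update_of_ne hk'.symm]
    omega
  · simp [Store.set, hn, Exp.cost, Exp.addrCost] at ht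
    simp [Exp.cost]; omega
  · simpa [Store.upd, Store.set, hn] using hL.2.1 s'
  · simpa [Store.upd, Store.set, Exp.eval, hn] using h6
  · simpa [Store.upd, Store.set, Function.update_of_ne hk'.symm] using hL.2.2

theorem wp_pushSet (hn : s.reg 0 = n) (hK : n ≤ K) {k : Fin 16} (hk : k ≠ 0) (hk' : k ≠ 12)
    {X : Set S} {L : List (Set S)} (hL : Stack e L s) (hX : Vec e X (s.arr k))
    (hQ : ∀ t s', t ≤ 29 * n + 10 → Frame (pushSet k) s s' → Stack e (X :: L) s' → Q t s') :
    wp W K (pushSet k) s Q := by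
  suffices h : wp W K (pushSet k) s fun t s' => t ≤ 29 * n + 10 ∧ Stack e (X :: L) s' from
    h.imp fun t s' hf ⟨h1, h2⟩ => hQ t s' h1 hf h2
  refine wp_seq (wp_loop (fun j s' => s'.reg 6 = n * L.length ∧ StackVec e L (s'.arr 12) ∧
    (∀ i < j, s'.arr 12 (n * L.length + i) = s.arr k i) ∧ s'.arr k = s.arr k) 20 rfl rfl (by decide)
    ⟨by simpa [Store.set] using hL.1, hL.2, by simp, rfl⟩ ?_ ?_)
  · rintro j s' hj h10 - ⟨h6, h1, h2, h3⟩
    refine wp_store ?_ ?_ (by simp) ⟨?_, ?_⟩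
    · simp [Exp.Ok, Exp.eval, h10]; omega
    · simp [Exp.Ok, hk]
    · simp [Exp.cost, Exp.addrCost]; split <;> simp
    · simp [Store.set, Store.put, Exp.eval, h10, h6, h3, Function.update_of_ne hk']
      refine ⟨h1.congr fun i hi => Function.update_of_ne (by omega) _ _, fun i hi => ?_⟩
      rcases hi.lt_or_eq with hi | rfl
      · rw [Function.update_of_ne (by omega), h2 i hi]
      · simp
  · rintro t s' ht h10 hf ⟨h6, h1, h2, h3⟩
    have h0 : s'.reg 0 = n := (hf.1 0 rfl).trans hn
    rw [hn] at ht h2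
    refine wp_seq (wp_assign ⟨trivial, trivial, by simpa [Exp.eval, h0] using hK⟩ (wp_skip
      ⟨by simp [Exp.cost]; omega, ?_, ?_⟩))
    · simp [Store.set, Exp.eval, h0, h6, Nat.mul_succ]
    · exact ⟨fun s'' => by rw [← hX s'']; exact h2 _ (e s'').2, h1⟩

/-! ### Quantifiers -/

/-- An existential quantifier. -/
def existsCmd : Cmd := .ite (var 13) (.ite (sub (var 13) (lit 1)) waitCmd untilCmd) nextCmd

theorem wp_existsCmd (hK : 1 ≤ K) (hn : 0 < n) (hg : g.On s) (hr : g.Represents G e) (m : QMode)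
    {A B : Set S} {op : ℕ} (hA : Vec e A (s.arr 7)) (hB : op ≠ 0 → Vec e B (s.arr 8))
    (h12 : s.reg 12 = m.code) (h13 : s.reg 13 = op)
    (hQ : ∀ t s', t ≤ 1010 * ((n + g.NA + g.E) * n) → Frame existsCmd s s' →
      Vec e (G.exOp n op m A B) (s'.arr 9) → Q t s') :
    wp W K existsCmd s Q := by
  suffices h : wp W K existsCmd s fun t s' => t ≤ 1010 * ((n + g.NA + g.E) * n) ∧
      Vec e (G.exOp n op m A B) (s'.arr 9) from
    h.imp fun t s' hf ⟨h1, h2⟩ => hQ t s' h1 hf h2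
  have hDn : n + g.NA + g.E ≤ (n + g.NA + g.E) * n := Nat.le_mul_of_pos_right _ (by omega)
  refine wp_ite trivial (fun h0 => ?_) (fun h0 => ?_)
  · simp [Exp.eval, h13] at h0
    refine wp_ite (by simp [Exp.Ok]) (fun h1 => ?_) (fun h1 => ?_)
    · simp [Exp.eval, h13] at h1
      refine wp_waitCmd hK hn hg hr m hA (hB h0) h12 fun t s' ht _ h =>
        ⟨by simp [Exp.cost]; omega, ?_⟩
      rwa [MDP.exOp, if_neg h0, if_neg (by omega)]
    · simp [Exp.eval, h13] at h1
      refine wp_untilCmd hK hn hg hr m hA (hB h0) h12 fun t s' ht _ h =>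
        ⟨by simp [Exp.cost]; omega, ?_⟩
      rwa [MDP.exOp, if_neg h0, if_pos (by omega)]
  · simp [Exp.eval, h13] at h0
    refine wp_nextCmd hK hn hg hr m hA h12 fun t s' ht _ h => ⟨by simp [Exp.cost]; omega, ?_⟩
    rwa [MDP.exOp, if_pos h0]

/-- The negation of a temporal operator. -/
def negCmd : Cmd :=
  .ite (var 13)
    (block [.map 10 0 10 (sub (lit 1) (arr 7 (var 10))), .map 10 0 7 (sub (lit 1) (arr 8 (var 10))),
      .map 10 0 8 (arr 10 (var 10)), .assign 13 (sub (lit 3) (var 13))])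
    (.map 10 0 7 (sub (lit 1) (arr 7 (var 10))))

theorem Vec.compl {X : Set S} {f f' : ℕ → ℕ} (h : Vec e X f) (hf : ∀ j < n, f' j = 1 - f j) :
    Vec e Xᶜ f' := fun s => by
  rw [hf _ (e s).2, h s]
  by_cases h : s ∈ X <;> simp [h]

/-- The complement of `A U B` is `Bᶜ W Aᶜ` and vice versa, so the operands are complemented and
exchanged, with array `10` as scratch space. -/
theorem wp_negCmd (hn : s.reg 0 = n) {A B : Set S} {op : ℕ} (hA : Vec e A (s.arr 7))
    (hB : op ≠ 0 → Vec e B (s.arr 8)) (h13 : s.reg 13 = op)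
    (hQ : ∀ t s', t ≤ 90 * n + 30 → Frame negCmd s s' →
      Vec e (if op = 0 then Aᶜ else Bᶜ) (s'.arr 7) → (op ≠ 0 → Vec e Aᶜ (s'.arr 8)) →
      s'.reg 13 = (if op = 0 then 0 else 3 - op) → Q t s') :
    wp W K negCmd s Q := by
  suffices h : wp W K negCmd s fun t s' => t ≤ 90 * n + 30 ∧
      Vec e (if op = 0 then Aᶜ else Bᶜ) (s'.arr 7) ∧ (op ≠ 0 → Vec e Aᶜ (s'.arr 8)) ∧
      s'.reg 13 = (if op = 0 then 0 else 3 - op) from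
    h.imp fun t s' hf ⟨h1, h2, h3, h4⟩ => hQ t s' h1 hf h2 h3 h4
  refine wp_ite trivial (fun h0 => ?_) (fun h0 => ?_)
  · simp [Exp.eval, h13] at h0
    refine wp_seq (wp_map (fun j => 1 - s.arr 7 j) (by decide) (by decide)
      (fun j _ f hf => by simp [Exp.Ok, Exp.eval, Store.upd]) fun t1 ht1 => ?_)
    refine wp_seq (wp_map (fun j => 1 - s.arr 8 j) (by decide) (by decide)
      (fun j _ f hf => by simp [Exp.Ok, Exp.eval, Store.upd]) fun t2 ht2 => ?_)
    refine wp_seq (wp_map (fun j => 1 - s.arr 7 j) (by decide) (by decide)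
      (fun j hj f hf => ?_) fun t3 ht3 => ?_)
    · simp [Store.upd] at hj
      simp [Exp.Ok, Exp.eval, Store.upd, hj]
    simp [Store.upd, Exp.cost, Exp.addrCost, hn] at ht1 ht2 ht3
    refine wp_seq (wp_assign (by simp [Exp.Ok]) (wp_skip ⟨by simp [Exp.cost]; omega, ?_, ?_, ?_⟩))
    · rw [if_neg h0]
      exact (hB h0).compl fun j hj => by simp [Store.upd, Store.set, hn, hj]
    · exact fun _ => hA.compl fun j hj => by simp [Store.upd, Store.set, hn, hj]
    · simp [Store.upd, Store.set, Exp.eval, h13, h0]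
  · simp [Exp.eval, h13] at h0
    subst h0
    refine wp_map (fun j => 1 - s.arr 7 j) (by decide) (by decide)
      (fun j _ f hf => by simp [Exp.Ok, Exp.eval, Store.upd, hf]) fun t1 ht1 => ?_
    simp [Exp.cost, Exp.addrCost, hn] at ht1
    refine ⟨by simp [Exp.cost]; omega, ?_, by simp, ?_⟩
    · rw [if_pos rfl]
      exact hA.compl fun j hj => by simp [Store.upd, hn, hj]
    · simp [Store.upd, h13]

/-- Decodes a quantifier. -/
def decodeCmd : Cmd :=
  block [.ite (sub (var 8) (lit 9))
      (block [.assign 11 (lit 1), .assign 12 (sub (lit 13) (var 8))])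
      (block [.assign 11 (lit 0), .assign 12 (sub (var 8) (lit 6))]),
    .assign 13 (sub (var 9) (lit 3))]

theorem code_le (m : QMode) : m.code ≤ 3 := by cases m <;> simp [QMode.code]

theorem dual_code (m : QMode) : m.dual.code = 3 - m.code := by cases m <;> rfl

/-- The codes are arranged so that dual superscripts add up to 3; hence 13 minus the symbol of a
universal quantifier is the code of the dual. -/
theorem wp_decodeCmd (m : QMode) (all : Bool) {op : ℕ}
    (h8 : s.reg 8 = (if all then 10 else 6) + m.code) (h9 : s.reg 9 = 3 + op)
    (hQ : ∀ t s', t ≤ 30 → Frame decodeCmd s s' → (s'.reg 11 = if all then 1 else 0) →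
      s'.reg 12 = (if all then m.dual else m).code → s'.reg 13 = op → Q t s') :
    wp W K decodeCmd s Q := by
  suffices h : wp W K decodeCmd s fun t s' => t ≤ 30 ∧ (s'.reg 11 = if all then 1 else 0) ∧
      s'.reg 12 = (if all then m.dual else m).code ∧ s'.reg 13 = op from
    h.imp fun t s' hf ⟨h1, h2, h3, h4⟩ => hQ t s' h1 hf h2 h3 h4
  have hm := code_le m
  refine wp_seq (wp_ite (by simp [Exp.Ok]) (fun h0 => ?_) (fun h0 => ?_))
  all_goals
    simp only [Exp.eval, h8] at h0
    refine wp_seq (wp_assign trivial (wp_seq (wp_assign (by simp [Exp.Ok]) (wp_skip (wp_seq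
      (wp_assign (by simp [Exp.Ok]) (wp_skip ⟨by simp [Exp.cost], ?_, ?_, ?_⟩)))))))
  · cases all
    · simp at h0; omega
    · simp [Store.set, Exp.eval]
  · cases all
    · simp at h0; omega
    · simp [Store.set, Exp.eval, h8, dual_code]; omega
  · simp [Store.set, Exp.eval, h9]
  · cases all
    · simp [Store.set, Exp.eval]
    · simp at h0; omega
  · cases all
    · simp [Store.set, Exp.eval, h8]
    · simp at h0; omega
  · simp [Store.set, Exp.eval, h9]

/-- A quantifier. -/
def quantCmd : Cmd :=
  block [decodeCmd, pop 7, .ite (var 13) (pop 8) .skip, .ite (var 11) negCmd .skip, existsCmd,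
    .ite (var 11) (.map 10 0 9 (sub (lit 1) (arr 9 (var 10)))) .skip, pushSet 9]

/-- A universal quantifier is evaluated by negating the operator, running the existential
computation with the dual superscript, and complementing the result. -/
theorem wp_quantCmd (hK : n ≤ K) (hn : 0 < n) (hg : g.On s) (hr : g.Represents G e) (m : QMode)
    (all : Bool) {A B : Set S} {L : List (Set S)} {op : ℕ} (hop : op ≤ 2)
    (h8 : s.reg 8 = (if all then 10 else 6) + m.code) (h9 : s.reg 9 = 3 + op)
    (hL : Stack e (A :: if op = 0 then L else B :: L) s)
    (hQ : ∀ t s', t ≤ 1500 * ((n + g.NA + g.E) * n) → Frame quantCmd s s' →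
      Stack e ((if all then G.allOp n op m A B else G.exOp n op m A B) :: L) s' → Q t s') :
    wp W K quantCmd s Q := by
  suffices h : wp W K quantCmd s fun t s' => t ≤ 1500 * ((n + g.NA + g.E) * n) ∧
      Stack e ((if all then G.allOp n op m A B else G.exOp n op m A B) :: L) s' from
    h.imp fun t s' hf ⟨h1, h2⟩ => hQ t s' h1 hf h2
  have hDn : n ≤ (n + g.NA + g.E) * n := Nat.le_mul_of_pos_left _ (by omega)
  have h3 := @lt_three_cases
  refine wp_seq (wp_decodeCmd m all h8 h9 fun t1 s1 ht1 hf1 h11 h12 h13 => ?_)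
  have hg1 := hg.of_frame hf1 (h3 rfl rfl rfl) (by decide)
  refine wp_seq (wp_pop (hg1.n.trans hr.n_eq) hK (by decide) (by decide)
    (hL.of_eq (hf1.1 6 rfl) (hf1.2 12 rfl)) fun t2 s2 ht2 hf2 hA2 hL2 => ?_)
  have hg2 := hg1.of_frame hf2 (h3 rfl rfl rfl) (by decide)
  have e13 : s2.reg 13 = op := (hf2.1 13 rfl).trans h13
  refine wp_seq (wp.imp (Q := fun t s3 => t ≤ 29 * n + 20 ∧ Vec e A (s3.arr 7) ∧
    (op ≠ 0 → Vec e B (s3.arr 8)) ∧ Stack e L s3) ?_ ?_)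
  · refine wp_ite trivial (fun h0 => ?_) (fun h0 => ?_)
    · simp only [Exp.eval, e13] at h0
      rw [if_neg h0] at hL2
      exact wp_pop (hg2.n.trans hr.n_eq) hK (by decide) (by decide) hL2 fun t s' ht hf hB hL' =>
        ⟨by simp [Exp.cost]; omega, hf.2 7 rfl ▸ hA2, fun _ => hB, hL'⟩
    · simp only [Exp.eval, e13] at h0
      rw [if_pos h0] at hL2
      exact wp_skip ⟨by simp [Exp.cost], hA2, fun h => absurd h0 h, hL2⟩
  rintro t3 s3 hf3 ⟨ht3, hA3, hB3, hL3⟩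
  have hg3 := hg2.of_frame hf3 (h3 rfl rfl rfl) (by decide)
  have e13 : s3.reg 13 = op := (hf3.1 13 rfl).trans e13
  have e11 : s3.reg 11 = if all then 1 else 0 := (hf3.1 11 rfl).trans ((hf2.1 11 rfl).trans h11)
  have e12 : s3.reg 12 = (if all then m.dual else m).code :=
    (hf3.1 12 rfl).trans ((hf2.1 12 rfl).trans h12)
  cases all
  · simp only [Bool.false_eq_true, if_false] at e11 e12 ⊢
    refine wp_seq (wp_ite trivial (fun h => absurd e11 h) (fun _ => wp_skip ?_))
    refine wp_seq (wp_existsCmd (hn.trans_le hK) hn hg3 hr m hA3 hB3 e12 e13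
      fun t4 s4 ht4 hf4 h4 => ?_)
    have hg4 := hg3.of_frame hf4 (h3 rfl rfl rfl) (by decide)
    refine wp_seq (wp_ite trivial (fun h => absurd ((hf4.1 11 rfl).trans e11) h)
      (fun _ => wp_skip ?_))
    refine wp_seq (wp_pushSet (hg4.n.trans hr.n_eq) hK (by decide) (by decide)
      (hL3.of_eq (hf4.1 6 rfl) (hf4.2 12 rfl)) h4 fun t5 s5 ht5 _ hL5 => wp_skip ⟨?_, hL5⟩)
    simp only [Exp.cost]; omega
  · simp only [if_true] at e11 e12 ⊢
    refine wp_seq (wp_ite trivial (fun _ => ?_) (fun h => by simp [Exp.eval, e11] at h))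
    refine wp_negCmd (hg3.n.trans hr.n_eq) hA3 hB3 e13 fun t4 s4 ht4 hf4 hA4 hB4 h4 => ?_
    have hg4 := hg3.of_frame hf4 (h3 rfl rfl rfl) (by decide)
    refine wp_seq (wp_existsCmd (hn.trans_le hK) hn hg4 hr m.dual hA4
      (fun h => hB4 fun h0 => h (if_pos h0)) ((hf4.1 12 rfl).trans e12) h4
      fun t5 s5 ht5 hf5 h5 => ?_)
    have hg5 := hg4.of_frame hf5 (h3 rfl rfl rfl) (by decide)
    have h05 := hg5.n.trans hr.n_eq
    refine wp_seq (wp_ite trivial (fun _ => ?_)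
      (fun h => by simp [Exp.eval, (hf5.1 11 rfl).trans ((hf4.1 11 rfl).trans e11)] at h))
    have hL5 : Stack e L s5 := (hL3.of_eq (hf4.1 6 rfl) (hf4.2 12 rfl)).of_eq (hf5.1 6 rfl)
      (hf5.2 12 rfl)
    refine wp_map (fun j => 1 - s5.arr 9 j) (by decide) (by decide)
      (fun j _ f hf => by simp [Exp.Ok, Exp.eval, Store.upd, hf]) fun t6 ht6 => ?_
    simp [h05, Exp.cost, Exp.addrCost] at ht6
    refine wp_seq (wp_pushSet (X := G.allOp n op m A B) (by simpa [Store.upd] using h05) hK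
      (by decide) (by decide)
      (hL5.of_eq (by simp [Store.upd]) (by simp [Store.upd])) ?_
      fun t7 s7 ht7 _ hL7 => wp_skip ⟨?_, hL7⟩)
    · have h6 := h5.compl (f' := fun j => if j < n then 1 - s5.arr 9 j else s5.arr 9 j)
        (fun j hj => if_pos hj)
      simp only [Store.upd, h05, Function.update_self]
      by_cases h0 : op = 0
      · subst h0
        simpa [MDP.allOp, MDP.exOp] using h6
      · simpa [MDP.allOp, h0] using h6
    · simp only [Exp.cost]; omega

end RAM

-- The length of the word of a formula

mutual

theorem StateFormula.encode_length {AP : Type w} (props : List AP) :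
    ∀ ψ : StateFormula AP, (ψ.encode props).length = ψ.length
  | .tt => rfl
  | .atom _ => rfl
  | .neg ψ => by simp [StateFormula.encode, StateFormula.length, ψ.encode_length]
  | .disj ψ₁ ψ₂ => by
    simp [StateFormula.encode, StateFormula.length, ψ₁.encode_length, ψ₂.encode_length]
  | .ex _ φ => by simp [StateFormula.encode, StateFormula.length, φ.encode_length]
  | .all _ φ => by simp [StateFormula.encode, StateFormula.length, φ.encode_length]

theorem PathFormula.encode_length {AP : Type w} (props : List AP) :
    ∀ φ : PathFormula AP, (φ.encode props).length = φ.length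
  | .state ψ => by simp [PathFormula.encode, PathFormula.length, ψ.encode_length]
  | .next ψ => by simp [PathFormula.encode, PathFormula.length, ψ.encode_length]
  | .until ψ₁ ψ₂ => by
    simp [PathFormula.encode, PathFormula.length, ψ₁.encode_length, ψ₂.encode_length]
  | .wait ψ₁ ψ₂ => by
    simp [PathFormula.encode, PathFormula.length, ψ₁.encode_length, ψ₂.encode_length]

end

namespace RAM

open Exp Cmd

variable {S : Type u} {Act : Type v} {AP : Type w} {n : ℕ}

variable {W K : ℕ} {g : Graph} {s : Store} {Q : ℕ → Store → Prop} {G : MDP S Act AP}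
  {e : S ≃ Fin n} {props : List AP} {w : List ℕ}

/-! ### Formulas -/

open Classical in
/-- The store holds the graph, the formula and the table of labels. -/
structure Ready (W K : ℕ) (g : Graph) (G : MDP S Act AP) (e : S ≃ Fin n) (props : List AP)
    (w : List ℕ) (s : Store) : Prop where
  on : g.On s
  len : s.reg 3 = w.length
  hprops : s.reg 4 = props.length
  code : ∀ j (h : j < w.length), s.arr 0 (3 + j) = w[j]
  lt : w.length + 3 < W
  label : ∀ s' i (h : i < props.length), s.reg 5 + i + e s' * props.length < W ∧
    s.arr 0 (s.reg 5 + i + e s' * props.length) = if props[i] ∈ G.label s' then 1 else 0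
  props_le : props.length ≤ K
  n_le : n ≤ K
  n_pos : 0 < n
  rep : g.Represents G e

theorem Ready.of_frame {s' : Store} {c : Cmd} (h : Ready W K g G e props w s) (hf : Frame c s s')
    (hr : ∀ r < 6, c.wr r = false) (ha : ∀ k : Fin 16, k < 6 → c.wa k = false) :
    Ready W K g G e props w s' where
  on := h.on.of_frame hf (fun r h => hr r (by omega)) (fun k _ h => ha k h)
  len := (hf.1 3 (hr 3 (by omega))).trans h.len
  hprops := (hf.1 4 (hr 4 (by omega))).trans h.hprops
  code := by rw [hf.2 0 (ha 0 (by decide))]; exact h.code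
  lt := h.lt
  label := by rw [hf.2 0 (ha 0 (by decide)), hf.1 5 (hr 5 (by omega))]; exact h.label
  props_le := h.props_le
  n_le := h.n_le
  n_pos := h.n_pos
  rep := h.rep

theorem Ready.reg_zero (h : Ready W K g G e props w s) : s.reg 0 = n := h.on.n.trans h.rep.n_eq

theorem lt_six_cases {P : ℕ → Prop} (h0 : P 0) (h1 : P 1) (h2 : P 2) (h3 : P 3) (h4 : P 4)
    (h5 : P 5) : ∀ r < 6, P r := by
  intro r hr; interval_cases r <;> assumption

/-- The constant `true`. -/
def ttCmd : Cmd := block [.map 10 0 9 (lit 1), pushSet 9]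

/-- An atomic proposition. -/
def atomCmd : Cmd :=
  block [.assign 24 (add (var 5) (sub (var 8) (lit 14))),
    .loop 10 0 (block [.store 9 (var 10) (arr 0 (var 24)), .assign 24 (add (var 24) (var 4))]),
    pushSet 9]

/-- Negation. -/
def notCmd : Cmd := block [pop 7, .map 10 0 9 (sub (lit 1) (arr 7 (var 10))), pushSet 9]

/-- Disjunction. -/
def orCmd : Cmd :=
  block [pop 7, pop 8,
    .map 10 0 9 (sub (lit 1) (sub (sub (lit 1) (arr 7 (var 10))) (arr 8 (var 10)))), pushSet 9]

theorem wp_ttCmd (h : Ready W K g G e props w s) {L : List (Set S)} (hL : Stack e L s)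
    (hQ : ∀ t s', t ≤ 200 * n → Stack e (Set.univ :: L) s' → Q t s') :
    wp W K ttCmd s Q := by
  have h0 := h.reg_zero
  have hn := h.n_pos
  refine wp_seq (wp_map (fun _ => 1) (by decide) (by decide)
    (fun j _ f hf => by simp [Exp.Ok, Exp.eval]) fun t1 ht1 => ?_)
  simp [Exp.cost, h0] at ht1
  refine wp_seq (wp_pushSet (X := Set.univ) (e := e) (L := L) (by simpa [Store.upd] using h0) h.n_le
    (by decide) (by decide) (hL.of_eq (by simp [Store.upd]) (by simp [Store.upd]))
    (fun s' => by simp [Store.upd, h0]) fun t2 s2 ht2 _ hL2 => wp_skip (hQ _ _ (by omega) hL2))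

theorem wp_notCmd (h : Ready W K g G e props w s) {A : Set S} {L : List (Set S)}
    (hL : Stack e (A :: L) s)
    (hQ : ∀ t s', t ≤ 200 * n → Stack e (Aᶜ :: L) s' → Q t s') :
    wp W K notCmd s Q := by
  have hn := h.n_pos
  refine wp_seq (wp_pop h.reg_zero h.n_le (by decide) (by decide) hL
    fun t1 s1 ht1 hf1 hA1 hL1 => ?_)
  have h0 : s1.reg 0 = n := (hf1.1 0 rfl).trans h.reg_zero
  refine wp_seq (wp_map (fun j => 1 - s1.arr 7 j) (by decide) (by decide)
    (fun j _ f hf => by simp [Exp.Ok, Exp.eval, Store.upd]) fun t2 ht2 => ?_)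
  simp [Exp.cost, Exp.addrCost, h0] at ht2
  refine wp_seq (wp_pushSet (X := Aᶜ) (e := e) (L := L) (by simpa [Store.upd] using h0) h.n_le
    (by decide) (by decide) (hL1.of_eq (by simp [Store.upd]) (by simp [Store.upd]))
    (hA1.compl fun j hj => by simp [Store.upd, h0, hj])
    fun t3 s3 ht3 _ hL3 => wp_skip (hQ _ _ (by omega) hL3))

theorem wp_orCmd (h : Ready W K g G e props w s) {A B : Set S} {L : List (Set S)}
    (hL : Stack e (A :: B :: L) s)
    (hQ : ∀ t s', t ≤ 250 * n → Stack e ((A ∪ B) :: L) s' → Q t s') :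
    wp W K orCmd s Q := by
  have hn := h.n_pos
  refine wp_seq (wp_pop h.reg_zero h.n_le (by decide) (by decide) hL
    fun t1 s1 ht1 hf1 hA1 hL1 => ?_)
  have h0 : s1.reg 0 = n := (hf1.1 0 rfl).trans h.reg_zero
  refine wp_seq (wp_pop h0 h.n_le (by decide) (by decide) hL1
    fun t2 s2 ht2 hf2 hB2 hL2 => ?_)
  have h0 : s2.reg 0 = n := (hf2.1 0 rfl).trans h0
  have hA2 : Vec e A (s2.arr 7) := hf2.2 7 rfl ▸ hA1
  refine wp_seq (wp_map (fun j => 1 - (1 - s2.arr 7 j - s2.arr 8 j)) (by decide) (by decide)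
    (fun j _ f hf => by simp [Exp.Ok, Exp.eval, Store.upd]) fun t3 ht3 => ?_)
  simp [Exp.cost, Exp.addrCost, h0] at ht3
  refine wp_seq (wp_pushSet (X := A ∪ B) (e := e) (L := L) (by simpa [Store.upd] using h0) h.n_le
    (by decide) (by decide) (hL2.of_eq (by simp [Store.upd]) (by simp [Store.upd])) (fun s' => ?_)
    fun t3 s3 ht3 _ hL3 => wp_skip (hQ _ _ (by omega) hL3))
  simp [Store.upd, h0, hA2 s', hB2 s']
  by_cases h1 : s' ∈ A <;> by_cases h2 : s' ∈ B <;> simp [h1, h2]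

/-- The column of the proposition is read with a pointer that advances by one row of the table at a
time, which avoids a multiplication. -/
theorem wp_atomCmd (h : Ready W K g G e props w s) {L : List (Set S)} {i : ℕ} (hi : i < props.length)
    (h8 : s.reg 8 = 14 + i) (hL : Stack e L s)
    (hQ : ∀ t s', t ≤ 200 * n → Stack e ({s' | props[i] ∈ G.label s'} :: L) s' → Q t s') :
    wp W K atomCmd s Q := by
  have hn := h.n_pos
  have hp := h.props_le
  have h0 := h.reg_zero
  refine wp_seq (wp_assign ?_ (wp_seq (wp_loop (fun j s' =>
    s'.reg 24 = s.reg 5 + i + j * props.length ∧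
    ∀ x < j, s'.arr 9 x = s.arr 0 (s.reg 5 + i + x * props.length)) 40 rfl rfl (by decide)
    ⟨?_, by simp⟩ ?_ ?_)))
  · simp [Exp.Ok, Exp.eval, h8]; omega
  · simp [Store.set, Exp.eval, h8]
  · rintro j s' hj h10 hf ⟨h24, hI⟩
    have hj' : j < n := by simpa [Store.set, h0] using hj
    have hraw : s'.arr 0 = s.arr 0 := hf.2 0 rfl
    have h4 : s'.reg 4 = props.length := ((hf.1 4 rfl).trans rfl).trans h.hprops
    obtain ⟨z, rfl⟩ := exists_index e hj'
    refine wp_seq (wp_store trivial ?_ (by simp) (wp_seq (wp_assign ?_ (wp_skip ⟨?_, ?_, ?_⟩))))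
    · simpa [Exp.Ok, Exp.eval, h24] using (h.label z i hi).1
    · simpa [Exp.Ok, Exp.eval, Store.put, h4] using hp
    · simp [Exp.cost, Exp.addrCost]
    · simp [Store.set, Store.put, Exp.eval, h24, h4]; ring
    · intro x hx
      simp only [Store.set, Store.put, Exp.eval, h10, h24, hraw, Function.update_self]
      rcases Nat.lt_succ_iff_lt_or_eq.1 hx with hx | rfl
      · rw [Function.update_of_ne (by omega), hI x hx]
      · simp
  · rintro t s' ht h10 hf ⟨-, hI⟩
    simp [Store.set, h0] at ht h10 hI
    have hs : ∀ r, r ≠ 24 → r ≠ 10 → s'.reg r = s.reg r := fun r h1 h2 => by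
      rw [hf.1 r (by simp [Cmd.loop, wr, block, inc]; tauto)]
      simp [Store.set, Function.update_of_ne h1]
    have h12 : s'.arr 12 = s.arr 12 := hf.2 12 rfl
    refine wp_seq (wp_pushSet (X := {s' | props[i] ∈ G.label s'}) (e := e) (L := L)
      ((hs 0 (by decide) (by decide)).trans h0) h.n_le (by decide) (by decide)
      (hL.of_eq (hs 6 (by decide) (by decide)) h12) (fun z => ?_)
      fun t3 s3 ht3 _ hL3 => wp_skip (hQ _ _ (by simp [Exp.cost]; omega) hL3))
    rw [hI _ (e z).2, (h.label z i hi).2]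
    rfl

/-- One symbol of the formula. -/
def symbolCmd : Cmd :=
  .ite (sub (var 8) (lit 13)) atomCmd
    (.ite (sub (var 8) (lit 5)) (.ite (sub (var 9) (lit 2))
        (.ite (sub (var 9) (lit 5)) .skip quantCmd) .skip)
      (.ite (sub (var 8) (lit 2)) .skip
        (.ite (sub (var 8) (lit 1)) orCmd (.ite (var 8) notCmd ttCmd))))

/-- Reads a symbol of the formula and the next one. -/
def readCmd : Cmd :=
  block [.assign 8 (arr 0 (sub (addl (var 3) 2) (var 7))),
    .assign 9 (arr 0 (sub (addl (var 3) 3) (var 7)))]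

/-- One step of the evaluation of the formula. -/
def stepCmd : Cmd := seq (seq readCmd symbolCmd) (inc 7)

/-- Variable `7` counts the symbols read so far, from the right, so the current one has address `3 +
l.length`. The look-ahead variable `9` is meaningful only if `l'` is nonempty; otherwise it receives
the input cell just after the formula, and nothing is claimed about it. -/
theorem wp_stepCmd (h : Ready W K g G e props w s) {l l' : List ℕ} {a T : ℕ}
    {L L' : List (Set S)} (hw : w = l ++ a :: l') (h7 : s.reg 7 = l'.length) (hL : Stack e L s)
    (hs : ∀ s', Ready W K g G e props w s' → Stack e L s' →
      s'.reg 8 = a → (∀ b l'', l' = b :: l'' → s'.reg 9 = b) →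
      wp W K symbolCmd s' fun t s'' => t ≤ T ∧ Stack e L' s'')
    (hQ : ∀ t s', t ≤ T + 30 → Ready W K g G e props w s' → s'.reg 7 = l'.length + 1 →
      Stack e L' s' → Q t s') :
    wp W K stepCmd s Q := by
  have hlt := h.lt
  have hlen := h.len
  have hcode := h.code
  have hwl : w.length = l.length + 1 + l'.length := by rw [hw]; simp; omega
  refine wp_seq (wp_seq (wp_seq (wp_assign ?_ (wp_seq (wp_assign ?_ (wp_skip ?_))))))
  · simp [Exp.Ok, Exp.eval]; omega
  · simp [Exp.Ok, Exp.eval, Store.set]; omega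
  simp only [Exp.eval, Store.set, hlen, h7, Exp.cost, Exp.addrCost,
    Function.update_of_ne (show (3 : ℕ) ≠ 8 by decide),
    Function.update_of_ne (show (7 : ℕ) ≠ 8 by decide)]
  set s' : Store := ⟨_, _⟩ with hs'
  have hf : Frame readCmd s s' := by
    refine ⟨fun r hr => ?_, fun _ _ => rfl⟩
    simp [readCmd, block, wr] at hr
    simp only [hs']
    rw [Function.update_of_ne (Ne.symm hr.2), Function.update_of_ne (Ne.symm hr.1)]
  have hR := h.of_frame hf (lt_six_cases rfl rfl rfl rfl rfl rfl) (by decide)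
  have e8 : s'.reg 8 = a := by
    have := hcode l.length (by omega)
    simp only [hw, List.getElem_append_right le_rfl, Nat.sub_self, List.getElem_cons_zero] at this
    simp only [hs', Function.update_of_ne (show (8 : ℕ) ≠ 9 by decide), Function.update_self, ← this]
    congr 1; omega
  have e9 : ∀ b l'', l' = b :: l'' → s'.reg 9 = b := by
    rintro b l'' rfl
    have := hcode (l.length + 1) (by simp at hwl; omega)
    simp only [hw, List.getElem_append_right (Nat.le_add_right _ 1)] at this
    simp at this
    rw [← this]
    simp only [hs', Function.update_self, List.length_cons] at hwl ⊢
    congr 1; omega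
  refine (hs s' hR (hL.of_eq (by simp [hs']) (by simp [hs'])) e8 e9).imp
    fun t s2 hf2 ⟨ht, hL2⟩ => wp_assign trivial ?_
  have e7 : s2.reg 7 = l'.length := by rw [hf2.1 7 rfl, ← h7]; simp [hs']
  have hR2 := hR.of_frame hf2 (lt_six_cases rfl rfl rfl rfl rfl rfl) (by decide)
  refine hQ _ _ (by simp [Exp.cost]; omega) (hR2.of_frame (c := inc 7) ⟨fun r hr => ?_, fun _ _ => rfl⟩
    (lt_six_cases rfl rfl rfl rfl rfl rfl) (by decide)) ?_ (hL2.of_eq ?_ rfl)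
  · simp [inc, wr] at hr
    simp [Store.set, Function.update_of_ne (Ne.symm hr)]
  · simp [Store.set, Exp.eval, e7]
  · simp [Store.set]

end RAM

-- Evaluation of a formula from right to left

namespace RAM

open Exp Cmd

variable {S : Type u} {Act : Type v} {AP : Type w} {n : ℕ}

variable {W K D : ℕ} {g : Graph} {s : Store} {Q : ℕ → Store → Prop} {G : MDP S Act AP}
  {e : S ≃ Fin n} {props : List AP} {w : List ℕ}

/-- Reading the word `u` backwards puts `R` on the stack, in at most `D` steps per symbol. -/
def Evaluates (W K D : ℕ) (g : Graph) (G : MDP S Act AP) (e : S ≃ Fin n) (props : List AP)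
    (u : List ℕ) (R : List (Set S)) : Prop :=
  ∀ w l l' s L (Q : ℕ → Store → Prop), w = l ++ (u ++ l') → Ready W K g G e props w s →
    s.reg 7 = l'.length → Stack e L s →
    (∀ t s', t ≤ D * u.length → Ready W K g G e props w s' → s'.reg 7 = l'.length + u.length →
      Stack e (R ++ L) s' → Q t s') →
    wp W K (iter stepCmd u.length) s Q

/-- The right factor is read first, so the results of the left one end up on top. Hence a first
operand lies above a second one. -/
theorem Evaluates.append {u v : List ℕ} {R R' : List (Set S)}
    (hu : Evaluates W K D g G e props u R) (hv : Evaluates W K D g G e props v R') :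
    Evaluates W K D g G e props (u ++ v) (R ++ R') := by
  intro w l l' s L Q hw hs h7 hL hQ
  rw [List.length_append, add_comm]
  refine wp_iter_add _ _ (hv w (l ++ u) l' s L _ (by simp [hw]) hs h7 hL fun t s' ht hs' h7' hL' =>
    hu w l (v ++ l') s' _ _ (by simp [hw]) hs' (by simp [h7', add_comm]) hL'
    fun t2 s2 ht2 hs2 h72 hL2 => hQ _ _ ?_ hs2 ?_ (by simpa using hL2))
  · rw [List.length_append, mul_add]; omega
  · simp only [h72, List.length_append]; omega

theorem Evaluates.cons {u : List ℕ} {R R' : List (Set S)} {a T : ℕ}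
    (hu : Evaluates W K D g G e props u R) (hT : T + 30 ≤ D)
    (h : ∀ w s L, Ready W K g G e props w s → Stack e (R ++ L) s → s.reg 8 = a →
      (∀ b u', u = b :: u' → s.reg 9 = b) →
      wp W K symbolCmd s fun t s' => t ≤ T ∧ Stack e (R' ++ L) s') :
    Evaluates W K D g G e props (a :: u) R' := by
  intro w l l' s L Q hw hs h7 hL hQ
  refine wp_iter_add _ 1 (hu w (l ++ [a]) l' s L _ (by simp [hw]) hs h7 hL
    fun t s' ht hs' h7' hL' => wp_seq (wp_stepCmd hs' (l := l) (l' := u ++ l') (by simp [hw])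
      (by simp [h7', add_comm]) hL' (fun s2 hs2 hL2 h8 h9 => h w s2 L hs2 hL2 h8
        fun b u' hb => h9 b (u' ++ l') (by simp [hb]))
      fun t2 s2 ht2 hs2 h72 hL2 => wp_skip (hQ _ _ ?_ hs2 ?_ hL2)))
  · rw [List.length_cons, mul_add]; omega
  · simp only [h72, List.length_append, List.length_cons]; omega

theorem Evaluates.nil : Evaluates W K D g G e props [] ([] : List (Set S)) :=
  fun w l l' s L Q hw hs h7 hL hQ => wp_skip (hQ _ _ (by simp) hs (by simpa using h7) hL)

theorem wp_ite_le {b : Exp} {c d : Cmd} {T : ℕ} {P : Store → Prop} (hb : b.Ok W K s)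
    (hc : b.cost ≤ 3) (h1 : b.eval s ≠ 0 → wp W K c s fun t s' => t ≤ T ∧ P s')
    (h2 : b.eval s = 0 → wp W K d s fun t s' => t ≤ T ∧ P s') :
    wp W K (.ite b c d) s fun t s' => t ≤ T + 5 ∧ P s' :=
  wp_ite hb (fun h => (h1 h).imp fun t s' _ h => ⟨by omega, h.2⟩)
    (fun h => (h2 h).imp fun t s' _ h => ⟨by omega, h.2⟩)

theorem wp_symbolCmd {T : ℕ} {P : Store → Prop}
    (hatom : 13 < s.reg 8 → wp W K atomCmd s fun t s' => t ≤ T ∧ P s')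
    (hquant : 5 < s.reg 8 → s.reg 8 ≤ 13 → 2 < s.reg 9 → s.reg 9 ≤ 5 →
      wp W K quantCmd s fun t s' => t ≤ T ∧ P s')
    (hskip : 5 < s.reg 8 ∧ s.reg 8 ≤ 13 ∧ (s.reg 9 ≤ 2 ∨ 5 < s.reg 9) ∨
      2 < s.reg 8 ∧ s.reg 8 ≤ 5 → P s)
    (hor : s.reg 8 = 2 → wp W K orCmd s fun t s' => t ≤ T ∧ P s')
    (hnot : s.reg 8 = 1 → wp W K notCmd s fun t s' => t ≤ T ∧ P s')
    (htt : s.reg 8 = 0 → wp W K ttCmd s fun t s' => t ≤ T ∧ P s') :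
    wp W K symbolCmd s fun t s' => t ≤ T + 25 ∧ P s' := by
  have hle : ∀ {c : Cmd} {T' k : ℕ}, (wp W K c s fun t s' => t ≤ T' ∧ P s') →
      wp W K c s fun t s' => t ≤ T' + k ∧ P s' :=
    fun h => h.imp fun t s' _ h => ⟨by omega, h.2⟩
  refine wp_ite_le (T := T + 20) ⟨trivial, trivial⟩ le_rfl
    (fun h => hle (hatom (by simp [Exp.eval] at h; omega))) fun h1 => ?_
  simp [Exp.eval] at h1
  refine wp_ite_le (T := T + 15) ⟨trivial, trivial⟩ le_rfl (fun h2 => ?_) (fun h2 => ?_)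
  · simp [Exp.eval] at h2
    refine wp_ite_le (T := T + 10) ⟨trivial, trivial⟩ le_rfl (fun h3 => ?_) (fun h3 => ?_)
    · simp [Exp.eval] at h3
      refine wp_ite_le (T := T + 5) ⟨trivial, trivial⟩ le_rfl (fun h4 => ?_) (fun h4 => ?_)
      · simp [Exp.eval] at h4
        exact wp_skip ⟨by omega, hskip (by omega)⟩
      · simp [Exp.eval] at h4
        exact hle (hquant (by omega) (by omega) (by omega) (by omega))
    · simp [Exp.eval] at h3
      exact wp_skip ⟨by omega, hskip (by omega)⟩
  · simp [Exp.eval] at h2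
    refine wp_ite_le (T := T + 10) ⟨trivial, trivial⟩ le_rfl (fun h3 => ?_) (fun h3 => ?_)
    · simp [Exp.eval] at h3
      exact wp_skip ⟨by omega, hskip (by omega)⟩
    · simp [Exp.eval] at h3
      refine wp_ite_le (T := T + 5) ⟨trivial, trivial⟩ le_rfl (fun h4 => ?_) (fun h4 => ?_)
      · simp [Exp.eval] at h4
        exact hle (hor (by omega))
      · simp [Exp.eval] at h4
        refine wp_ite_le (T := T) trivial (by simp [Exp.cost]) (fun h5 => ?_) (fun h5 => ?_)
        · simp [Exp.eval] at h5
          exact hnot (by omega)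
        · exact htt h5

/-- The word `a :: u` is evaluated without effect on the stack, if `a` is a temporal operator. -/
theorem Evaluates.operator {u : List ℕ} {R : List (Set S)} {a : ℕ}
    (hu : Evaluates W K D g G e props u R) (hD : 55 ≤ D) (ha : 2 < a) (ha' : a ≤ 5) :
    Evaluates W K D g G e props (a :: u) R :=
  hu.cons (T := 25) hD fun w s L hs hL h8 _ =>
    wp_symbolCmd (T := 0) (fun h => by omega) (fun h1 h2 h3 h4 => by omega) (fun _ => hL)
      (fun h => by omega) (fun h => by omega) (fun h => by omega)

section Sat

variable [Countable S] [MeasurableSpace S] [DiscreteMeasurableSpace S]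

/-- The sets of states of the operands of the temporal operator. -/
def _root_.PathFormula.operands (G : MDP S Act AP) : PathFormula AP → List (Set S)
  | .state ψ => [{s | ψ.Sat G s}]
  | .next ψ => [{s | ψ.Sat G s}]
  | .until ψ₁ ψ₂ => [{s | ψ₁.Sat G s}, {s | ψ₂.Sat G s}]
  | .wait ψ₁ ψ₂ => [{s | ψ₁.Sat G s}, {s | ψ₂.Sat G s}]

end Sat

section Evaluation

variable [Fintype S] [MeasurableSpace S] [DiscreteMeasurableSpace S]

theorem steps_le (hn : 0 < n) (hD : D = 1600 * ((n + g.NA + g.E) * n)) :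
    1500 * ((n + g.NA + g.E) * n) + 55 ≤ D ∧ 250 * n + 55 ≤ D := by
  have : n ≤ (n + g.NA + g.E) * n := Nat.le_mul_of_pos_left _ (by omega)
  omega

/-- One symbol of look-ahead tells a quantifier whether a temporal operator follows, because no
state formula begins with one. -/
theorem _root_.StateFormula.encode_ne (ψ : StateFormula AP) :
    ∃ b u, ψ.encode props = b :: u ∧ (b ≤ 2 ∨ 5 < b) := by
  cases ψ <;> simp [StateFormula.encode] <;> omega

/-- The symbol of a temporal operator leaves its operands on the stack; the quantifier before it
does the work. Without an operator, the quantifier may leave the stack as it is. -/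
theorem evaluates_quant (hS : Fintype.card S = n) (hn : 0 < n) (hD : D = 1600 * ((n + g.NA + g.E) * n))
    (all : Bool) (m : QMode) (φ : PathFormula AP)
    (h : Evaluates W K D g G e props (φ.encode props) (φ.operands G)) :
    Evaluates W K D g G e props (((if all then 10 else 6) + m.code) :: φ.encode props)
      [{s | if all then ∀ σ : G.Strategy, m.Holds G s σ {ω | φ.Sat G ω}
        else ∃ σ : G.Strategy, m.Holds G s σ {ω | φ.Sat G ω}}] := by
  have hm := code_le m
  refine h.cons (T := 1500 * ((n + g.NA + g.E) * n) + 25) ?_ fun w s L hs hL h8 h9 => ?_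
  · have := steps_le hn hD; omega
  have h8' : 5 < s.reg 8 ∧ s.reg 8 ≤ 13 := by rw [h8]; split_ifs <;> omega
  have key : ∀ {A B : Set S} (op : ℕ) (_ : op ≤ 2), s.reg 9 = 3 + op →
      Stack e (A :: if op = 0 then L else B :: L) s →
      (∀ ω, φ.Sat G ω ↔ ω ∈ opPlays op A B) →
      wp W K symbolCmd s fun t s' => t ≤ 1500 * ((n + g.NA + g.E) * n) + 25 ∧
        Stack e ({s | if all then ∀ σ : G.Strategy, m.Holds G s σ {ω | φ.Sat G ω}
          else ∃ σ : G.Strategy, m.Holds G s σ {ω | φ.Sat G ω}} :: L) s' := by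
    intro A B op hop e9 hL hφ
    refine wp_symbolCmd (fun h => by omega) (fun h1 h2 h3 h4 => ?_) (fun _ => by omega)
      (fun h => by omega) (fun h => by omega) (fun h => by omega)
    refine wp_quantCmd hs.n_le hs.n_pos hs.on hs.rep m all hop h8 e9 hL
      fun t s' ht _ hL' => ⟨ht, ?_⟩
    have hφ' : {ω | φ.Sat G ω} = opPlays op A B := Set.ext hφ
    rw [hφ']
    have h1 : {s | if all then ∀ σ : G.Strategy, m.Holds G s σ (opPlays op A B)
        else ∃ σ : G.Strategy, m.Holds G s σ (opPlays op A B)} =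
        if all then G.allOp n op m A B else G.exOp n op m A B := by
      ext z
      cases all
      · exact G.exists_holds_op hS hop m A B z
      · exact G.forall_holds_op hS hop m A B z
    rw [h1]
    exact hL'
  rcases φ with ψ | ψ | ⟨ψ₁, ψ₂⟩ | ⟨ψ₁, ψ₂⟩
  · obtain ⟨b, u, hb, hb'⟩ := ψ.encode_ne (props := props)
    have e9 := h9 b u hb
    refine wp_symbolCmd (fun h => by omega) (fun h1 h2 h3 h4 => by omega) (fun _ => ?_)
      (fun h => by omega) (fun h => by omega) (fun h => by omega)
    have h1 : {s | if all then ∀ σ : G.Strategy, m.Holds G s σ {ω | ψ.Sat G (ω 0)}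
        else ∃ σ : G.Strategy, m.Holds G s σ {ω | ψ.Sat G (ω 0)}} = {s | ψ.Sat G s} := by
      ext z
      cases all
      · exact G.exists_holds_state m {s | ψ.Sat G s} z
      · exact G.forall_holds_state m {s | ψ.Sat G s} z
    simp only [PathFormula.Sat]
    rw [h1]
    exact hL
  · exact key (B := ∅) 0 (by omega) (h9 3 _ rfl) hL fun ω => Iff.rfl
  · exact key 1 (by omega) (h9 4 _ rfl) hL fun ω => Iff.rfl
  · exact key 2 (by omega) (h9 5 _ rfl) hL fun ω => Iff.rfl

mutual

theorem _root_.StateFormula.evaluates (hS : Fintype.card S = n)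
    (hn : 0 < n)
    (hD : D = 1600 * ((n + g.NA + g.E) * n)) :
    ∀ ψ : StateFormula AP, (∀ q ∈ ψ.atoms, q ∈ props) →
      Evaluates W K D g G e props (ψ.encode props) [{s | ψ.Sat G s}]
  | .tt, _ => by
    refine Evaluates.nil.cons (T := 200 * n + 25) ?_ fun w s L hs hL h8 _ => wp_symbolCmd
      (fun h => by omega) (fun h1 h2 h3 h4 => by omega) (fun _ => by omega)
      (fun h => by omega) (fun h => by omega) (fun _ => wp_ttCmd hs hL fun t s' ht hL' => ⟨ht, ?_⟩)
    · have := steps_le hn hD; omega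
    · simpa [StateFormula.Sat] using hL'
  | .atom q, hq => by
    classical
    have hi := List.idxOf_lt_length_of_mem (hq q rfl)
    refine Evaluates.nil.cons (T := 200 * n + 25) ?_ fun w s L hs hL h8 _ => wp_symbolCmd
      (fun h => wp_atomCmd hs hi h8 hL fun t s' ht hL' => ⟨ht, ?_⟩) (fun h1 h2 h3 h4 => by omega)
      (fun _ => by omega) (fun h => by omega) (fun h => by omega) (fun _ => by omega)
    · have := steps_le hn hD; omega
    · simpa [StateFormula.Sat] using hL'
  | .neg ψ, hq => by
    refine (ψ.evaluates hS hn hD hq).cons (T := 200 * n + 25) ?_ fun w s L hs hL h8 _ => wp_symbolCmd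
      (fun h => by omega) (fun h1 h2 h3 h4 => by omega) (fun _ => by omega)
      (fun h => by omega) (fun _ => wp_notCmd hs hL fun t s' ht hL' => ⟨ht, ?_⟩) (fun h => by omega)
    · have := steps_le hn hD; omega
    · exact hL'
  | .disj ψ₁ ψ₂, hq => by
    refine ((ψ₁.evaluates hS hn hD fun q h => hq q (Or.inl h)).append
      (ψ₂.evaluates hS hn hD fun q h => hq q (Or.inr h))).cons (T := 250 * n + 25) ?_
      fun w s L hs hL h8 _ => wp_symbolCmd
      (fun h => by omega) (fun h1 h2 h3 h4 => by omega) (fun _ => by omega)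
      (fun h => wp_orCmd hs hL fun t s' ht hL' => ⟨ht, ?_⟩) (fun h => by omega) (fun h => by omega)
    · have := steps_le hn hD; omega
    · exact hL'
  | .ex m φ, hq => by
    simpa [StateFormula.Sat, StateFormula.encode] using
      evaluates_quant hS hn hD false m φ (φ.evaluates hS hn hD hq)
  | .all m φ, hq => by
    simpa [StateFormula.Sat, StateFormula.encode] using
      evaluates_quant hS hn hD true m φ (φ.evaluates hS hn hD hq)

theorem _root_.PathFormula.evaluates (hS : Fintype.card S = n)
    (hn : 0 < n)
    (hD : D = 1600 * ((n + g.NA + g.E) * n)) :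
    ∀ φ : PathFormula AP, (∀ q ∈ φ.atoms, q ∈ props) →
      Evaluates W K D g G e props (φ.encode props) (φ.operands G)
  | .state ψ, hq => ψ.evaluates hS hn hD hq
  | .next ψ, hq => (ψ.evaluates hS hn hD hq).operator (by have := steps_le hn hD; omega) (by omega) (by omega)
  | .until ψ₁ ψ₂, hq =>
    ((ψ₁.evaluates hS hn hD fun q h => hq q (Or.inl h)).append
      (ψ₂.evaluates hS hn hD fun q h => hq q (Or.inr h))).operator (by have := steps_le hn hD; omega) (by omega) (by omega)
  | .wait ψ₁ ψ₂, hq =>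
    ((ψ₁.evaluates hS hn hD fun q h => hq q (Or.inl h)).append
      (ψ₂.evaluates hS hn hD fun q h => hq q (Or.inr h))).operator (by have := steps_le hn hD; omega) (by omega) (by omega)

end

end Evaluation

end RAM

-- Loops over lists and words in memory

namespace RAM

open Exp Cmd

variable {W K : ℕ} {s : Store} {Q : ℕ → Store → Prop}

/-- Unlike in `wp_loop`, the time of a round depends on the element, so nested loops over lists of
different lengths take linear total time. -/
theorem Cmd.wp_loop_list {α : Type*} {i N : ℕ} {c : Cmd} (l : List α) (Inv : List α → Store → Prop)
    (T : α → ℕ) (hi : c.wr i = false) (hN : c.wr N = false) (hne : i ≠ N) (hl : s.reg N = l.length)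
    (h0 : Inv [] (s.set i 0))
    (hstep : ∀ p x q s', l = p ++ x :: q → s'.reg i = p.length → Frame (Cmd.loop i N c) s s' →
      Inv p s' → wp W K c s' fun t s'' => t ≤ T x ∧ Inv (p ++ [x]) (s''.set i (p.length + 1)))
    (hend : ∀ t s', t ≤ (l.map fun x => T x + 9).sum + 6 → Frame (Cmd.loop i N c) s s' →
      Inv l s' → Q t s') :
    wp W K (Cmd.loop i N c) s Q := by
  have key : ∀ q p (s1 : Store), l = p ++ q → s1.reg i = p.length → Frame (Cmd.loop i N c) s s1 →
      Inv p s1 → wp W K (iter (seq c (inc i)) q.length) s1 fun t s' =>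
        t ≤ (q.map fun x => T x + 4).sum ∧ Frame (Cmd.loop i N c) s s' ∧ Inv l s' := by
    intro q
    induction q with
    | nil =>
      intro p s1 h1 h2 h3 h4
      exact wp_skip ⟨by simp, h3, by simpa [h1] using h4⟩
    | cons x q ih =>
      intro p s1 h1 h2 h3 h4
      refine wp_seq (wp_seq ((hstep p x q s1 h1 h2 h3 h4).imp fun t s2 hf hq => ?_))
      have e2 : s2.reg i = p.length := by rw [hf.1 i hi, h2]
      refine wp_assign trivial ?_
      simp only [Exp.eval, e2]
      refine (ih (p ++ [x]) _ (by simp [h1]) (by simp [Store.set]) (h3.trans ?_) hq.2).imp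
        fun t' s' _ h => ⟨?_, h.2⟩
      · refine ⟨fun r hr => ?_, fun k hk => ?_⟩
        · simp only [Cmd.loop, wr, inc, Bool.or_eq_false_iff, beq_eq_false_iff_ne] at hr
          simp [Store.set, Function.update_of_ne (Ne.symm hr.1), hf.1 r hr.2.1]
        · simp only [Cmd.loop, wa, inc, Bool.or_eq_false_iff] at hk
          simp [Store.set, hf.2 k hk.2.1]
      · have h1 := h.1
        have h2 := hq.1
        simp only [Exp.cost, List.map_cons, List.sum_cons]
        omega
  have hsum : (l.map fun x => T x + 9).sum = (l.map fun x => T x + 4).sum + 5 * l.length := by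
    clear key hend hstep hl
    induction l with
    | nil => rfl
    | cons x l ih => simp only [List.map_cons, List.sum_cons, List.length_cons, ih]; omega
  refine wp_loop_iter hi hN hne ?_
  rw [hl]
  refine (key l [] _ rfl (by simp [Store.set]) ?_ h0).imp fun t s' _ h he => hend _ _ ?_ h.2.1 h.2.2
  · refine ⟨fun r hr => ?_, fun k hk => rfl⟩
    simp only [Cmd.loop, wr, inc, Bool.or_eq_false_iff, beq_eq_false_iff_ne] at hr
    simp [Store.set, Function.update_of_ne (Ne.symm hr.1)]
  · have := h.1
    omega

/-- The word `u` stands in the memory `m` from the address `a` on. -/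
def Segment (m : ℕ → ℕ) : ℕ → List ℕ → Prop
  | _, [] => True
  | a, x :: u => m a = x ∧ Segment m (a + 1) u

theorem segment_append {m : ℕ → ℕ} {a : ℕ} {u v : List ℕ} :
    Segment m a (u ++ v) ↔ Segment m a u ∧ Segment m (a + u.length) v := by
  induction u generalizing a with
  | nil => simp [Segment]
  | cons x u ih =>
    simp [Segment, ih, and_assoc, add_assoc, add_comm 1]

theorem Segment.getElem {m : ℕ → ℕ} {a : ℕ} {u : List ℕ} (h : Segment m a u) (j : ℕ)
    (hj : j < u.length) : m (a + j) = u[j] := by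
  induction u generalizing a j with
  | nil => simp at hj
  | cons x u ih =>
    cases j with
    | zero => exact h.1
    | succ j =>
      have := ih h.2 j (by simpa using hj)
      rw [← Nat.add_assoc, Nat.add_right_comm, this]; rfl

/-! ### The traversal of the transitions -/

/-- The word for a list of destinations. -/
def destWord (d : List ℕ) : List ℕ := d.length :: d

/-- The word for a list of actions. -/
def actWord (l : List (List ℕ)) : List ℕ := l.length :: l.flatMap destWord

/-- The word for a list of states. -/
def stateWord (l : List (List (List ℕ))) : List ℕ := l.flatMap actWord

/-- The actions with their sources. -/
def actions : List (List (List ℕ)) → ℕ → List (ℕ × List ℕ)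
  | [], _ => []
  | d :: l, x => d.map (x, ·) ++ actions l (x + 1)

theorem actions_append (l l' : List (List (List ℕ))) (x : ℕ) :
    actions (l ++ l') x = actions l x ++ actions l' (x + l.length) := by
  induction l generalizing x with
  | nil => simp [actions]
  | cons d l ih => simp [actions, ih, add_assoc, add_comm 1]

/-- Goes through the destinations of an action. -/
def destLoop (cd : Cmd) : Cmd := .loop 15 23 (block [cd, inc 21])

/-- Goes through the actions of a state. -/
def actLoop (ca cd : Cmd) : Cmd :=
  .loop 14 22 (block [.assign 23 (arr 0 (var 21)), inc 21, ca, destLoop cd])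

/-- Goes through the states, and executes `ca` for each action and `cd` for each destination. -/
def stateLoop (ca cd : Cmd) : Cmd :=
  .loop 10 0 (block [.assign 22 (arr 0 (var 21)), inc 21, actLoop ca cd])

/-- `ca` and `cd` preserve `I`, which depends on the variables `1`, `2` and on arrays. -/
structure Hooks (W K : ℕ) (I : List (ℕ × List ℕ) → Store → Prop) (ca cd : Cmd) : Prop where
  stable : ∀ l s s', s'.reg 1 = s.reg 1 → s'.reg 2 = s.reg 2 → s'.arr = s.arr → I l s → I l s'
  wr : ∀ r, r ≠ 1 → r ≠ 2 → ca.wr r = false ∧ cd.wr r = false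
  wa : ca.wa 0 = false ∧ cd.wa 0 = false
  act : ∀ l s, I l s → wp W K ca s fun t s' => t ≤ 30 ∧ I (l ++ [(s.reg 10, [])]) s'
  dest : ∀ l x d s, s.reg 21 < W → I (l ++ [(x, d)]) s →
    wp W K cd s fun t s' => t ≤ 30 ∧ I (l ++ [(x, d ++ [s.arr 0 (s.reg 21)])]) s'

variable {I : List (ℕ × List ℕ) → Store → Prop} {ca cd : Cmd}

theorem Hooks.set (h : Hooks W K I ca cd) {l : List (ℕ × List ℕ)} (hI : I l s) {r x : ℕ}
    (h1 : r ≠ 1) (h2 : r ≠ 2) : I l (s.set r x) :=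
  h.stable l s _ (by simp [Store.set, Function.update_of_ne h1.symm])
    (by simp [Store.set, Function.update_of_ne h2.symm]) rfl hI

theorem wp_destLoop (h : Hooks W K I ca cd) {l : List (ℕ × List ℕ)} {x : ℕ} {d : List ℕ}
    (h23 : s.reg 23 = d.length) (hd : Segment (s.arr 0) (s.reg 21) d)
    (hW : s.reg 21 + d.length ≤ W) (hI : I (l ++ [(x, [])]) s)
    (hQ : ∀ t s', t ≤ 43 * d.length + 6 → s'.reg 21 = s.reg 21 + d.length →
      I (l ++ [(x, d)]) s' → Q t s') :
    wp W K (destLoop cd) s Q := by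
  have hw := h.wr
  have ha := h.wa
  refine wp_loop_list d (fun p s' => s'.reg 21 = s.reg 21 + p.length ∧ I (l ++ [(x, p)]) s')
    (fun _ => 34) (by simp [block, wr, inc, hw 15]) (by simp [block, wr, inc, hw 23]) (by decide) h23
    ⟨by simp [Store.set], h.set hI (by decide) (by decide)⟩ ?_ ?_
  · rintro p y q s' rfl h15 hf ⟨h21, hI⟩
    have e0 : s'.arr 0 = s.arr 0 := hf.2 0 (by simp [Cmd.loop, wa, block, inc, ha])
    have hy : s'.arr 0 (s'.reg 21) = y := by
      rw [e0, h21]; exact (segment_append.1 hd).2.1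
    refine wp_seq ((h.dest l x p s' (by simp at hW; omega) hI).imp fun t s2 hf2 h2 =>
      wp_seq (wp_assign trivial (wp_skip ⟨by simp [Exp.cost]; omega, ?_, ?_⟩)))
    · simp [Store.set, Exp.eval, hf2.1 21 (hw 21 (by decide) (by decide)).2, h21, add_assoc]
    · rw [hy] at h2
      exact h.set (h.set h2.2 (by decide) (by decide)) (by decide) (by decide)
  · rintro t s' ht hf ⟨h1, h2⟩
    exact hQ t s' (by simpa [mul_comm] using ht) h1 h2

theorem destLoop_wr (h : Hooks W K I ca cd) {r : ℕ} (h1 : r ≠ 1) (h2 : r ≠ 2) (h3 : r ≠ 15)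
    (h4 : r ≠ 21) : (destLoop cd).wr r = false := by
  simp [destLoop, Cmd.loop, block, wr, inc, (h.wr r h1 h2).2]
  omega

theorem wp_actLoop (h : Hooks W K I ca cd) {l : List (ℕ × List ℕ)} {d : List (List ℕ)}
    (h22 : s.reg 22 = d.length) (hd : Segment (s.arr 0) (s.reg 21) (d.flatMap destWord))
    (hW : s.reg 21 + (d.flatMap destWord).length ≤ W) (hI : I l s)
    (hQ : ∀ t s', t ≤ 60 * (d.flatMap destWord).length + 6 →
      s'.reg 21 = s.reg 21 + (d.flatMap destWord).length →
      I (l ++ d.map (s.reg 10, ·)) s' → Q t s') :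
    wp W K (actLoop ca cd) s Q := by
  have hw := h.wr
  have ha := h.wa
  have hdl := @destLoop_wr W K I ca cd h
  have hda : (destLoop cd).wa 0 = false := by simp [destLoop, Cmd.loop, wa, block, inc, ha]
  refine wp_loop_list d (fun p s' => s'.reg 21 = s.reg 21 + (p.flatMap destWord).length ∧
    I (l ++ p.map (s.reg 10, ·)) s')
    (fun x => 43 * x.length + 45) (by simp [block, wr, inc, hw 14, hdl])
    (by simp [block, wr, inc, hw 22, hdl]) (by decide) h22
    ⟨by simp [Store.set], by simpa using h.set hI (by decide) (by decide)⟩ ?_ ?_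
  · rintro p y q s' rfl h14 hf ⟨h21, hI⟩
    have e0 : s'.arr 0 = s.arr 0 := hf.2 0 (by simp [Cmd.loop, wa, block, inc, ha, hda])
    have e10 : s'.reg 10 = s.reg 10 := hf.1 10 (by simp [Cmd.loop, wr, block, inc, hw, hdl])
    rw [List.flatMap_append, List.flatMap_cons, segment_append, segment_append, ← h21] at hd
    simp only [List.flatMap_append, List.flatMap_cons, List.length_append, destWord,
      List.length_cons] at hW
    obtain ⟨-, ⟨hy, hy'⟩, -⟩ := hd
    refine wp_seq (wp_assign ⟨trivial, fun _ => ?_⟩ (wp_seq (wp_assign trivial (wp_seq ?_))))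
    · simp only [Exp.eval]; omega
    refine (h.act _ _ (h.set (h.set hI (by decide) (by decide)) (by decide) (by decide))).imp
      fun t s2 hf2 h2 => wp_seq (wp_destLoop h (x := s.reg 10) (d := y)
        (l := l ++ p.map (s.reg 10, ·)) ?_ ?_ ?_ ?_
        fun t3 s3 ht3 h213 hI3 => wp_skip ⟨?_, ?_, ?_⟩)
    · rw [hf2.1 23 (hw 23 (by decide) (by decide)).1]
      simp [Store.set, Exp.eval, e0, hy]
    · rw [hf2.1 21 (hw 21 (by decide) (by decide)).1, hf2.2 0 ha.1]
      simpa [Store.set, Exp.eval, e0] using hy'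
    · rw [hf2.1 21 (hw 21 (by decide) (by decide)).1]
      simp [Store.set, Exp.eval]; omega
    · simpa [Store.set, e10] using h2.2
    · simp [Exp.cost, Exp.addrCost]; omega
    · simp only [Store.set, Function.update_of_ne (show (21 : ℕ) ≠ 14 by decide), h213,
        hf2.1 21 (hw 21 (by decide) (by decide)).1, Function.update_self, Exp.eval,
        Function.update_of_ne (show (21 : ℕ) ≠ 23 by decide), h21]
      simp [destWord]; omega
    · simpa using h.set hI3 (by decide) (by decide)
  · rintro t s' ht hf ⟨h1, h2⟩
    refine hQ t s' (ht.trans ?_) h1 h2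
    clear hQ h2 h1 ht hf hd hW h22
    induction d with
    | nil => simp
    | cons y d ih =>
      simp only [List.map_cons, List.sum_cons, List.flatMap_cons, List.length_append, destWord,
        List.length_cons] at ih ⊢
      omega

theorem actLoop_wr (h : Hooks W K I ca cd) {r : ℕ} (h1 : r ≠ 1) (h2 : r ≠ 2) (h3 : r ≠ 15)
    (h4 : r ≠ 21) (h5 : r ≠ 14) (h6 : r ≠ 23) : (actLoop ca cd).wr r = false := by
  simp [actLoop, Cmd.loop, block, wr, inc, (h.wr r h1 h2).1, destLoop_wr h h1 h2 h3 h4]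
  omega

/-- The time is linear in the length of the word because every state, action and destination
occupies a cell of its own. -/
theorem wp_stateLoop (h : Hooks W K I ca cd) {d : List (List (List ℕ))}
    (h0 : s.reg 0 = d.length) (hd : Segment (s.arr 0) (s.reg 21) (stateWord d))
    (hW : s.reg 21 + (stateWord d).length ≤ W) (hI : I [] s)
    (hQ : ∀ t s', t ≤ 100 * (stateWord d).length + 6 → Frame (stateLoop ca cd) s s' →
      s'.reg 21 = s.reg 21 + (stateWord d).length → I (actions d 0) s' → Q t s') :
    wp W K (stateLoop ca cd) s Q := by
  have hw := h.wr
  have ha := h.wa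
  have hdl := @actLoop_wr W K I ca cd h
  have hda : (actLoop ca cd).wa 0 = false := by
    simp [actLoop, destLoop, Cmd.loop, wa, block, inc, ha]
  refine wp_loop_list d (fun p s' => s'.reg 21 = s.reg 21 + (stateWord p).length ∧
    I (actions p 0) s')
    (fun x => 60 * (x.flatMap destWord).length + 20) (by simp [block, wr, inc, hdl])
    (by simp [block, wr, inc, hdl]) (by decide) h0
    ⟨by simp [Store.set, stateWord], by simpa [actions] using h.set hI (by decide) (by decide)⟩
    ?_ ?_
  · rintro p y q s' rfl h10 hf ⟨h21, hI⟩
    have e0 : s'.arr 0 = s.arr 0 := hf.2 0 (by simp [Cmd.loop, wa, block, inc, hda])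
    rw [stateWord, List.flatMap_append, List.flatMap_cons, segment_append, segment_append,
      ← stateWord, ← h21] at hd
    simp only [stateWord, List.flatMap_append, List.flatMap_cons, List.length_append, actWord,
      List.length_cons] at hW h21
    obtain ⟨-, ⟨hy, hy'⟩, -⟩ := hd
    refine wp_seq (wp_assign ⟨trivial, fun _ => ?_⟩ (wp_seq (wp_assign trivial (wp_seq ?_))))
    · simp only [Exp.eval]; omega
    refine wp_actLoop h (d := y) (l := actions p 0) ?_ ?_ ?_
      (h.set (h.set hI (by decide) (by decide)) (by decide) (by decide))
      fun t3 s3 ht3 h213 hI3 => wp_skip ⟨?_, ?_, ?_⟩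
    · simp [Store.set, Exp.eval, e0, hy]
    · simpa [Store.set, Exp.eval, e0] using hy'
    · simp [Store.set, Exp.eval, -List.length_flatMap]; omega
    · simp [Exp.cost, Exp.addrCost, -List.length_flatMap]; omega
    · simp only [Store.set, Function.update_of_ne (show (21 : ℕ) ≠ 10 by decide), h213,
        Function.update_self, Exp.eval,
        Function.update_of_ne (show (21 : ℕ) ≠ 22 by decide), h21]
      simp [stateWord, actWord]; omega
    · rw [actions_append]
      simpa [actions, Store.set, h10] using h.set hI3 (by decide) (by decide)
  · rintro t s' ht hf ⟨h1, h2⟩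
    refine hQ t s' (ht.trans ?_) hf h1 h2
    clear hQ h2 h1 ht hf hd hW h0
    simp only [stateWord]
    induction d with
    | nil => simp
    | cons y d ih =>
      simp only [List.map_cons, List.sum_cons, List.flatMap_cons, List.length_append, actWord,
        List.length_cons] at ih ⊢
      omega

end RAM

namespace RAM

open Exp Cmd

variable {W K : ℕ} {s : Store} {Q : ℕ → Store → Prop}

/-! ### Building the graph -/

/-- The edges: pairs of the number of an action and a destination. -/
def edges (l : List (ℕ × List ℕ)) : List (ℕ × ℕ) :=
  l.zipIdx.flatMap fun q => q.1.2.map (q.2, ·)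

theorem edges_append_nil (l : List (ℕ × List ℕ)) (x : ℕ) : edges (l ++ [(x, [])]) = edges l := by
  simp [edges, List.zipIdx_append]

theorem edges_append_cons (l : List (ℕ × List ℕ)) (x y : ℕ) (d : List ℕ) :
    edges (l ++ [(x, d ++ [y])]) = edges (l ++ [(x, d)]) ++ [(l.length, y)] := by
  simp [edges, List.zipIdx_append]

theorem mem_edges {l : List (ℕ × List ℕ)} {x t : ℕ} :
    (x, t) ∈ edges l ↔ ∃ h : x < l.length, t ∈ l[x].2 := by
  simp only [edges, List.mem_flatMap, List.mem_map, Prod.mk.injEq, Prod.exists,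
    List.mem_zipIdx_iff_getElem?, List.getElem?_eq_some_iff]
  constructor
  · rintro ⟨a, b, i, ⟨h1, h2⟩, t', h3, rfl, rfl⟩
    exact ⟨h1, by rw [h2]; exact h3⟩
  · rintro ⟨h, h'⟩
    exact ⟨l[x].1, l[x].2, x, ⟨h, rfl⟩, t, h', rfl, rfl⟩

theorem edges_length (l : List (ℕ × List ℕ)) :
    (edges l).length = (l.map fun q => q.2.length).sum := by
  induction l using List.reverseRecOn with
  | nil => rfl
  | append_singleton l q ih =>
    have : edges (l ++ [q]) = edges l ++ q.2.map (l.length, ·) := by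
      simp [edges, List.zipIdx_append]
    simp [this, ih]

theorem mem_actions {l : List (List (List ℕ))} {x₀ x : ℕ} {d : List ℕ} :
    (x, d) ∈ actions l x₀ ↔ ∃ i, ∃ h : i < l.length, x = x₀ + i ∧ d ∈ l[i] := by
  induction l generalizing x₀ with
  | nil => simp [actions]
  | cons y l ih =>
    simp only [actions, List.mem_append, ih, List.mem_map, Prod.mk.injEq]
    constructor
    · rintro (⟨a, h1, rfl, rfl⟩ | ⟨i, h, rfl, h'⟩)
      · exact ⟨0, by simp, rfl, h1⟩
      · exact ⟨i + 1, by simpa using h, by omega, by simpa using h'⟩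
    · rintro ⟨_ | i, h, rfl, h'⟩
      · exact .inl ⟨d, by simpa using h', rfl, rfl⟩
      · exact .inr ⟨i, by simpa using h, by omega, by simpa using h'⟩

/-- The graph of a list of actions. -/
def Graph.ofActions (n : ℕ) (l : List (ℕ × List ℕ)) (h : ∀ q ∈ l, q.1 < n ∧ ∀ t ∈ q.2, t < n) :
    Graph where
  n := n
  NA := l.length
  E := (edges l).length
  src x := (l.map Prod.fst).getD x 0
  act j := ((edges l).map Prod.fst).getD j 0
  dst j := ((edges l).map Prod.snd).getD j 0
  src_lt x hx := by
    rw [List.getD_eq_getElem _ _ (by simpa using hx)]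
    simpa using (h _ (List.getElem_mem hx)).1
  act_lt j hj := by
    rw [List.getD_eq_getElem _ _ (by simpa using hj)]
    simpa using (mem_edges.1 (List.getElem_mem hj)).1
  dst_lt j hj := by
    rw [List.getD_eq_getElem _ _ (by simpa using hj)]
    obtain ⟨h1, h2⟩ := mem_edges.1 (List.getElem_mem hj)
    simpa using (h _ (List.getElem_mem h1)).2 _ h2

theorem Segment.update {m : ℕ → ℕ} {u : List ℕ} {x : ℕ} (h : Segment m 0 u) :
    Segment (Function.update m u.length x) 0 (u ++ [x]) := by
  refine segment_append.2 ⟨?_, by simp [Segment]⟩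
  have : ∀ (u : List ℕ) a, Segment m a u → ∀ b, a + u.length ≤ b →
      Segment (Function.update m b x) a u := by
    intro u
    induction u with
    | nil => intros; trivial
    | cons y u ih =>
      intro a h b hb
      simp only [List.length_cons] at hb
      exact ⟨by rw [Function.update_of_ne (by omega), h.1], ih _ h.2 _ (by omega)⟩
  exact this u 0 h _ (by simp)

/-- Records an action. -/
def recordAct : Cmd := block [.store 1 (var 1) (var 10), inc 1]

/-- Records an edge. -/
def recordDest : Cmd :=
  block [.store 2 (var 2) (sub (var 1) (lit 1)), .store 3 (var 2) (arr 0 (var 21)), inc 2]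

/-- The actions and the edges have been recorded. -/
structure Recorded (l : List (ℕ × List ℕ)) (s : Store) : Prop where
  NA : s.reg 1 = l.length
  E : s.reg 2 = (edges l).length
  src : Segment (s.arr 1) 0 (l.map Prod.fst)
  act : Segment (s.arr 2) 0 ((edges l).map Prod.fst)
  dst : Segment (s.arr 3) 0 ((edges l).map Prod.snd)

theorem hooks_record : Hooks W K Recorded recordAct recordDest where
  stable l s s' h1 h2 h := by
    rintro ⟨a, b, c, d, e⟩
    exact ⟨h1.trans a, h2.trans b, h ▸ c, h ▸ d, h ▸ e⟩
  wr r h1 h2 := by simp [recordAct, recordDest, block, Cmd.wr, inc]; omega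
  wa := by decide
  act l s h := by
    refine wp_seq (wp_store trivial trivial (by simp) (wp_seq (wp_assign trivial (wp_skip
      ⟨by simp [Exp.cost, Exp.addrCost], ?_, ?_, ?_, ?_, ?_⟩))))
    · simp [Store.set, Store.put, Exp.eval, h.NA]
    · simp [Store.set, Store.put, edges_append_nil, h.E]
    · simpa [Store.set, Store.put, Exp.eval, h.NA] using h.src.update (x := s.reg 10)
    · simpa [Store.set, Store.put, edges_append_nil] using h.act
    · simpa [Store.set, Store.put, edges_append_nil] using h.dst
  dest l x d s hW h := by
    have h1 := h.NA
    simp at h1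
    refine wp_seq (wp_store trivial ⟨trivial, trivial⟩ (by simp) (wp_seq (wp_store trivial
      ⟨trivial, fun _ => hW⟩ (by simp) (wp_seq (wp_assign trivial (wp_skip
      ⟨by simp [Exp.cost, Exp.addrCost], ?_, ?_, ?_, ?_, ?_⟩))))))
    · simp [Store.set, Store.put, Exp.eval, h1]
    · simp [Store.set, Store.put, Exp.eval, h.E, edges_append_cons]
    · simpa [Store.set, Store.put, Exp.eval] using h.src
    · simpa [Store.set, Store.put, Exp.eval, edges_append_cons, h.E, h1] using
        h.act.update (x := l.length)
    · simpa [Store.set, Store.put, Exp.eval, edges_append_cons, h.E] using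
        h.dst.update (x := s.arr 0 (s.reg 21))

/-- Builds the lists of the edges into each state. -/
def linkCmd : Cmd :=
  .loop 10 2 (block [.store 5 (var 10) (arr 4 (arr 3 (var 10))),
    .store 4 (arr 3 (var 10)) (addl (var 10) 1)])

/-- Edges are prepended in increasing order: the old head of the list becomes the link of the new
edge, as in the recursion for `lastIdx`. Array `4` has to be zero initially, for empty lists. -/
theorem wp_linkCmd {l : List (ℕ × List ℕ)} {n : ℕ} {h : ∀ q ∈ l, q.1 < n ∧ ∀ t ∈ q.2, t < n}
    (hr : Recorded l s) (h0 : s.reg 0 = n) (h4 : ∀ t, s.arr 4 t = 0)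
    (hQ : ∀ t s', t ≤ 80 * (edges l).length + 6 → Frame linkCmd s s' →
      (Graph.ofActions n l h).On s' → Q t s') :
    wp W K linkCmd s Q := by
  refine wp_loop (fun j s' => (∀ t, s'.arr 4 t = lastIdx (Graph.ofActions n l h).dst j t) ∧
    ∀ i < j, s'.arr 5 i = lastIdx (Graph.ofActions n l h).dst i ((Graph.ofActions n l h).dst i))
    60 rfl rfl (by decide) ⟨by simpa [lastIdx, Store.set] using h4, by simp⟩ ?_ ?_
  · rintro j s' hj h10 hf ⟨h1, h2⟩
    rw [hr.E] at hj
    have e3 : s'.arr 3 j = (Graph.ofActions n l h).dst j := by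
      rw [hf.2 3 rfl]
      have := hr.dst.getElem j (by simpa using hj)
      rw [zero_add] at this
      rw [this]
      exact (List.getD_eq_getElem _ _ (by simpa using hj)).symm
    refine wp_seq (wp_store trivial ⟨⟨trivial, by simp⟩, by simp⟩ (by simp) (wp_seq (wp_store
      ⟨trivial, by simp⟩ trivial (by simp) (wp_skip
      ⟨by simp [Exp.cost, Exp.addrCost], ?_, ?_⟩))))
    · intro t
      simp only [Store.set, Store.put, Exp.eval, h10, Function.update_self, lastIdx,
        Function.update_of_ne (show (3 : Fin 16) ≠ 5 by decide),
        Function.update_of_ne (show (4 : Fin 16) ≠ 5 by decide), e3]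
      split_ifs with ht
      · rw [ht, Function.update_self]
      · rw [Function.update_of_ne (Ne.symm ht), h1]
    · intro i hi
      simp only [Store.set, Store.put, Exp.eval, h10, Function.update_self,
        Function.update_of_ne (show (5 : Fin 16) ≠ 4 by decide), e3]
      rcases Nat.lt_succ_iff_lt_or_eq.1 hi with hi | rfl
      · rw [Function.update_of_ne hi.ne, h2 i hi]
      · rw [Function.update_self, h1]
  · rintro t s' ht - hf ⟨h1, h2⟩
    rw [hr.E] at *
    refine hQ t s' (by omega) hf ⟨(hf.1 0 rfl).trans h0, (hf.1 1 rfl).trans hr.NA,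
      (hf.1 2 rfl).trans hr.E, fun x (hx : x < l.length) => ?_,
      fun x (hx : x < (edges l).length) => ?_, fun x (hx : x < (edges l).length) => ?_,
      fun t _ => h1 t, h2⟩
    · rw [hf.2 1 rfl]
      have := hr.src.getElem x (by simpa using hx)
      rw [zero_add] at this
      rw [this]
      exact (List.getD_eq_getElem _ _ (by simpa using hx)).symm
    · rw [hf.2 2 rfl]
      have := hr.act.getElem x (by simpa using hx)
      rw [zero_add] at this
      rw [this]
      exact (List.getD_eq_getElem _ _ (by simpa using hx)).symm
    · rw [hf.2 3 rfl]
      have := hr.dst.getElem x (by simpa using hx)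
      rw [zero_add] at this
      rw [this]
      exact (List.getD_eq_getElem _ _ (by simpa using hx)).symm

/-! ### The word of a Markov decision process -/

section Transitions

variable {S : Type u} {Act : Type v} {AP : Type w} {n k : ℕ}

open Classical in
/-- The list of destinations of an action. -/
noncomputable def destList (G : MDP S Act AP) (e : S ≃ Fin n) (s : S) (a : Act) : List ℕ :=
  ((List.finRange n).filter fun j => e.symm j ∈ G.dest s a).map Fin.val

open Classical in
/-- The lists of destinations of the actions of a state. -/
noncomputable def actList (G : MDP S Act AP) (e : S ≃ Fin n) (f : Act ≃ Fin k) (s : S) :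
    List (List ℕ) :=
  ((List.finRange k).filter fun j => f.symm j ∈ G.mov s).map fun j => destList G e s (f.symm j)

/-- The transitions. -/
noncomputable def transList (G : MDP S Act AP) (e : S ≃ Fin n) (f : Act ≃ Fin k) :
    List (List (List ℕ)) := (List.finRange n).map fun i => actList G e f (e.symm i)

variable {G : MDP S Act AP} {e : S ≃ Fin n} {f : Act ≃ Fin k}

theorem stateWord_transList (G : MDP S Act AP) (e : S ≃ Fin n) (f : Act ≃ Fin k) :
    stateWord (transList G e f) = (List.finRange n).flatMap fun i => G.encodeState e f (e.symm i) := by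
  simp only [stateWord, transList, List.flatMap_map]
  congr 1
  ext1 i
  simp only [actWord, MDP.encodeState, actList, List.length_map, List.flatMap_map]
  congr 2
  ext1 j
  simp [destWord, destList, MDP.encodeDest]

theorem mem_destList {s t : S} {a : Act} : (e t : ℕ) ∈ destList G e s a ↔ t ∈ G.dest s a := by
  simp only [destList, List.mem_map, List.mem_filter, List.mem_finRange, true_and,
    decide_eq_true_eq]
  constructor
  · rintro ⟨j, h1, h2⟩
    have : j = e t := Fin.ext h2
    simpa [this] using h1
  · exact fun h => ⟨e t, by simpa using h, rfl⟩

theorem mem_actions_transList {x : ℕ} {d : List ℕ} :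
    (x, d) ∈ actions (transList G e f) 0 ↔
      ∃ s, x = e s ∧ ∃ a ∈ G.mov s, d = destList G e s a := by
  simp only [mem_actions, transList, List.length_map, List.length_finRange, List.getElem_map,
    List.getElem_finRange, actList, List.mem_map, List.mem_filter, List.mem_finRange, true_and,
    decide_eq_true_eq, zero_add]
  constructor
  · rintro ⟨i, h, rfl, j, h1, rfl⟩
    exact ⟨e.symm ⟨x, h⟩, by simp, f.symm j, by simpa using h1, by simp⟩
  · rintro ⟨s, rfl, a, h1, rfl⟩
    exact ⟨e s, (e s).2, rfl, f a, by simpa using h1, by simp⟩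

theorem actions_transList_lt (G : MDP S Act AP) (e : S ≃ Fin n) (f : Act ≃ Fin k) :
    ∀ q ∈ actions (transList G e f) 0, q.1 < n ∧ ∀ t ∈ q.2, t < n := by
  rintro ⟨x, d⟩ h
  obtain ⟨s, rfl, a, -, rfl⟩ := mem_actions_transList.1 h
  refine ⟨(e s).2, fun t ht => ?_⟩
  simp only [destList, List.mem_map] at ht
  obtain ⟨j, -, rfl⟩ := ht
  exact j.2

/-- The graph of a Markov decision process. -/
noncomputable def graph (G : MDP S Act AP) (e : S ≃ Fin n) (f : Act ≃ Fin k) : Graph :=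
  Graph.ofActions n (actions (transList G e f) 0) (actions_transList_lt G e f)

theorem exists_edge {x t : ℕ} : (∃ j < (graph G e f).E, (graph G e f).act j = x ∧
    (graph G e f).dst j = t) ↔ (x, t) ∈ edges (actions (transList G e f) 0) := by
  rw [List.mem_iff_getElem]
  refine exists_congr fun j => ⟨fun ⟨(h : j < (edges (actions (transList G e f) 0)).length),
    h1, h2⟩ => ⟨h, ?_⟩, fun ⟨h, h1⟩ => ⟨h, ?_⟩⟩
  · have a1 := List.getD_eq_getElem (l := (edges (actions (transList G e f) 0)).map Prod.fst) 0
      (n := j) (by simpa using h)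
    have a2 := List.getD_eq_getElem (l := (edges (actions (transList G e f) 0)).map Prod.snd) 0
      (n := j) (by simpa using h)
    refine Prod.ext ?_ ?_
    · simpa [graph, Graph.ofActions] using a1.symm.trans h1
    · simpa [graph, Graph.ofActions] using a2.symm.trans h2
  · have a1 := List.getD_eq_getElem (l := (edges (actions (transList G e f) 0)).map Prod.fst) 0
      (n := j) (by simpa using h)
    have a2 := List.getD_eq_getElem (l := (edges (actions (transList G e f) 0)).map Prod.snd) 0
      (n := j) (by simpa using h)
    exact ⟨a1.trans (by simp [h1]), a2.trans (by simp [h1])⟩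

theorem represents_graph (G : MDP S Act AP) (e : S ≃ Fin n) (f : Act ≃ Fin k) :
    (graph G e f).Represents G e where
  n_eq := rfl
  exists_act s a ha := by
    obtain ⟨x, hx, h⟩ := List.mem_iff_getElem.1
      (mem_actions_transList (f := f).2 ⟨s, rfl, a, ha, rfl⟩)
    refine ⟨x, hx, ?_, fun t => ?_⟩
    · refine (List.getD_eq_getElem (l := (actions (transList G e f) 0).map Prod.fst) 0
        (n := x) (by simpa using hx)).trans ?_
      simp [h]
    · rw [exists_edge, mem_edges]
      simp only [h, ← mem_destList (G := G) (e := e)]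
      exact ⟨fun h => ⟨hx, h⟩, fun h => h.2⟩
  exists_mov x hx := by
    replace hx : x < (actions (transList G e f) 0).length := hx
    obtain ⟨s, h1, a, ha, h2⟩ := mem_actions_transList.1 (List.getElem_mem hx)
    refine ⟨s, a, ha, ?_, fun t => ?_⟩
    · refine (List.getD_eq_getElem (l := (actions (transList G e f) 0).map Prod.fst) 0
        (n := x) (by simpa using hx)).trans ?_
      simpa using h1
    · rw [exists_edge, mem_edges, ← mem_destList (G := G) (e := e)]
      exact ⟨fun h => ⟨hx, h2 ▸ h⟩, fun ⟨_, h⟩ => h2 ▸ h⟩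

theorem destList_length (G : MDP S Act AP) (e : S ≃ Fin n) (s : S) (a : Act) :
    (destList G e s a).length = (G.dest s a).ncard := by
  classical
  have h : G.dest s a = (((List.finRange n).filter fun j => e.symm j ∈ G.dest s a).toFinset.map
      e.symm.toEmbedding : Finset S) := by
    ext t
    simp
  conv_rhs => rw [h, Set.ncard_coe_finset, Finset.card_map]
  rw [List.toFinset_card_of_nodup ((List.nodup_finRange n).filter _), destList, List.length_map]

theorem sum_actions (l : List (List (List ℕ))) (x : ℕ) (g : List ℕ → ℕ) :
    ((actions l x).map fun q => g q.2).sum = (l.map fun d => (d.map g).sum).sum := by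
  induction l generalizing x with
  | nil => rfl
  | cons d l ih => simp [actions, ih, Function.comp_def]

/-- One cell for each state and each action, holding a count, and one for each destination. -/
theorem stateWord_length (l : List (List (List ℕ))) :
    (stateWord l).length = l.length + (actions l 0).length + (edges (actions l 0)).length := by
  have h1 := sum_actions l 0 List.length
  have h2 := sum_actions l 0 fun _ => 1
  simp only [List.map_const', List.sum_replicate, smul_eq_mul, mul_one] at h2
  rw [edges_length, h1, h2]
  clear h1 h2
  simp only [stateWord]
  induction l with
  | nil => rfl
  | cons d l ih =>
    have : (d.flatMap destWord).length = d.length + (d.map List.length).sum := by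
      clear ih
      induction d with
      | nil => rfl
      | cons y d ih =>
        simp only [List.flatMap_cons, List.length_append, ih, destWord, List.length_cons,
          List.map_cons, List.sum_cons]
        omega
    simp only [List.flatMap_cons, List.length_append, ih, actWord, List.length_cons,
      List.map_cons, List.sum_cons, this]
    omega

theorem dest_ncard_pos [Finite S] (G : MDP S Act AP) (s : S) (a : Act) :
    0 < (G.dest s a).ncard :=
  (Set.ncard_pos (Set.toFinite _)).2 (G.trans s a).support_nonempty

variable [Fintype S]

theorem graph_E (G : MDP S Act AP) (e : S ≃ Fin n) (f : Act ≃ Fin k) :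
    (graph G e f).E = G.transSize := by
  classical
  have h : (graph G e f).E = (edges (actions (transList G e f) 0)).length := rfl
  rw [h, edges_length, sum_actions, transList, List.map_map, MDP.transSize,
    ← e.symm.sum_comp, Fin.sum_univ_def]
  congr 2
  ext1 i
  simp only [Function.comp, actList, List.map_map]
  rw [← List.sum_toFinset _ ((List.nodup_finRange k).filter _)]
  refine Finset.sum_equiv f.symm (fun j => ?_) fun j _ => destList_length ..
  simp

/-- Every available action has at least one destination, because the support of a distribution is
nonempty. -/
theorem graph_NA_le (G : MDP S Act AP) (e : S ≃ Fin n) (f : Act ≃ Fin k) :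
    (graph G e f).NA ≤ G.transSize := by
  have h : (graph G e f).E = (edges (actions (transList G e f) 0)).length := rfl
  rw [← graph_E G e f, h, edges_length]
  refine le_trans ?_ (List.length_le_sum_of_one_le _ ?_)
  · simp [graph, Graph.ofActions]
  · simp only [List.mem_map, forall_exists_index, and_imp]
    rintro i ⟨x, d⟩ h rfl
    obtain ⟨s, -, a, -, rfl⟩ := mem_actions_transList.1 h
    rw [destList_length]
    exact dest_ncard_pos G s a

theorem card_le_transSize (G : MDP S Act AP) : Fintype.card S ≤ G.transSize := by
  rw [Fintype.card_eq_sum_ones]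
  refine Finset.sum_le_sum fun s _ => ?_
  obtain ⟨a, ha⟩ := G.mov_nonempty s
  exact (Nat.succ_le_of_lt (dest_ncard_pos G s a)).trans
    (Finset.single_le_sum (f := fun a => (G.dest s a).ncard) (fun _ _ => Nat.zero_le _) ha)

end Transitions

end RAM

-- A bound for the symbols of a formula

mutual

theorem StateFormula.encode_le {AP : Type w} (props : List AP) :
    ∀ (ψ : StateFormula AP), ∀ x ∈ ψ.encode props, x ≤ props.length + 14
  | .tt => by simp [StateFormula.encode]
  | .atom q => by
    classical
    have := List.idxOf_le_length (a := q) (l := props)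
    simp [StateFormula.encode]
    convert (show List.idxOf q props + 14 ≤ props.length + 14 by omega) using 1
    rw [add_comm]
  | .neg ψ => by
    have := ψ.encode_le props
    simp only [StateFormula.encode, List.mem_cons]
    rintro x (rfl | h)
    exacts [by omega, this x h]
  | .disj ψ₁ ψ₂ => by
    have h1 := ψ₁.encode_le props
    have h2 := ψ₂.encode_le props
    simp only [StateFormula.encode, List.mem_cons, List.mem_append]
    rintro x (rfl | h | h)
    exacts [by omega, h1 x h, h2 x h]
  | .ex m φ => by
    have h1 := φ.encode_le props
    have := RAM.code_le m
    simp only [StateFormula.encode, List.mem_cons]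
    rintro x (rfl | h)
    exacts [by omega, h1 x h]
  | .all m φ => by
    have h1 := φ.encode_le props
    have := RAM.code_le m
    simp only [StateFormula.encode, List.mem_cons]
    rintro x (rfl | h)
    exacts [by omega, h1 x h]

theorem PathFormula.encode_le {AP : Type w} (props : List AP) :
    ∀ (φ : PathFormula AP), ∀ x ∈ φ.encode props, x ≤ props.length + 14
  | .state ψ => ψ.encode_le props
  | .next ψ => by
    have := ψ.encode_le props
    simp only [PathFormula.encode, List.mem_cons]
    rintro x (rfl | h)
    exacts [by omega, this x h]
  | .until ψ₁ ψ₂ => by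
    have h1 := ψ₁.encode_le props
    have h2 := ψ₂.encode_le props
    simp only [PathFormula.encode, List.mem_cons, List.mem_append]
    rintro x (rfl | h | h)
    exacts [by omega, h1 x h, h2 x h]
  | .wait ψ₁ ψ₂ => by
    have h1 := ψ₁.encode_le props
    have h2 := ψ₂.encode_le props
    simp only [PathFormula.encode, List.mem_cons, List.mem_append]
    rintro x (rfl | h | h)
    exacts [by omega, h1 x h, h2 x h]

end

-- Reading the input, and the main command

namespace RAM

open Exp Cmd

variable {W K : ℕ} {s : Store} {Q : ℕ → Store → Prop}

theorem segment_getD (u v : List ℕ) : Segment (fun i => (u ++ v).getD i 0) u.length v := by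
  induction v generalizing u with
  | nil => trivial
  | cons x v ih =>
    refine ⟨by simp, ?_⟩
    simpa using ih (u ++ [x])

theorem Segment.flatMap {α : Type*} {m : ℕ → ℕ} {a p : ℕ} {l : List α} {F : α → List ℕ}
    (hF : ∀ x, (F x).length = p) (h : Segment m a (l.flatMap F)) (i : ℕ) (hi : i < l.length) :
    Segment m (a + i * p) (F l[i]) := by
  induction l generalizing a i with
  | nil => simp at hi
  | cons x l ih =>
    rw [List.flatMap_cons, segment_append, hF] at h
    cases i with
    | zero => simpa using h.1
    | succ i =>
      have := ih h.2 i (by simpa using hi)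
      rwa [add_assoc, add_comm p, ← Nat.succ_mul] at this

/-- The store with the input in array `0`. -/
def Store.ofInput (u : List ℕ) : Store :=
  ⟨fun _ => 0, fun k i => if k = 0 then u.getD i 0 else 0⟩

/-- Finds the parts of the input. -/
def headerCmd : Cmd :=
  block [.assign 0 (arr 0 (lit 0)), .assign 4 (arr 0 (lit 1)), .assign 3 (arr 0 (lit 2)),
    .assign 21 (addl (var 3) 3), stateLoop .skip .skip, .assign 5 (var 21),
    .loop 10 0 (.assign 21 (add (var 21) (var 4)))]

/-- With empty hooks the traversal only moves the pointer past the transitions, to the beginning of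
the table of labels. -/
theorem hooks_skip : Hooks W K (fun _ _ => True) .skip .skip where
  stable := fun _ _ _ _ _ _ _ => trivial
  wr _ _ _ := ⟨rfl, rfl⟩
  wa := ⟨rfl, rfl⟩
  act _ _ _ := wp_skip ⟨by simp, trivial⟩
  dest _ _ _ _ _ _ := wp_skip ⟨by simp, trivial⟩

/-- The input does not state its own length, which is needed as the base address of the arrays. The
end is found by walking over the transitions and then adding `p` once for each state. -/
theorem wp_headerCmd {n p : ℕ} {w lab : List ℕ} {d : List (List (List ℕ))}
    (hd : d.length = n) (hn : 0 < n) (hlab : lab.length = n * p) (hK : p ≤ K)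
    (hW : W = 3 + w.length + (stateWord d).length + lab.length)
    (hs : s = Store.ofInput ([n, p, w.length] ++ (w ++ (stateWord d ++ lab))))
    (hQ : ∀ t s', t ≤ 200 * (stateWord d).length → s'.arr = s.arr → s'.reg 0 = n → s'.reg 1 = 0 →
      s'.reg 2 = 0 → s'.reg 3 = w.length → s'.reg 4 = p →
      s'.reg 5 = 3 + w.length + (stateWord d).length → s'.reg 6 = 0 → s'.reg 21 = W → Q t s') :
    wp W K headerCmd s Q := by
  have hdn := stateWord_length d
  have hseg : Segment (s.arr 0) (3 + w.length) (stateWord d) := by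
    have := segment_getD ([n, p, w.length] ++ w) (stateWord d ++ lab)
    rw [segment_append] at this
    simp only [List.length_append, List.length_cons, List.length_nil, zero_add,
      List.append_assoc] at this
    rw [hs]
    exact this.1
  have v0 : s.arr 0 0 = n := by simp [hs, Store.ofInput]
  have v1 : s.arr 0 1 = p := by simp [hs, Store.ofInput]
  have v2 : s.arr 0 2 = w.length := by simp [hs, Store.ofInput]
  have hr : ∀ r, s.reg r = 0 := fun r => by simp [hs, Store.ofInput]
  clear hs
  suffices h : wp W K headerCmd s fun t s' => t ≤ 200 * (stateWord d).length ∧ s'.reg 0 = n ∧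
      s'.reg 3 = w.length ∧ s'.reg 4 = p ∧ s'.reg 5 = 3 + w.length + (stateWord d).length ∧
      s'.reg 21 = W by
    refine h.imp fun t s' hf ⟨h1, h2, h3, h4, h5, h6⟩ => hQ t s' h1
      (funext fun k => hf.2 k rfl) h2 ((hf.1 1 rfl).trans (hr 1)) ((hf.1 2 rfl).trans (hr 2))
      h3 h4 h5 ((hf.1 6 rfl).trans (hr 6)) h6
  refine wp_seq (wp_assign ⟨trivial, fun _ => by simp [Exp.eval]; omega⟩ (wp_seq (wp_assign
    ⟨trivial, fun _ => by simp [Exp.eval]; omega⟩ (wp_seq (wp_assign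
    ⟨trivial, fun _ => by simp [Exp.eval]; omega⟩ (wp_seq (wp_assign trivial (wp_seq ?_))))))))
  simp only [Exp.eval, Store.set, v0, v1, v2, Exp.cost, Exp.addrCost]
  refine wp_stateLoop hooks_skip (d := d) (by simp [hd]) (by simpa [add_comm] using hseg)
    (by simp; omega) trivial fun t s1 ht hf h21 _ => wp_seq (wp_assign trivial (wp_seq ?_))
  have e0 : s1.reg 0 = n := (hf.1 0 rfl).trans (by simp)
  have e3 : s1.reg 3 = w.length := (hf.1 3 rfl).trans (by simp)
  have e4 : s1.reg 4 = p := (hf.1 4 rfl).trans (by simp)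
  have e21 : s1.reg 21 = 3 + w.length + (stateWord d).length := by rw [h21]; simp; omega
  refine wp_loop (fun j s' => s'.reg 21 = 3 + w.length + (stateWord d).length + j * p) 4 rfl rfl
    (by decide) (by simp [Store.set, e21]) ?_ ?_
  · rintro j s' hj h10 hf2 h
    have e4' : s'.reg 4 = p := ((hf2.1 4 rfl).trans (by simp [Store.set])).trans e4
    refine wp_assign ⟨trivial, trivial, by simpa [Exp.eval, e4'] using hK⟩ ⟨by simp [Exp.cost], ?_⟩
    simp [Store.set, Exp.eval, h, e4', Nat.succ_mul, add_assoc]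
  · rintro t2 s2 ht2 h10 hf2 h
    simp only [Store.set, Exp.eval, Function.update_of_ne (show (0 : ℕ) ≠ 5 by decide), e0] at h ht2
    refine wp_skip ⟨?_, ?_, ?_, ?_, ?_, ?_⟩
    · simp [Exp.cost]; omega
    · exact ((hf2.1 0 rfl).trans (by simp [Store.set])).trans e0
    · exact ((hf2.1 3 rfl).trans (by simp [Store.set])).trans e3
    · exact ((hf2.1 4 rfl).trans (by simp [Store.set])).trans e4
    · exact ((hf2.1 5 rfl).trans (by simp [Store.set, Exp.eval])).trans e21
    · rw [h, hW, hlab]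

/-- Builds the graph, evaluates the formula and writes the result. -/
def mainCmd : Cmd :=
  block [.assign 21 (addl (var 3) 3), stateLoop recordAct recordDest, linkCmd,
    .loop 7 3 (seq readCmd symbolCmd), pop 7, .loop 10 0 (.store 0 (var 10) (arr 7 (var 10)))]

variable {S : Type u} {Act : Type v} {AP : Type w} {G : MDP S Act AP} {n k : ℕ} {e : S ≃ Fin n} {f : Act ≃ Fin k}
  {props : List AP} {ψ : StateFormula AP}

theorem encodeInput_eq : encodeInput G e f props ψ =
    [n, props.length, (ψ.encode props).length] ++ (ψ.encode props ++ (stateWord (transList G e f) ++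
      (List.finRange n).flatMap fun i => G.encodeLabel props (e.symm i))) := by
  simp only [encodeInput, stateWord_transList, ψ.encode_length, List.append_assoc]

theorem encodeLabel_length (s : S) : (G.encodeLabel props s).length = props.length := by
  simp [MDP.encodeLabel]

theorem length_labels : ((List.finRange n).flatMap fun i => G.encodeLabel props (e.symm i)).length =
    n * props.length := by
  simp [List.length_flatMap, encodeLabel_length]

theorem encodeInput_length : (encodeInput G e f props ψ).length =
    3 + ψ.length + (stateWord (transList G e f)).length + n * props.length := by
  rw [encodeInput_eq]
  simp only [List.length_append, length_labels, ψ.encode_length, List.length_cons, List.length_nil]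
  omega

variable [Fintype S] [MeasurableSpace S] [DiscreteMeasurableSpace S]

/-- Since `n` and `NA` are at most `E`, the sum `n + NA + E` is at most `3 * E`; the evaluation
contributes 4800 and the linear terms fit into the rest. -/
theorem total_time {NA E l t : ℕ} (hn : 0 < n) (hE : n ≤ E) (hNA : NA ≤ E) (hl : 0 < l)
    (ht : t ≤ 1600 * ((n + NA + E) * n) * l) :
    t + 200 * n + 100 * NA + 200 * E + 5 * l + 100 ≤ 6000 * (n * E * l) := by
  have a1 : n ≤ n * E := Nat.le_mul_of_pos_right _ (by omega)
  have a2 : E ≤ n * E := Nat.le_mul_of_pos_left _ hn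
  have a3 : n * E ≤ n * E * l := Nat.le_mul_of_pos_right _ hl
  have a4 : l ≤ n * E * l := Nat.le_mul_of_pos_left _ (by omega)
  have a5 : 1600 * ((n + NA + E) * n) * l ≤ 4800 * (n * E * l) :=
    calc _ ≤ 1600 * ((3 * E) * n) * l := by gcongr; omega
      _ = _ := by ring
  omega

open Classical in
theorem wp_mainCmd (hψ : ∀ q ∈ ψ.atoms, q ∈ props) (hn : 0 < n)
    (hW : W = (encodeInput G e f props ψ).length) (hWK : W ≤ K)
    (ha : s.arr = (Store.ofInput (encodeInput G e f props ψ)).arr) (h0 : s.reg 0 = n)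
    (h1 : s.reg 1 = 0) (h2 : s.reg 2 = 0) (h3 : s.reg 3 = ψ.length) (h4 : s.reg 4 = props.length)
    (h5 : s.reg 5 = 3 + ψ.length + (stateWord (transList G e f)).length) (h6 : s.reg 6 = 0)
    (hQ : ∀ t s', t ≤ 6000 * (n * G.transSize * ψ.length) →
      (∀ z, s'.arr 0 (e z) = if ψ.Sat G z then 1 else 0) → Q t s') :
    wp W K mainCmd s Q := by
  have hS : Fintype.card S = n := by simpa using Fintype.card_congr e
  have hl := encodeInput_length (G := G) (e := e) (f := f) (props := props) (ψ := ψ)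
  have hsl := stateWord_length (transList G e f)
  have hE := graph_E G e f
  have hNA := graph_NA_le G e f
  have hnE := card_le_transSize G
  have hψl : 0 < ψ.length := by cases ψ <;> simp [StateFormula.length]
  have htl : (transList G e f).length = n := by simp [transList]
  change (edges (actions (transList G e f) 0)).length = _ at hE
  change (actions (transList G e f) 0).length ≤ _ at hNA
  rw [hE, htl] at hsl
  set E := G.transSize with hEdef
  have hp : props.length ≤ W := by
    have : 1 * props.length ≤ n * props.length := Nat.mul_le_mul_right _ hn
    omega
  have hseg : Segment (s.arr 0) (3 + ψ.length) (stateWord (transList G e f)) ∧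
      Segment (s.arr 0) 3 (ψ.encode props) ∧
      Segment (s.arr 0) (s.reg 5)
        ((List.finRange n).flatMap fun i => G.encodeLabel props (e.symm i)) := by
    have := segment_getD [n, props.length, (ψ.encode props).length]
      (ψ.encode props ++ (stateWord (transList G e f) ++
        (List.finRange n).flatMap fun i => G.encodeLabel props (e.symm i)))
    rw [← encodeInput_eq, segment_append, segment_append] at this
    simp only [ψ.encode_length, List.length_cons, List.length_nil, zero_add] at this
    rw [h5, ha]
    exact ⟨this.2.1, this.1, this.2.2⟩
  refine wp_seq (wp_assign trivial (wp_seq (wp_stateLoop hooks_record (d := transList G e f) ?_ ?_ ?_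
    ?_ fun t1 s1 ht1 hf1 h21 hI => wp_seq (wp_linkCmd (h := actions_transList_lt G e f) hI ?_ ?_
    fun t2 s2 ht2 hf2 hg2 => wp_seq (wp_loop_iter rfl rfl (by decide) ?_)))))
  · simp [Store.set, h0, htl]
  · simpa [Store.set, Exp.eval, h3, add_comm] using hseg.1
  · simp [Store.set, Exp.eval, h3]; omega
  · constructor <;> simp [Store.set, h1, h2, edges, Segment]
  · exact (hf1.1 0 rfl).trans (by simpa [Store.set] using h0)
  · intro t
    rw [hf1.2 4 rfl]
    simp [Store.set, ha, Store.ofInput]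
  have hgE : (graph G e f).E = E := hE
  have hgn : (graph G e f).NA ≤ E := hNA
  have fr : ∀ r, r ≠ 21 → (stateLoop recordAct recordDest).wr r = false → linkCmd.wr r = false →
      s2.reg r = s.reg r := fun r h1 h2 h3 => by
    rw [hf2.1 r h3, hf1.1 r h2]; simp [Store.set, Function.update_of_ne h1]
  have fa : s2.arr 0 = s.arr 0 := (hf2.2 0 rfl).trans (hf1.2 0 rfl)
  have hready : Ready W K (graph G e f) G e props (ψ.encode props) (s2.set 7 0) := by
    refine ⟨hg2.of_eq (fun r hr => ?_) (fun _ _ _ => rfl), ?_, ?_, fun j hj => ?_, ?_,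
      fun z i hi => ?_, hp.trans hWK, by omega, hn, represents_graph G e f⟩
    · simp [Store.set, Function.update_of_ne (show r ≠ 7 by omega)]
    · simp [Store.set, fr 3 (by decide) rfl rfl, h3, ψ.encode_length]
    · simp [Store.set, fr 4 (by decide) rfl rfl, h4]
    · simpa [Store.set, fa] using hseg.2.1.getElem j hj
    · rw [ψ.encode_length]; omega
    · have e5 : (s2.set 7 0).reg 5 = s.reg 5 := by simp [Store.set, fr 5 (by decide) rfl rfl]
      have e0 : (s2.set 7 0).arr 0 = s.arr 0 := fa
      rw [e5, e0]
      constructor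
      · have : (e z + 1) * props.length ≤ n * props.length := Nat.mul_le_mul_right _ (e z).2
        rw [Nat.succ_mul] at this
        omega
      · have := (hseg.2.2.flatMap (fun _ => encodeLabel_length _) (e z)
          (by simp)).getElem i (by simpa [encodeLabel_length] using hi)
        rw [Nat.add_right_comm, this]
        simp [MDP.encodeLabel]
  have e3 : s2.reg 3 = (ψ.encode props).length := by
    rw [fr 3 (by decide) rfl rfl, h3, ψ.encode_length]
  rw [e3]
  -- The whole formula is evaluated, with nothing to its left or right and an empty stack.
  refine ψ.evaluates hS hn rfl hψ (ψ.encode props) [] [] _ [] _ (by simp) hready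
    (by simp [Store.set]) ⟨by simp [Store.set, fr 6 (by decide) rfl rfl, h6], trivial⟩ ?_
  rintro t3 s3 ht3 hs3 h73 hL3 -
  refine wp_seq (wp_pop hs3.reg_zero (by omega) (by decide) (by decide) hL3
    fun t4 s4 ht4 hf4 hX hL4 => wp_seq ?_)
  have e0 : s4.reg 0 = n := (hf4.1 0 rfl).trans hs3.reg_zero
  -- The result overwrites the beginning of the input, which is no longer needed and has at least
  -- `n` cells.
  refine wp_loop (fun j s' => ∀ i < j, s'.arr 0 i = s4.arr 7 i) 11 rfl rfl (by decide) (by simp) ?_ ?_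
  · rintro j s' hj h10 hf h
    refine wp_store trivial ⟨trivial, by simp⟩ (fun _ => by simp [Exp.eval, h10]; omega)
      ⟨by simp [Exp.cost, Exp.addrCost], fun i hi => ?_⟩
    have e7 : s'.arr 7 = s4.arr 7 := hf.2 7 rfl
    simp only [Store.set, Store.put, Exp.eval, h10, Function.update_self, e7]
    rcases Nat.lt_succ_iff_lt_or_eq.1 hi with hi | rfl
    · rw [Function.update_of_ne hi.ne, h i hi]
    · rw [Function.update_self]
  · rintro t5 s5 ht5 - - h
    rw [e0] at h ht5
    refine wp_skip (hQ _ _ ?_ fun z => ?_)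
    · rw [hgE, ψ.encode_length] at ht3
      rw [ψ.encode_length]
      rw [hE] at ht2
      rw [hsl] at ht1
      have := total_time hn (hS ▸ hnE) hgn hψl (t := t3) ht3
      simp only [Exp.cost]
      change t1 ≤ 100 * (n + (graph G e f).NA + E) + 6 at ht1
      omega
    · rw [h _ (e z).2, hX z]
      rfl

end RAM

-- The bound on the numbers, and the theorem

namespace RAM

open Exp Cmd

/-- The program: `headerCmd`, then the length of the input goes to register `0`, then `mainCmd`. -/
def program : Program :=
  headerCmd.compile 0 ++ (.move 0 (vreg 21) :: mainCmd.compile (headerCmd.size + 1))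

theorem headerCmd_maxLit : headerCmd.maxLit ≤ 100 := by decide

set_option maxRecDepth 4000 in
theorem mainCmd_maxLit : mainCmd.maxLit ≤ 100 := by decide

section Input

variable {S : Type u} {Act : Type v} {AP : Type w} {G : MDP S Act AP} {n k : ℕ} {e : S ≃ Fin n}
  {f : Act ≃ Fin k} {props : List AP} {ψ : StateFormula AP}

/-- Counts and indices are at most the lengths of the parts they describe. Symbols exceed the number
of listed propositions by at most 14, and that number is at most the size of the table because there
is a state. -/
theorem ofInput_below (hn : 0 < n) :
    (Store.ofInput (encodeInput G e f props ψ)).Below ((encodeInput G e f props ψ).length + 14) := by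
  have hl := encodeInput_length (G := G) (e := e) (f := f) (props := props) (ψ := ψ)
  have hsl := stateWord_length (transList G e f)
  have htl : (transList G e f).length = n := by simp [transList]
  have hp : 1 * props.length ≤ n * props.length := Nat.mul_le_mul_right _ hn
  have key : ∀ x ∈ encodeInput G e f props ψ, x ≤ (encodeInput G e f props ψ).length + 14 := by
    have hs : ∀ x ∈ stateWord (transList G e f), x ≤ (stateWord (transList G e f)).length := by
      intro x hx
      obtain ⟨d, hd, hx⟩ := List.mem_flatMap.1 hx
      have h1 : (actWord d).length ≤ (stateWord (transList G e f)).length := by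
        simp only [stateWord]
        rw [List.length_flatMap]
        exact List.le_sum_of_mem (List.mem_map.2 ⟨d, hd, rfl⟩)
      have h2 : d.length ≤ (d.flatMap destWord).length := by
        clear hx hd h1
        induction d with
        | nil => simp
        | cons y d ih =>
          simp only [List.flatMap_cons, List.length_append, destWord, List.length_cons] at ih ⊢
          omega
      simp only [actWord, List.length_cons] at h1 hx
      rcases List.mem_cons.1 hx with rfl | hx
      · omega
      obtain ⟨y, hy, hx⟩ := List.mem_flatMap.1 hx
      have h3 : (destWord y).length ≤ (d.flatMap destWord).length := by
        rw [List.length_flatMap]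
        exact List.le_sum_of_mem (List.mem_map.2 ⟨y, hy, rfl⟩)
      simp only [destWord, List.length_cons] at h3 hx
      rcases List.mem_cons.1 hx with rfl | hx
      · omega
      obtain ⟨i, hi, rfl⟩ := List.mem_map.1 hd
      obtain ⟨j, hj, rfl⟩ := List.mem_map.1 hy
      obtain ⟨z, -, rfl⟩ := List.mem_map.1 hx
      have := z.2
      omega
    intro x hx
    rw [encodeInput_eq] at hx
    simp only [List.mem_append] at hx
    rcases hx with hx | hx | hx | hx
    · have h1 := ψ.encode_length props
      simp only [List.mem_cons, List.not_mem_nil, or_false] at hx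
      omega
    · have := ψ.encode_le props x hx
      omega
    · have := hs x hx
      omega
    · obtain ⟨i, -, hx⟩ := List.mem_flatMap.1 hx
      obtain ⟨q, -, rfl⟩ := List.mem_map.1 hx
      split_ifs <;> omega
  refine ⟨fun r => Nat.zero_le _, fun j i => ?_⟩
  simp only [Store.ofInput]
  split_ifs
  · by_cases hi : i < (encodeInput G e f props ψ).length
    · rw [List.getD_eq_getElem _ _ hi]
      exact key _ (List.getElem_mem hi)
    · rw [List.getD_eq_default _ _ (by omega)]
      omega
  · omega

/-- The arrays other than `0` lie beyond the input, where the memory is zero. -/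
theorem rep_init (u : List ℕ) : Rep u.length (Store.ofInput u) (init u) := by
  refine ⟨fun _ => rfl, fun i _ => rfl, fun k hk i => ?_⟩
  simp only [addr, if_neg hk, Store.ofInput]
  exact List.getD_eq_default _ _ (by omega)

/-- From `7 ≤ W` comes `W + 100 ≤ 16 * W`, which makes the left side a constant times `W ^ 4`. The
constant is absorbed by the exponent because `m < W ^ m`. -/
theorem power_bound {W t C : ℕ} (hW : 7 ≤ W) (ht : t ≤ C * W ^ 3) :
    W + 16 * (W + 14 + t * (W + 100)) + 16 ≤ W ^ (100 + 256 * C) := by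
  have h1 : W + 16 * (W + 14 + t * (W + 100)) + 16 ≤ (52 + 256 * C) * W ^ 4 := by
    have : W + 100 ≤ 16 * W := by omega
    have h2 : t * (W + 100) ≤ C * W ^ 3 * (16 * W) := Nat.mul_le_mul ht this
    have h3 : C * W ^ 3 * (16 * W) = 16 * (C * W ^ 4) := by ring
    have h4 : W ≤ W ^ 4 := Nat.le_self_pow (by omega) _
    have : (52 + 256 * C) * W ^ 4 = 52 * W ^ 4 + 256 * (C * W ^ 4) := by ring
    omega
  refine h1.trans ?_
  calc (52 + 256 * C) * W ^ 4 ≤ W ^ (52 + 256 * C) * W ^ 4 :=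
        Nat.mul_le_mul_right _ (Nat.lt_pow_self (by omega)).le
    _ = W ^ (56 + 256 * C) := by rw [← pow_add]; congr 1; omega
    _ ≤ W ^ (100 + 256 * C) := Nat.pow_le_pow_right (by omega) (by omega)

end Input

end RAM

open RAM in
theorem mainTheorem11 :
    ∃ (P : RAM.Program) (C c : ℕ),
      ∀ (S : Type u) (Act : Type v) (AP : Type w) [Fintype S] [Nonempty S] [MeasurableSpace S]
        [DiscreteMeasurableSpace S] (G : MDP S Act AP) (ψ : StateFormula AP)
        (n k : ℕ) (e : S ≃ Fin n) (f : Act ≃ Fin k) (props : List AP),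
        (∀ q ∈ ψ.atoms, q ∈ props) →
        ∃ t : ℕ, t ≤ C * (Fintype.card S * G.transSize * ψ.length) ∧
          RAM.Halted P (RAM.run P (encodeInput G e f props ψ) t) ∧
          (∀ s : S,
            (ψ.Sat G s → (RAM.run P (encodeInput G e f props ψ) t).mem (e s) = 1) ∧
            (¬ ψ.Sat G s → (RAM.run P (encodeInput G e f props ψ) t).mem (e s) = 0)) ∧
          ∀ t' ≤ t, (RAM.run P (encodeInput G e f props ψ) t').BoundedBy
            ((encodeInput G e f props ψ).length ^ c) := by
  classical
  -- The main command contributes 6000, and the header at most 600 together with the one step that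
  -- sets register `0`.
  refine ⟨program, 7000, 100 + 256 * 7000, fun S Act AP _ _ _ _ G ψ n k e f props hψ => ?_⟩
  have hS : Fintype.card S = n := by simpa using Fintype.card_congr e
  have hn : 0 < n := hS ▸ Fintype.card_pos
  set u := encodeInput G e f props ψ with hu
  have hl : u.length = _ := encodeInput_length
  have hsl := stateWord_length (transList G e f)
  have htl : (transList G e f).length = n := by simp [transList]
  have hE : (edges (actions (transList G e f) 0)).length = _ := graph_E G e f
  have hNA : (actions (transList G e f) 0).length ≤ _ := graph_NA_le G e f
  have hnE := card_le_transSize G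
  have hψl : 0 < ψ.length := by cases ψ <;> simp [StateFormula.length]
  have hp : 1 * props.length ≤ n * props.length := Nat.mul_le_mul_right _ hn
  -- One action and one destination, with the header, a symbol and a state, give the seven cells
  -- required by `power_bound`.
  have hNA1 : 1 ≤ (actions (transList G e f) 0).length := by
    obtain ⟨s⟩ := ‹Nonempty S›
    obtain ⟨a, ha⟩ := G.mov_nonempty s
    exact List.length_pos_of_mem (mem_actions_transList.2 ⟨s, rfl, a, ha, rfl⟩)
  rw [hS] at hnE ⊢
  rw [hE, htl] at hsl
  -- In `K = u.length + 100`, the first term dominates the right summands that depend on the input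
  -- and the second the constants of the program.
  obtain ⟨t₁, s₁, hx₁, ht₁, ha₁, r0, r1, r2, r3, r4, r5, r6, r21⟩ :=
    wp_headerCmd (s := Store.ofInput u) (K := u.length + 100) (W := u.length) (n := n) (p := props.length)
      (w := ψ.encode props)
      (d := transList G e f) (lab := (List.finRange n).flatMap fun i => G.encodeLabel props (e.symm i))
      (Q := fun t s' => t ≤ 200 * (stateWord (transList G e f)).length ∧
        s'.arr = (Store.ofInput u).arr ∧ s'.reg 0 = n ∧ s'.reg 1 = 0 ∧ s'.reg 2 = 0 ∧
        s'.reg 3 = ψ.length ∧ s'.reg 4 = props.length ∧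
        s'.reg 5 = 3 + ψ.length + (stateWord (transList G e f)).length ∧ s'.reg 6 = 0 ∧
        s'.reg 21 = u.length) htl hn length_labels (by omega)
      (by rw [hl, ψ.encode_length, length_labels]) (by rw [hu, encodeInput_eq])
      (by
        rw [ψ.encode_length]
        exact fun t s' h1 h2 h3 h4 h5 h6 h7 h8 h9 h10 => ⟨h1, h2, h3, h4, h5, h6, h7, h8, h9, h10⟩)
  obtain ⟨t₂, s₂, hx₂, ht₂, hres⟩ := wp_mainCmd (K := u.length + 100) (W := u.length) hψ hn
    (congrArg List.length hu)
    (by omega) ha₁ r0 r1 r2 r3 r4 r5 r6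
    (Q := fun t s' => t ≤ 6000 * (n * G.transSize * ψ.length) ∧
      ∀ z, s'.arr 0 (e z) = if ψ.Sat G z then 1 else 0) fun t s' h1 h2 => ⟨h1, h2⟩
  have ht : t₁ + 1 + t₂ ≤ 7000 * (n * G.transSize * ψ.length) := by
    have a1 : n ≤ n * G.transSize := Nat.le_mul_of_pos_right _ (by omega)
    have a2 : G.transSize ≤ n * G.transSize := Nat.le_mul_of_pos_left _ hn
    have a3 : n * G.transSize ≤ n * G.transSize * ψ.length := Nat.le_mul_of_pos_right _ hψl
    omega
  -- Each of the three factors is at most the length of the input.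
  have hcube : n * G.transSize * ψ.length ≤ u.length ^ 3 := by
    calc n * G.transSize * ψ.length ≤ u.length * u.length * u.length := by
          gcongr <;> omega
      _ = u.length ^ 3 := by ring
  have hB := power_bound (W := u.length) (t := t₁ + 1 + t₂) (C := 7000) (by omega)
    (ht.trans (Nat.mul_le_mul_left _ hcube))
  set B := u.length ^ (100 + 256 * 7000) with hBdef
  have hmul : (t₁ + 1 + t₂) * (u.length + 100) =
    t₁ * (u.length + 100) + (u.length + 100) + t₂ * (u.length + 100) := by ring
  have hbelow : (Store.ofInput u).Below (u.length + 14) := ofInput_below hn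
  have hinit : (init u).BoundedBy B := fun i =>
    ⟨Nat.zero_le _, (hbelow.2 0 i).trans (by omega)⟩
  have hP : At program 0 program := fun i h => by
    rw [zero_add, List.getElem?_eq_getElem h]
  have hP' := hP
  simp only [program, at_append, at_cons, Cmd.compile_length, zero_add] at hP'
  rw [← program] at hP'
  obtain ⟨g₁, h₁, pc₁, rep₁, -⟩ := hx₁.goes (P := program) (B := B)
    (headerCmd_maxLit.trans (by omega)) hbelow
    (g := init u) hP'.1 (rep_init u) (Or.inl (by decide)) hinit (by omega)
  have pc₁' : g₁.pc = headerCmd.size := by rw [pc₁]; simp [init]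
  obtain ⟨g₂, h₂, pc₂, reg₂, mem₂⟩ := goes_reg (P := program) (B := B) (c := g₁) 0 u.length
    (by rw [pc₁']; exact hP'.2.1) h₁.bounded (by omega)
    (by rw [Instr.exec, rep₁.1, r21])
  -- Register `0` represents no variable, so setting it to the base address keeps the represented
  -- store.
  have rep₂ : Rep u.length s₁ g₂ := by
    refine ⟨fun v => ?_, by rw [mem₂]; exact rep₁.2⟩
    rw [reg₂, Function.update_of_ne (by simp), rep₁.1]
  obtain ⟨g₃, h₃, pc₃, rep₃, -⟩ := hx₂.goes (P := program) (B := B)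
    (mainCmd_maxLit.trans (by omega))
    (hx₁.store_below (headerCmd_maxLit.trans (by omega)) hbelow) (g := g₂) (by rw [pc₂, pc₁']; exact hP'.2.2) rep₂
    (Or.inr (by simp [reg₂])) h₂.bounded (by omega)
  have hgo := (h₁.trans h₂).trans h₃
  refine ⟨t₁ + 1 + t₂, ht, ?_, fun s => ?_, hgo.2⟩
  · change program.length ≤ ((step program)^[t₁ + 1 + t₂] (init u)).pc
    rw [hgo.1, pc₃, pc₂, pc₁']
    simp [program, Cmd.compile_length]
    omega
  · change (_ → ((step program)^[t₁ + 1 + t₂] (init u)).mem _ = _) ∧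
      (_ → ((step program)^[t₁ + 1 + t₂] (init u)).mem _ = _)
    have hs := (e s).2
    rw [hgo.1, rep₃.2.1 _ (by omega), hres s]
    exact ⟨fun h => if_pos h, fun h => if_neg h⟩
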